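/- Let $M$ be a complete (smooth) Riemannian manifold of dimension $n$ with sectional curvature $\ge 1$, let $\alpha\in[0,\pi)$, and let $\gamma:[\alpha,\pi]\to M$ be a unit speed geodesic. Let $\Lambda$ be an $(n-1)$-dimensional real vector space of Jacobi fields along $\gamma$ that are orthogonal to $\dot\gamma$, and suppose that its Riccati operator $S$, given by $S(J(t))=J'(t)$ for $J\in\Lambda$, is self-adjoint, that is, $$\langle J'(t),K(t)\rangle=\langle J(t),K'(t)\rangle\qquad\text{for all }J,K\in\Lambda,\ t\in[\alpha,\pi].$$ If $\alpha>0$, suppose moreover that the Riccati operator is defined at $\alpha$, i.e. there is a linear map $S(\alpha):\dot\gamma(\alpha)^{\perp}\to\dot\gamma(\alpha)^{\perp}$ with $S(\alpha)J(\alpha)=J'(\alpha)$ for all $J\in\Lambda$, and that all its eigenvalues are $\le\cot\alpha$. (For $\alpha=0$ the bound reads $\cot 0=\infty$ and nothing is assumed.) Put $$Z=\operatorname{span}\{J\in\Lambda : J(t)=0\text{ for some }t\in(\alpha,\pi)\},\qquad P=\{J\in\Lambda : J(t)=\sin(t)\,E(t)\text{ on }[\alpha,\pi]\text{ for some parallel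 field }E\text{ along }\gamma\}.$$ Then $P$ is a linear subspace of $\Lambda$, $\Lambda=Z\oplus P$, and the sum is orthogonal: $\langle J(t),K(t)\rangle=0$ for all $J\in Z$, $K\in P$ and $t\in[\alpha,\pi]$. -/

import Mathlib

open Bundle FiberBundle VectorField
open scoped Manifold ContDiff Topology

noncomputable section
namespace JacobiSplitting
variable {E : Type*} [NormedAddCommGroup E] [NormedSpace ℝ E]
  {H : Type*} [TopologicalSpace H] {I : ModelWithCorners ℝ E H}
  {M : Type*} [TopologicalSpace M] [ChartedSpace H M]
  [RiemannianBundle (fun x : M ↦ TangentSpace I x)]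

/-- The Koszul expression, whose value is `⟨∇_X Y, Z⟩` at `x`. -/
def koszul (X Y Z : Π x : M, TangentSpace I x) (x : M) : ℝ :=
  (1 / 2 : ℝ) *
    (d% (fun y ↦ inner ℝ (Y y) (Z y)) x (X x)
      + d% (fun y ↦ inner ℝ (X y) (Z y)) x (Y x)
      - d% (fun y ↦ inner ℝ (X y) (Y y)) x (Z x)
      + inner ℝ (mlieBracket I X Y x) (Z x)
      - inner ℝ (mlieBracket I X Z x) (Y x)
      - inner ℝ (mlieBracket I Y Z x) (X x))


variable [FiniteDimensional ℝ E] [CompleteSpace E] [IsManifold I ∞ M]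
  [IsContMDiffRiemannianBundle I ∞ E (fun x : M ↦ TangentSpace I x)]

theorem mdiff_inner {X Y : Π x : M, TangentSpace I x} {x : M}
    (hX : MDiffAt (T% X) x) (hY : MDiffAt (T% Y) x) :
    MDiffAt (fun y ↦ inner ℝ (X y) (Y y)) x :=
  MDifferentiableAt.inner_bundle (IB := I) (F := E) (E := fun x : M ↦ TangentSpace I x)
    (b := fun y ↦ y) hX hY

theorem koszul_tensorial_left {Y Z : Π x : M, TangentSpace I x} {x : M}
    (hY : MDiffAt (T% Y) x) (hZ : MDiffAt (T% Z) x) :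
    TensorialAt I E (koszul · Y Z x) x where
  smul {f X} hf hX := by
    simp [koszul, mvfderiv_fun_mul hf (mdiff_inner hX hZ),
      mvfderiv_fun_mul hf (mdiff_inner hX hY), inner_add_left, inner_smul_left,
      inner_smul_right, mlieBracket_smul_left hf hX]
    ring
  add {X X'} hX hX' := by
    simp [koszul, mvfderiv_fun_add (mdiff_inner hX hZ) (mdiff_inner hX' hZ),
      mvfderiv_fun_add (mdiff_inner hX hY) (mdiff_inner hX' hY), inner_add_left,
      inner_add_right, mlieBracket_add_left hX hX']
    ring

theorem koszul_tensorial_right {X Y : Π x : M, TangentSpace I x} {x : M}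
    (hX : MDiffAt (T% X) x) (hY : MDiffAt (T% Y) x) :
    TensorialAt I E (koszul X Y · x) x where
  smul {f Z} hf hZ := by
    simp [koszul, mvfderiv_fun_mul hf (mdiff_inner hX hZ),
      mvfderiv_fun_mul hf (mdiff_inner hY hZ), inner_add_left, inner_smul_left,
      inner_smul_right, mlieBracket_smul_right hf hZ, real_inner_comm]
    ring
  add {Z Z'} hZ hZ' := by
    simp [koszul, mvfderiv_fun_add (mdiff_inner hX hZ) (mdiff_inner hX hZ'),
      mvfderiv_fun_add (mdiff_inner hY hZ) (mdiff_inner hY hZ'), inner_add_left,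
      inner_add_right, mlieBracket_add_right hZ hZ']
    ring

theorem koszul_add_middle {X Y Y' Z : Π x : M, TangentSpace I x} {x : M}
    (hX : MDiffAt (T% X) x) (hY : MDiffAt (T% Y) x) (hY' : MDiffAt (T% Y') x)
    (hZ : MDiffAt (T% Z) x) :
    koszul X (Y + Y') Z x = koszul X Y Z x + koszul X Y' Z x := by
  simp [koszul, mvfderiv_fun_add (mdiff_inner hX hY) (mdiff_inner hX hY'),
      mvfderiv_fun_add (mdiff_inner hY hZ) (mdiff_inner hY' hZ), inner_add_left,
      inner_add_right, mlieBracket_add_right hY hY', mlieBracket_add_left hY hY']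
  ring

theorem koszul_smul_middle {X Y Z : Π x : M, TangentSpace I x} {f : M → ℝ} {x : M}
    (hX : MDiffAt (T% X) x) (hY : MDiffAt (T% Y) x) (hf : MDiffAt f x)
    (hZ : MDiffAt (T% Z) x) :
    koszul X (f • Y) Z x = f x * koszul X Y Z x + d% f x (X x) * inner ℝ (Y x) (Z x) := by
  simp [koszul, mvfderiv_fun_mul hf (mdiff_inner hX hY),
      mvfderiv_fun_mul hf (mdiff_inner hY hZ), inner_add_left, inner_smul_left,
      inner_smul_right, mlieBracket_smul_right hf hY, mlieBracket_smul_left hf hY, real_inner_comm]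
  ring

theorem extend_mdiff {x : M} (v : TangentSpace I x) : MDiffAt (T% (extend E v)) x :=
  mdifferentiableAt_extend ..

instance finiteDimensional_tangentSpace (x : M) : FiniteDimensional ℝ (TangentSpace I x) :=
  inferInstanceAs (FiniteDimensional ℝ E)

instance completeSpace_tangentSpace (x : M) : CompleteSpace (TangentSpace I x) :=
  FiniteDimensional.complete ℝ (TangentSpace I x)

open scoped Classical in
/-- `leviCivitaFun Y x v` is `∇_v Y` at `x`: the vector dual to the linear form given by the
Koszul expression. Where `Y` is not differentiable the value is irrelevant and set to `0`. -/
def leviCivitaFun (Y : Π x : M, TangentSpace I x) (x : M) :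
    TangentSpace I x →L[ℝ] TangentSpace I x :=
  if hY : MDiffAt (T% Y) x then
    LinearMap.toContinuousLinearMap
      { toFun := fun v ↦ (InnerProductSpace.toDual ℝ (TangentSpace I x)).symm
          (TensorialAt.mkHom₂ (fun X Z ↦ koszul X Y Z x) x
            (fun _ hZ ↦ koszul_tensorial_left hY hZ)
            (fun _ hX ↦ koszul_tensorial_right hX hY) v)
        map_add' := fun v w ↦ by simp
        map_smul' := fun c v ↦ by simp }
  else 0

theorem inner_leviCivitaFun {Y : Π x : M, TangentSpace I x} {x : M} (hY : MDiffAt (T% Y) x)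
    (v w : TangentSpace I x) :
    inner ℝ (leviCivitaFun Y x v) w = koszul (extend E v) Y (extend E w) x := by
  simp [leviCivitaFun, hY, TensorialAt.mkHom₂_apply_eq_extend]

/-- The Levi-Civita connection: `leviCivita Y x v` is `∇_v Y` at `x`. -/
def leviCivita : CovariantDerivative I E (TangentSpace I : M → Type _) where
  toFun := leviCivitaFun
  isCovariantDerivativeOnUniv :=
    { add := fun {Y Y' x} hY hY' _ ↦ by
        ext1 v
        refine ext_inner_right ℝ fun w ↦ ?_
        have hYY' : MDiffAt (T% (Y + Y')) x := mdifferentiableAt_add_section hY hY'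
        rw [inner_leviCivitaFun hYY', add_apply, inner_add_left,
          inner_leviCivitaFun hY, inner_leviCivitaFun hY',
          koszul_add_middle (extend_mdiff v) hY hY' (extend_mdiff w)]
      leibniz := fun {Y f x} hY hf _ ↦ by
        ext1 v
        refine ext_inner_right ℝ fun w ↦ ?_
        have hfY : MDiffAt (T% (f • Y)) x := hf.smul_section hY
        rw [inner_leviCivitaFun hfY, koszul_smul_middle (extend_mdiff v) hY hf (extend_mdiff w)]
        simp [inner_add_left, inner_smul_left, inner_leviCivitaFun hY] }

theorem koszul_add_koszul_swap {X Y Z : Π x : M, TangentSpace I x} {x : M} :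
    koszul X Y Z x + koszul X Z Y x = d% (fun y ↦ inner ℝ (Y y) (Z y)) x (X x) := by
  have h : (fun y ↦ (inner ℝ (Z y) (Y y) : ℝ)) = (fun y ↦ inner ℝ (Y y) (Z y)) := by
    ext; rw [real_inner_comm]
  simp only [koszul, h, mlieBracket_swap_apply (V := Z) (W := Y), inner_neg_left]
  ring

theorem inner_leviCivita {X Y Z : Π x : M, TangentSpace I x} {x : M} (hX : MDiffAt (T% X) x)
    (hY : MDiffAt (T% Y) x) (hZ : MDiffAt (T% Z) x) :
    inner ℝ (leviCivita Y x (X x)) (Z x) = koszul X Y Z x := by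
  change inner ℝ (leviCivitaFun Y x (X x)) (Z x) = koszul X Y Z x
  rw [inner_leviCivitaFun hY]
  exact TensorialAt.pointwise₂ (I := I) (F := E) (F' := E) (Φ := fun X Z ↦ koszul X Y Z x)
      (fun _ hZ ↦ koszul_tensorial_left hY hZ) (fun _ hX ↦ koszul_tensorial_right hX hY)
      (extend_mdiff _) hX (extend_mdiff _) hZ (by simp) (by simp)

/-- The Levi-Civita connection is compatible with the metric. -/
theorem leviCivita_metric {X Y Z : Π x : M, TangentSpace I x} {x : M} (hX : MDiffAt (T% X) x)
    (hY : MDiffAt (T% Y) x) (hZ : MDiffAt (T% Z) x) :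
    d% (fun y ↦ inner ℝ (Y y) (Z y)) x (X x) = inner ℝ (leviCivita Y x (X x)) (Z x)
     + inner ℝ (Y x) (leviCivita Z x (X x)) := by
  rw [inner_leviCivita hX hY hZ, real_inner_comm, inner_leviCivita hX hZ hY, koszul_add_koszul_swap]

/-- The Levi-Civita connection is torsion free. -/
theorem leviCivita_torsion : (leviCivita (I := I) (M := M)).torsion = 0 := by
  rw [CovariantDerivative.torsion_eq_zero_iff]
  intro X Y x hX hY
  refine ext_inner_right ℝ fun w ↦ ?_
  have := inner_leviCivita hX hY (extend_mdiff w)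
  have h2 := inner_leviCivita hY hX (extend_mdiff w)
  rw [extend_apply_self] at this h2
  rw [inner_sub_left, this, h2]
  have h : (fun y ↦ (inner ℝ (Y y) (X y) : ℝ)) = (fun y ↦ inner ℝ (X y) (Y y)) := by
    ext; rw [real_inner_comm]
  simp only [koszul, h, mlieBracket_swap_apply (V := Y) (W := X), inner_neg_left, extend_apply_self]
  ring

/-- The curvature tensor `R(u,v)w = ∇_u ∇_v w - ∇_v ∇_u w - ∇_[u,v] w`, computed with the
extensions of `u`, `v`, `w` to vector fields with constant coefficients in a chart around `x`. -/
def curvature {x : M} (u v w : TangentSpace I x) : TangentSpace I x :=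
  leviCivita (fun y ↦ leviCivita (extend E w) y (extend E v y)) x u
    - leviCivita (fun y ↦ leviCivita (extend E w) y (extend E u y)) x v
    - leviCivita (extend E w) x (mlieBracket I (extend E u) (extend E v) x)

/-- The sectional curvature of the plane spanned by `u` and `v`. -/
def sectionalCurvature {x : M} (u v : TangentSpace I x) : ℝ :=
  inner ℝ (curvature u v v) u / (‖u‖ ^ 2 * ‖v‖ ^ 2 - (inner ℝ u v) ^ 2)

variable (I) in
/-- Vector fields along the restriction of the curve `γ` to the parameter set `s`. -/
abbrev FieldAlong (γ : ℝ → M) (s : Set ℝ) : Type _ :=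
  (t : s) → TangentSpace I (γ t)

variable {γ : ℝ → M} {s : Set ℝ}

open scoped Classical in
/-- A field along `γ` on `s`, as a map into the tangent bundle; only its values on `s` matter. -/
def FieldAlong.lift (V : FieldAlong I γ s) (r : ℝ) : TangentBundle I M :=
  ⟨γ r, if h : r ∈ s then V ⟨r, h⟩ else 0⟩

/-- Smoothness of a vector field along `γ` on `s`. -/
def FieldAlong.IsSmooth (V : FieldAlong I γ s) : Prop :=
  ContMDiffOn 𝓘(ℝ, ℝ) I.tangent ∞ V.lift s

variable (I) in
/-- The velocity field of `γ` on `s`. -/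
def velocity (γ : ℝ → M) (s : Set ℝ) : FieldAlong I γ s :=
  fun t ↦ mfderivWithin 𝓘(ℝ, ℝ) I γ s t (1 : ℝ)

/-- The covariant derivative `V'` of a vector field `V` along `γ`. If `e₁, …, eₙ` is the frame of
coordinate fields around `γ t` and `V = ∑ vⁱ eᵢ`, then `V' = ∑ (dvⁱ/dt) eᵢ + ∑ vⁱ ∇_γ' eᵢ`
at the parameter `t`. The extension of `V t` used below has constant coefficients in this frame. -/
def FieldAlong.covDeriv (V : FieldAlong I γ s) : FieldAlong I γ s :=
  fun t ↦
    (trivializationAt E (TangentSpace I) (γ t)).symm (γ t)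
        (derivWithin (fun r ↦ (trivializationAt E (TangentSpace I) (γ t) (V.lift r)).2) s t)
      + leviCivita (extend E (V t)) (γ t) (velocity I γ s t)

variable (I) in
/-- `γ` is a geodesic on `s`. -/
def IsGeodesicOn (γ : ℝ → M) (s : Set ℝ) : Prop :=
  ContMDiffOn 𝓘(ℝ, ℝ) I ∞ γ s ∧ (velocity I γ s).covDeriv = 0

/-- Parallel vector fields along `γ`. -/
def FieldAlong.IsParallel (V : FieldAlong I γ s) : Prop :=
  V.IsSmooth ∧ V.covDeriv = 0

/-- Jacobi fields along `γ`: `J'' + R(J, γ')γ' = 0`. -/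
def FieldAlong.IsJacobi (J : FieldAlong I γ s) : Prop :=
  J.IsSmooth ∧
    ∀ t : s, J.covDeriv.covDeriv t + curvature (J t) (velocity I γ s t) (velocity I γ s t) = 0

/-- Vector fields along `γ` that are orthogonal to `γ`. -/
def FieldAlong.IsNormal (V : FieldAlong I γ s) : Prop :=
  ∀ t : s, inner ℝ (V t) (velocity I γ s t) = 0

variable (I) in
/-- The orthogonal complement of `γ'(t)`. -/
def normalSpace (γ : ℝ → M) (s : Set ℝ) (t : s) : Submodule ℝ (TangentSpace I (γ t)) :=
  (Submodule.span ℝ {velocity I γ s t})ᗮ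

/-- `S` is the Riccati operator of the family `Λ` at the parameter `t`: the endomorphism of
`γ'(t)^⊥` with `S (J t) = J' t` for all `J ∈ Λ`. For an `(n-1)`-dimensional space of normal Jacobi
fields it exists if and only if no nonzero `J ∈ Λ` vanishes at `t`, and it is then unique. -/
def IsRiccatiOperator (Λ : Submodule ℝ (FieldAlong I γ s)) (t : s)
    (S : Module.End ℝ (normalSpace I γ s t)) : Prop :=
  ∀ J ∈ Λ, ∀ v : normalSpace I γ s t,
    (v : TangentSpace I (γ t)) = J t → (S v : TangentSpace I (γ t)) = J.covDeriv t

/-- The Riccati operator `S J = J'` of the family `Λ` is self-adjoint: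
`⟨S J, K⟩ = ⟨J, S K⟩` for all `J, K ∈ Λ`, at every parameter. -/
def RiccatiSelfAdjoint (Λ : Submodule ℝ (FieldAlong I γ s)) : Prop :=
  ∀ J ∈ Λ, ∀ K ∈ Λ, ∀ t : s, inner ℝ (J.covDeriv t) (K t) = inner ℝ (J t) (K.covDeriv t)

end JacobiSplitting

end

/-!
Let `lam` be a linear form on `Λ` that vanishes on `Z`, and let `φ t` be the minimum of `‖J t‖` over
the `J ∈ Λ` with `lam J = 1`. A field of `Λ` that vanishes at `t ∈ (α, π)` lies in `Z`, so `φ` is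
positive there, and varying the minimizer in the direction given by the Riccati operator shows that
`φ'' + φ ≤ 0` in the barrier sense. Together with the bound `cot α` at the left end this forces
`φ = c sin`. Equality in the barrier inequality yields `J' = cot t • J` at `t` for some minimizer
`J` at `t`; such a minimizer does not depend on `t`, and it is the product of the sine and a
parallel field. Hence no nonzero linear form vanishes on `Z + P`. Finally, if `J` vanishes
somewhere in the interior and `E` is parallel with `sin • E ∈ Λ`, self-adjointness makes
`⟪J, E⟫ / sin` constant, hence zero.
-/

noncomputable section

namespace JacobiSplitting

open Filter
open scoped RealInnerProductSpace

/-! ### Comparison with the sine -/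

section Comparison

variable {φ : ℝ → ℝ} {a b t α : ℝ}

theorem deriv_nonneg_of_isLocalMin {f f' : ℝ → ℝ} {d : ℝ}
    (hf : ∀ᶠ r in 𝓝 t, HasDerivAt f (f' r) r) (hf' : HasDerivAt f' d t) (hmin : IsLocalMin f t) :
    0 ≤ d := by
  by_contra! hd
  have hderiv : deriv f =ᶠ[𝓝 t] f' := hf.mono fun r hr ↦ hr.deriv
  have hdd : deriv (deriv f) t = d := by rw [hderiv.deriv_eq, hf'.deriv]
  have hmax : IsLocalMax f t := isLocalMax_of_deriv_deriv_neg (hdd.trans_lt hd)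
    hmin.deriv_eq_zero hf.self_of_nhds.continuousAt
  have hconst : f =ᶠ[𝓝 t] fun _ ↦ f t := by
    filter_upwards [hmin, hmax] with r h₁ h₂ using le_antisymm h₂ h₁
  have hdd₀ : deriv (deriv f) t = 0 := by
    rw [hconst.deriv.deriv_eq]
    simp
  exact hd.ne (hdd.symm.trans hdd₀)

theorem second_deriv_le_of_sq_le {g g' η η' : ℝ → ℝ} {d e : ℝ}
    (hle : ∀ᶠ r in 𝓝 t, η r ^ 2 ≤ g r) (heq : g t = η t ^ 2)
    (hg : ∀ᶠ r in 𝓝 t, HasDerivAt g (g' r) r) (hg' : HasDerivAt g' d t)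
    (hη : ∀ᶠ r in 𝓝 t, HasDerivAt η (η' r) r) (hη' : HasDerivAt η' e t) :
    g' t = 2 * η t * η' t ∧ 2 * η' t ^ 2 + 2 * η t * e ≤ d := by
  have hdiff : ∀ᶠ r in 𝓝 t, HasDerivAt (fun r ↦ g r - η r ^ 2) (g' r - 2 * η r * η' r) r := by
    filter_upwards [hg, hη] with r h₁ h₂
    exact (h₁.sub (h₂.pow 2)).congr_deriv (by simp)
  have hdiff' : HasDerivAt (fun r ↦ g' r - 2 * η r * η' r)
      (d - (2 * η' t ^ 2 + 2 * η t * e)) t :=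
    (hg'.sub ((hη.self_of_nhds.const_mul 2).mul hη')).congr_deriv (by ring)
  have hmin : IsLocalMin (fun r ↦ g r - η r ^ 2) t := by
    filter_upwards [hle] with r hr
    linarith
  exact ⟨sub_eq_zero.1 (hmin.hasDerivAt_eq_zero hdiff.self_of_nhds),
    sub_nonneg.1 (deriv_nonneg_of_isLocalMin hdiff hdiff' hmin)⟩

/-- The inequality `φ'' + φ ≤ 0` at `t` in the barrier sense. The barrier `g` is one for `φ ^ 2`
and `k` plays the role of `φ' / φ`, so that the bound on `d = g''` at `t` reads
`(φ ^ 2)'' ≤ 2 φ' ^ 2 - 2 φ ^ 2`. -/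
def HasSineBarrierAt (φ : ℝ → ℝ) (t : ℝ) : Prop :=
  ∃ g g' : ℝ → ℝ, ∃ k d : ℝ, (∀ᶠ r in 𝓝 t, φ r ^ 2 ≤ g r) ∧ g t = φ t ^ 2 ∧
    (∀ᶠ r in 𝓝 t, HasDerivAt g (g' r) r) ∧ HasDerivAt g' d t ∧ g' t = 2 * k * φ t ^ 2 ∧
    d ≤ 2 * k ^ 2 * φ t ^ 2 - 2 * φ t ^ 2

theorem HasSineBarrierAt.second_deriv_le {η η' : ℝ → ℝ} {e : ℝ} (hφ : HasSineBarrierAt φ t)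
    (hle : ∀ᶠ r in 𝓝 t, η r ≤ φ r) (heq : η t = φ t) (hpos : 0 < φ t)
    (hη : ∀ᶠ r in 𝓝 t, HasDerivAt η (η' r) r) (hη' : HasDerivAt η' e t) : e ≤ -η t := by
  obtain ⟨g, g', k, d, hφg, hgt, hg, hg', hk, hd⟩ := hφ
  rw [← heq] at hgt hk hd hpos
  have hηg : ∀ᶠ r in 𝓝 t, η r ^ 2 ≤ g r := by
    filter_upwards [hφg, hle, hη.self_of_nhds.continuousAt.eventually (lt_mem_nhds hpos)]
      with r h₁ h₂ h₃ using (pow_le_pow_left₀ h₃.le h₂ 2).trans h₁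
  obtain ⟨hfirst, hsecond⟩ := second_deriv_le_of_sq_le hηg hgt hg hg' hη hη'
  have hη't : η' t = k * η t := by
    refine mul_left_cancel₀ (mul_pos two_pos hpos).ne' ?_
    rw [← hfirst, hk]
    ring
  rw [hη't] at hsecond
  exact le_of_mul_le_mul_left (by linarith : η t * e ≤ η t * -η t) hpos

theorem exists_cos_pos_on_Icc (hab : a < b) (hπ : b - a < Real.pi) :
    ∃ κ m : ℝ, 1 < κ ∧ ∀ r ∈ Set.Icc a b, 0 < Real.cos (κ * (r - m)) := by
  have hba : 0 < b - a := sub_pos.2 hab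
  obtain ⟨κ, hκ, hκπ⟩ := exists_between ((one_lt_div hba).2 hπ)
  rw [lt_div_iff₀ hba] at hκπ
  refine ⟨κ, (a + b) / 2, hκ, fun r hr ↦ Real.cos_pos_of_mem_Ioo ⟨?_, ?_⟩⟩
  · nlinarith [hr.1]
  · nlinarith [hr.2]

theorem exists_neg_smul_touching {f σ : ℝ → ℝ} (hf : ContinuousOn f (Set.Icc a b))
    (hσ : ContinuousOn σ (Set.Icc a b)) (hpos : ∀ r ∈ Set.Icc a b, 0 < σ r) (ha : 0 ≤ f a)
    (hb : 0 ≤ f b) (ht : t ∈ Set.Icc a b) (hft : f t < 0) :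
    ∃ c < 0, ∃ t₀ ∈ Set.Ioo a b, c * σ t₀ = f t₀ ∧ ∀ r ∈ Set.Icc a b, c * σ r ≤ f r := by
  obtain ⟨t₀, ht₀, hmin⟩ := isCompact_Icc.exists_isMinOn ⟨t, ht⟩
    (hf.div hσ fun r hr ↦ (hpos r hr).ne')
  have hc : f t₀ / σ t₀ < 0 := (hmin ht).trans_lt (div_neg_of_neg_of_pos hft (hpos t ht))
  have heq : f t₀ / σ t₀ * σ t₀ = f t₀ := div_mul_cancel₀ _ (hpos t₀ ht₀).ne'
  have hft₀ : f t₀ < 0 := heq ▸ mul_neg_of_neg_of_pos hc (hpos t₀ ht₀)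
  refine ⟨_, hc, t₀, ⟨ht₀.1.lt_of_ne ?_, ht₀.2.lt_of_ne ?_⟩, heq,
    fun r hr ↦ (le_div_iff₀ (hpos r hr)).1 (hmin hr)⟩
  · rintro rfl
    exact hft₀.not_ge ha
  · rintro rfl
    exact hft₀.not_ge hb

-- If `φ < u` somewhere, then `u + c cos (κ (· - m))` with suitable `c < 0 < κ - 1` touches `φ` from
-- below, although `η'' + η > 0` for this function `η`.
theorem le_of_hasSineBarrierAt {u u' : ℝ → ℝ} (hab : a < b) (hπ : b - a < Real.pi)
    (hc : ContinuousOn φ (Set.Icc a b)) (hpos : ∀ t ∈ Set.Ioo a b, 0 < φ t)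
    (hbar : ∀ t ∈ Set.Ioo a b, HasSineBarrierAt φ t) (hu : ∀ r, HasDerivAt u (u' r) r)
    (hu' : ∀ r, HasDerivAt u' (-u r) r) (ha : u a ≤ φ a) (hb : u b ≤ φ b)
    (ht : t ∈ Set.Icc a b) : u t ≤ φ t := by
  obtain ⟨κ, m, hκ, hσpos⟩ := exists_cos_pos_on_Icc hab hπ
  by_contra! hlt
  obtain ⟨c, hc₀, t₀, ht₀, heq, hle⟩ := exists_neg_smul_touching
    (hc.sub fun r _ ↦ (hu r).continuousAt.continuousWithinAt)
    (Continuous.continuousOn (by fun_prop)) hσpos (sub_nonneg.2 ha) (sub_nonneg.2 hb) ht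
    (sub_neg.2 hlt)
  have hlin (r : ℝ) : HasDerivAt (fun r ↦ κ * (r - m)) (κ * 1) r :=
    ((hasDerivAt_id r).sub_const m).const_mul κ
  simp only [Pi.sub_apply] at heq hle
  have hη (r : ℝ) : HasDerivAt (fun r ↦ u r + c * Real.cos (κ * (r - m)))
      (u' r - c * κ * Real.sin (κ * (r - m))) r :=
    ((hu r).add ((hlin r).cos.const_mul c)).congr_deriv (by ring)
  have hη' : HasDerivAt (fun r ↦ u' r - c * κ * Real.sin (κ * (r - m)))
      (-u t₀ - c * κ ^ 2 * Real.cos (κ * (t₀ - m))) t₀ :=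
    ((hu' t₀).sub ((hlin t₀).sin.const_mul (c * κ))).congr_deriv (by ring)
  have hbelow : ∀ᶠ r in 𝓝 t₀, u r + c * Real.cos (κ * (r - m)) ≤ φ r := by
    filter_upwards [Icc_mem_nhds ht₀.1 ht₀.2] with r hr
    linarith [hle r hr]
  have hsecond := (hbar t₀ ht₀).second_deriv_le hbelow (by linarith) (hpos t₀ ht₀)
    (Filter.Eventually.of_forall hη) hη'
  have : 0 < -c * (κ ^ 2 - 1) * Real.cos (κ * (t₀ - m)) :=
    mul_pos (mul_pos (neg_pos.2 hc₀) (by nlinarith)) (hσpos t₀ (Set.Ioo_subset_Icc_self ht₀))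
  linarith

/-- The comparison inequality for `φ'' + φ ≤ 0` on `s`: on each `[a, b]` with end points in `s`,
`φ` lies above the solution of `u'' + u = 0` with the same boundary values. The denominator
`sin (b - a)` is cleared, so the notion is meant for sets of diameter at most `π`. -/
def SineConcaveOn (φ : ℝ → ℝ) (s : Set ℝ) : Prop :=
  ∀ a ∈ s, ∀ b ∈ s, ∀ t ∈ Set.Icc a b,
    φ a * Real.sin (b - t) + φ b * Real.sin (t - a) ≤ φ t * Real.sin (b - a)

theorem hasDerivAt_sin_const_sub (b r : ℝ) :
    HasDerivAt (fun r ↦ Real.sin (b - r)) (-Real.cos (b - r)) r :=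
  ((hasDerivAt_id r).const_sub b).sin.congr_deriv (mul_neg_one _)

theorem hasDerivAt_sin_sub_const (a r : ℝ) :
    HasDerivAt (fun r ↦ Real.sin (r - a)) (Real.cos (r - a)) r :=
  ((hasDerivAt_id r).sub_const a).sin.congr_deriv (mul_one _)

theorem mul_sin_add_mul_sin_le_of_hasSineBarrierAt (hab : a < b) (hπ : b - a < Real.pi)
    (hc : ContinuousOn φ (Set.Icc a b)) (hpos : ∀ t ∈ Set.Ioo a b, 0 < φ t)
    (hbar : ∀ t ∈ Set.Ioo a b, HasSineBarrierAt φ t) (ht : t ∈ Set.Icc a b) :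
    φ a * Real.sin (b - t) + φ b * Real.sin (t - a) ≤ φ t * Real.sin (b - a) := by
  have hs : 0 < Real.sin (b - a) := Real.sin_pos_of_pos_of_lt_pi (sub_pos.2 hab) hπ
  rw [← div_le_iff₀ hs]
  refine le_of_hasSineBarrierAt (t := t)
    (u := fun r ↦ (φ a * Real.sin (b - r) + φ b * Real.sin (r - a)) / Real.sin (b - a))
    (u' := fun r ↦ (-φ a * Real.cos (b - r) + φ b * Real.cos (r - a)) / Real.sin (b - a))
    hab hπ hc hpos hbar (fun r ↦ ?_) (fun r ↦ ?_) (by simp [hs.ne']) (by simp [hs.ne']) ht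
  · exact ((((hasDerivAt_sin_const_sub b r).const_mul (φ a)).add
      ((hasDerivAt_sin_sub_const a r).const_mul (φ b))).div_const _).congr_deriv (by ring)
  · have hcos₁ : HasDerivAt (fun r ↦ Real.cos (b - r)) (-Real.sin (b - r) * (-1)) r :=
      ((hasDerivAt_id r).const_sub b).cos
    have hcos₂ : HasDerivAt (fun r ↦ Real.cos (r - a)) (-Real.sin (r - a) * 1) r :=
      ((hasDerivAt_id r).sub_const a).cos
    exact (((hcos₁.const_mul (-φ a)).add (hcos₂.const_mul (φ b))).div_const _).congr_deriv (by ring)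

theorem sineConcaveOn_of_hasSineBarrierAt {s : Set ℝ} (hs : s.OrdConnected)
    (hdiam : ∀ a ∈ s, ∀ b ∈ s, b - a < Real.pi) (hc : ContinuousOn φ s)
    (hpos : ∀ t ∈ interior s, 0 < φ t) (hbar : ∀ t ∈ interior s, HasSineBarrierAt φ t) :
    SineConcaveOn φ s := by
  intro a ha b hb t ht
  rcases (ht.1.trans ht.2).eq_or_lt with rfl | hab
  · simp [le_antisymm ht.2 ht.1]
  · have hsub : Set.Ioo a b ⊆ interior s :=
      interior_maximal (Set.Ioo_subset_Icc_self.trans (hs.out ha hb)) isOpen_Ioo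
    exact mul_sin_add_mul_sin_le_of_hasSineBarrierAt hab (hdiam a ha b hb)
      (hc.mono (hs.out ha hb)) (fun r hr ↦ hpos r (hsub hr)) (fun r hr ↦ hbar r (hsub hr)) ht

theorem SineConcaveOn.mono {s s' : Set ℝ} (h : SineConcaveOn φ s) (hs : s' ⊆ s) :
    SineConcaveOn φ s' :=
  fun a ha b hb ↦ h a (hs ha) b (hs hb)

theorem SineConcaveOn.comp_const_sub {s : Set ℝ} (h : SineConcaveOn φ s) (c : ℝ) :
    SineConcaveOn (fun t ↦ φ (c - t)) ((c - ·) ⁻¹' s) := by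
  intro a ha b hb t ht
  have := h (c - b) hb (c - a) ha (c - t) ⟨by linarith [ht.2], by linarith [ht.1]⟩
  simp only [sub_sub_sub_cancel_left] at this
  linarith

theorem SineConcaveOn.mul_sin_le_mul_sin (h : SineConcaveOn φ (Set.Ico a Real.pi)) (ha : 0 ≤ a)
    (hφ : ∀ r ∈ Set.Ioo a Real.pi, 0 ≤ φ r) (ht : t ∈ Set.Ico a Real.pi) :
    φ a * Real.sin t ≤ φ t * Real.sin a := by
  have hlim (c x : ℝ) : Filter.Tendsto (fun b ↦ c * Real.sin (b - x)) (𝓝[<] Real.pi)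
      (𝓝 (c * Real.sin x)) := by
    rw [← Real.sin_pi_sub x]
    exact (Continuous.tendsto (by fun_prop) _).mono_left nhdsWithin_le_nhds
  refine le_of_tendsto_of_tendsto (hlim (φ a) t) (hlim (φ t) a) ?_
  filter_upwards [Ioo_mem_nhdsLT ht.2] with b hb
  have hab : a < b := ht.1.trans_lt hb.1
  have := h a ⟨le_rfl, hab.trans hb.2⟩ b ⟨hab.le, hb.2⟩ t ⟨ht.1, hb.1.le⟩
  have : 0 ≤ φ b * Real.sin (t - a) := mul_nonneg (hφ b ⟨hab, hb.2⟩)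
    (Real.sin_nonneg_of_nonneg_of_le_pi (sub_nonneg.2 ht.1) (by linarith [ht.2]))
  linarith

theorem SineConcaveOn.eq_mul_sin (h : SineConcaveOn φ (Set.Ioo 0 Real.pi))
    (hφ : ∀ r ∈ Set.Ioo 0 Real.pi, 0 ≤ φ r) (ht : t ∈ Set.Ioo 0 Real.pi) :
    φ t = φ (Real.pi / 2) * Real.sin t := by
  -- `φ / sin` is nondecreasing, and the reflection `t ↦ π - t` shows that it is nonincreasing.
  have hmono {ψ : ℝ → ℝ} (hψ : SineConcaveOn ψ (Set.Ioo 0 Real.pi))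
      (hψ₀ : ∀ r ∈ Set.Ioo 0 Real.pi, 0 ≤ ψ r) {x y : ℝ} (hx : 0 < x) (hxy : x ≤ y)
      (hy : y < Real.pi) : ψ x * Real.sin y ≤ ψ y * Real.sin x :=
    (hψ.mono fun r hr ↦ ⟨hx.trans_le hr.1, hr.2⟩).mul_sin_le_mul_sin hx.le
      (fun r hr ↦ hψ₀ r ⟨hx.trans hr.1, hr.2⟩) ⟨hxy, hy⟩
  have hanti {x y : ℝ} (hx : 0 < x) (hxy : x ≤ y) (hy : y < Real.pi) :
      φ y * Real.sin x ≤ φ x * Real.sin y := by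
    have := hmono
      ((h.comp_const_sub Real.pi).mono fun r hr ↦ ⟨by linarith [hr.2], by linarith [hr.1]⟩)
      (fun r hr ↦ hφ _ ⟨by linarith [hr.2], by linarith [hr.1]⟩)
      (sub_pos.2 hy) (sub_le_sub_left hxy Real.pi) (sub_lt_self _ hx)
    simpa using this
  rcases le_total t (Real.pi / 2) with hle | hle
  · have h₁ := hmono h hφ ht.1 hle (by linarith [Real.pi_pos])
    have h₂ := hanti ht.1 hle (by linarith [Real.pi_pos])
    rw [Real.sin_pi_div_two] at h₁ h₂
    linarith
  · have h₁ := hmono h hφ (by positivity) hle ht.2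
    have h₂ := hanti (by positivity) hle ht.2
    rw [Real.sin_pi_div_two] at h₁ h₂
    linarith

theorem SineConcaveOn.le_of_hasDerivWithinAt {g : ℝ → ℝ} {k : ℝ}
    (h : SineConcaveOn φ (Set.Icc a b)) (hab : a < b) (hπ : b - a ≤ Real.pi)
    (hle : ∀ r ∈ Set.Icc a b, φ r ≤ g r) (heq : g a = φ a)
    (hg : HasDerivWithinAt g k (Set.Ioi a) a) :
    φ b ≤ k * Real.sin (b - a) + φ a * Real.cos (b - a) := by
  have hslope : HasDerivWithinAt
      (fun t ↦ g t * Real.sin (b - a) - φ a * Real.sin (b - t) - φ b * Real.sin (t - a))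
      (k * Real.sin (b - a) + φ a * Real.cos (b - a) - φ b) (Set.Ioi a) a :=
    (((hg.mul_const _).sub ((hasDerivAt_sin_const_sub b a).hasDerivWithinAt.const_mul _)).sub
      ((hasDerivAt_sin_sub_const a a).hasDerivWithinAt.const_mul _)).congr_deriv (by simp)
  rw [hasDerivWithinAt_iff_tendsto_slope, Set.sdiff_singleton_eq_self (by simp)] at hslope
  refine sub_nonneg.1 (ge_of_tendsto hslope ?_)
  filter_upwards [Ioo_mem_nhdsGT hab] with t ht
  have hmem := Set.Ioo_subset_Icc_self ht
  have hconc := h a ⟨le_rfl, hab.le⟩ b ⟨hab.le, le_rfl⟩ t hmem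
  have hgt := mul_le_mul_of_nonneg_right (hle t hmem)
    (Real.sin_nonneg_of_nonneg_of_le_pi (sub_nonneg.2 hab.le) hπ)
  rw [slope_def_field]
  refine div_nonneg ?_ (sub_nonneg.2 ht.1.le)
  simp only [heq, sub_self, Real.sin_zero]
  linarith

theorem SineConcaveOn.eq_div_sin_mul_sin (h : SineConcaveOn φ (Set.Ico α Real.pi)) (hα : 0 < α)
    (hφ : ∀ r ∈ Set.Ioo α Real.pi, 0 ≤ φ r) {g : ℝ → ℝ} {k : ℝ}
    (hle : ∀ r ∈ Set.Icc α Real.pi, φ r ≤ g r) (heq : g α = φ α)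
    (hg : HasDerivWithinAt g k (Set.Ioi α) α) (hk : k ≤ Real.cot α * φ α)
    (ht : t ∈ Set.Ioo α Real.pi) : φ t = φ α / Real.sin α * Real.sin t := by
  have hsα : 0 < Real.sin α := Real.sin_pos_of_pos_of_lt_pi hα (ht.1.trans ht.2)
  refine le_antisymm ?_ ?_
  · have hupper := (h.mono (Set.Icc_subset_Ico_right ht.2)).le_of_hasDerivWithinAt ht.1
      (by linarith [ht.2]) (fun r hr ↦ hle r ⟨hr.1, hr.2.trans ht.2.le⟩) heq hg
    have hsin : 0 ≤ Real.sin (t - α) :=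
      Real.sin_nonneg_of_nonneg_of_le_pi (sub_nonneg.2 ht.1.le) (by linarith [ht.2])
    calc φ t ≤ k * Real.sin (t - α) + φ α * Real.cos (t - α) := hupper
      _ ≤ Real.cot α * φ α * Real.sin (t - α) + φ α * Real.cos (t - α) := by gcongr
      _ = φ α / Real.sin α * Real.sin t := by
        nth_rw 3 [← sub_add_cancel t α]
        rw [Real.sin_add, Real.cot_eq_cos_div_sin]
        field_simp
  · rw [div_mul_eq_mul_div, div_le_iff₀ hsα]
    exact h.mul_sin_le_mul_sin hα.le hφ ⟨ht.1.le, ht.2⟩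

theorem exists_eq_mul_sin_of_hasSineBarrierAt (hα : 0 ≤ α)
    (hc : ContinuousOn φ (Set.Ioo α Real.pi)) (hpos : ∀ t ∈ Set.Ioo α Real.pi, 0 < φ t)
    (hbar : ∀ t ∈ Set.Ioo α Real.pi, HasSineBarrierAt φ t)
    (hleft : 0 < α → ContinuousWithinAt φ (Set.Ici α) α ∧ ∃ (g : ℝ → ℝ) (k : ℝ),
      (∀ r ∈ Set.Icc α Real.pi, φ r ≤ g r) ∧ g α = φ α ∧
      HasDerivWithinAt g k (Set.Ioi α) α ∧ k ≤ Real.cot α * φ α) :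
    ∃ c : ℝ, ∀ t ∈ Set.Ioo α Real.pi, φ t = c * Real.sin t := by
  rcases hα.eq_or_lt with rfl | hα₀
  · refine ⟨φ (Real.pi / 2), fun t ht ↦ SineConcaveOn.eq_mul_sin ?_ (fun r hr ↦ (hpos r hr).le) ht⟩
    exact sineConcaveOn_of_hasSineBarrierAt Set.ordConnected_Ioo
      (fun a ha b hb ↦ by linarith [ha.1, hb.2]) hc (by simpa using hpos) (by simpa using hbar)
  · obtain ⟨hcα, g, k, hle, heq, hg, hk⟩ := hleft hα₀
    have hcont : ContinuousOn φ (Set.Ico α Real.pi) := fun r hr ↦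
      hr.1.eq_or_lt.elim (fun h ↦ h ▸ hcα.mono Set.Ico_subset_Ici_self) fun h ↦
        (hc.continuousAt (Ioo_mem_nhds h hr.2)).continuousWithinAt
    have hconc : SineConcaveOn φ (Set.Ico α Real.pi) :=
      sineConcaveOn_of_hasSineBarrierAt Set.ordConnected_Ico
        (fun a ha b hb ↦ by linarith [ha.1, hb.2]) hcont (by simpa using hpos) (by simpa using hbar)
    exact ⟨φ α / Real.sin α, fun t ht ↦
      hconc.eq_div_sin_mul_sin hα₀ (fun r hr ↦ (hpos r hr).le) hle heq hg hk ht⟩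

end Comparison

section QuadraticForms

variable {Λ ι : Type*} [AddCommGroup Λ] [Module ℝ Λ] [FiniteDimensional ℝ Λ] {l : Filter ι}
  {Q : ι → LinearMap.BilinForm ℝ Λ} {Q₀ : LinearMap.BilinForm ℝ Λ}

theorem eventually_pos_of_tendsto_posDef (hlim : ∀ x y, Tendsto (fun i ↦ Q i x y) l (𝓝 (Q₀ x y)))
    (hpos : ∀ x, x ≠ 0 → 0 < Q₀ x x) : ∀ᶠ i in l, ∀ x, x ≠ 0 → 0 < Q i x x := by
  let n := Module.finrank ℝ Λ
  let b : Module.Basis (Fin n) ℝ Λ := Module.finBasis ℝ Λ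
  let gram (B : LinearMap.BilinForm ℝ Λ) : Fin n → Fin n → ℝ := fun j k ↦ B (b j) (b k)
  let q (A : Fin n → Fin n → ℝ) (v : Fin n → ℝ) : ℝ := ∑ j, ∑ k, v j * (v k * A k j)
  have hq (B : LinearMap.BilinForm ℝ Λ) (v) : B (b.equivFun.symm v) (b.equivFun.symm v) =
      q (gram B) v := by
    simp [q, gram, Module.Basis.equivFun_symm_apply, Finset.mul_sum, LinearMap.sum_apply]
  have hgram : Tendsto (fun i ↦ gram (Q i)) l (𝓝 (gram Q₀)) :=
    tendsto_pi_nhds.2 fun j ↦ tendsto_pi_nhds.2 fun k ↦ hlim (b j) (b k)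
  have hsphere : ∀ᶠ A in 𝓝 (gram Q₀), ∀ v ∈ Metric.sphere (0 : Fin n → ℝ) 1, 0 < q A v := by
    refine (isCompact_sphere _ _).eventually_forall_of_forall_eventually fun v hv ↦ ?_
    have hcont : Continuous fun z : (Fin n → Fin n → ℝ) × (Fin n → ℝ) ↦ q z.1 z.2 := by
      fun_prop
    have hv₀ : b.equivFun.symm v ≠ 0 :=
      (LinearEquiv.map_ne_zero_iff _).2 (ne_zero_of_mem_unit_sphere ⟨v, hv⟩)
    exact hcont.continuousAt.eventually (lt_mem_nhds ((hpos _ hv₀).trans_eq (hq Q₀ v)))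
  filter_upwards [hgram.eventually hsphere] with i hi x hx
  have hv : b.equivFun x ≠ 0 := (LinearEquiv.map_ne_zero_iff _).2 hx
  have hpos_unit := hi (‖b.equivFun x‖⁻¹ • b.equivFun x) (by
    rw [mem_sphere_zero_iff_norm, norm_smul, norm_inv, norm_norm,
      inv_mul_cancel₀ (norm_ne_zero_iff.2 hv)])
  rw [← hq (Q i)] at hpos_unit
  simp only [map_smul, LinearEquiv.symm_apply_apply, LinearMap.smul_apply, smul_eq_mul,
    ← mul_assoc] at hpos_unit
  exact pos_of_mul_pos_right hpos_unit (by positivity)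

theorem eventually_mul_le_of_tendsto_posDef
    (hlim : ∀ x y, Tendsto (fun i ↦ Q i x y) l (𝓝 (Q₀ x y)))
    (hpos : ∀ x, x ≠ 0 → 0 < Q₀ x x) {θ : ℝ} (hθ : θ < 1) :
    ∀ᶠ i in l, ∀ x, θ * Q₀ x x ≤ Q i x x := by
  have hlim' : ∀ x y, Tendsto (fun i ↦ (Q i - θ • Q₀) x y) l (𝓝 (((1 - θ) • Q₀) x y)) := by
    intro x y
    simp only [LinearMap.sub_apply, LinearMap.smul_apply, smul_eq_mul, one_sub_mul]
    exact (hlim x y).sub_const _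
  filter_upwards [eventually_pos_of_tendsto_posDef hlim'
    fun x hx ↦ mul_pos (sub_pos.2 hθ) (hpos x hx)] with i hi x
  rcases eq_or_ne x 0 with rfl | hx
  · simp
  · simpa using (hi x hx).le

end QuadraticForms

/-! ### Self-adjoint Riccati families -/

section Calculus

variable {s : Set ℝ} {f f' : ℝ → ℝ} {a b d t : ℝ}

theorem tendsto_div_sq_of_hasDerivWithinAt (hs : Convex ℝ s) (ht : t ∈ s)
    (hf : ∀ r ∈ s, HasDerivWithinAt f (f' r) s r) (hf' : HasDerivWithinAt f' d s t)
    (hft : f t = 0) (hft' : f' t = 0) :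
    Tendsto (fun r ↦ f r / (r - t) ^ 2) (𝓝[s \ {t}] t) (𝓝 (d / 2)) := by
  rw [Metric.tendsto_nhdsWithin_nhds]
  intro ε hε
  have hlinear : ∀ᶠ r in 𝓝[s] t, ‖f' r - d * (r - t)‖ ≤ ε / 2 * ‖r - t‖ := by
    simpa [hft', mul_comm] using (hasDerivWithinAt_iff_isLittleO.1 hf').def (half_pos hε)
  obtain ⟨δ, hδ, hball⟩ := Metric.nhdsWithin_basis_ball.eventually_iff.1 hlinear
  refine ⟨δ, hδ, fun {r} hr hrt ↦ ?_⟩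
  have hsub : segment ℝ t r ⊆ Metric.ball t δ ∩ s :=
    ((convex_ball t δ).inter hs).segment_subset ⟨Metric.mem_ball_self hδ, ht⟩ ⟨hrt, hr.1⟩
  have hderiv : ∀ x ∈ segment ℝ t r,
      HasDerivWithinAt (fun x ↦ f x - d / 2 * (x - t) ^ 2) (f' x - d * (x - t)) (segment ℝ t r) x :=
    fun x hx ↦ (((hf x (hsub hx).2).mono (hsub.trans Set.inter_subset_right)).sub
      ((((hasDerivAt_id x).sub_const t).pow 2).const_mul (d / 2)).hasDerivWithinAt).congr_deriv
        (by simp only [id, Nat.cast_ofNat]; ring)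
  have hbound : ∀ x ∈ segment ℝ t r, ‖f' x - d * (x - t)‖ ≤ ε / 2 * ‖r - t‖ := fun x hx ↦
    (hball (hsub hx)).trans (by gcongr; exact norm_sub_le_of_mem_segment hx)
  have hrt₀ : 0 < ‖r - t‖ := norm_pos_iff.2 (sub_ne_zero.2 hr.2)
  have hmv := Convex.norm_image_sub_le_of_norm_hasDerivWithin_le hderiv hbound
    (convex_segment t r) (left_mem_segment ℝ t r) (right_mem_segment ℝ t r)
  simp only [hft, sub_self] at hmv
  rw [dist_eq_norm, div_sub' (pow_ne_zero 2 (sub_ne_zero.2 hr.2)), norm_div, norm_pow,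
    div_lt_iff₀ (by positivity)]
  calc ‖f r - (r - t) ^ 2 * (d / 2)‖ ≤ ε / 2 * ‖r - t‖ * ‖r - t‖ := by
        simpa [mul_comm] using hmv
    _ < ε * ‖r - t‖ ^ 2 := by nlinarith [mul_pos hε (pow_pos hrt₀ 2)]

theorem eq_of_hasDerivAt_zero_off_isolated (hab : a ≤ b) (hc : ContinuousOn f (Set.Icc a b))
    (hf : ∀ t ∈ Set.Icc a b, ∀ᶠ r in 𝓝[≠] t, HasDerivAt f 0 r) : f a = f b := by
  have hfinite : (Set.Icc a b \ {r | HasDerivAt f 0 r}).Finite := by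
    refine isCompact_Icc.finite_sdiff_of_mem_codiscreteWithin ?_
    exact mem_codiscreteWithin_iff_forall_mem_nhdsNE.2 fun t ht ↦
      mem_of_superset (hf t ht) Set.subset_union_left
  have hintegral := MeasureTheory.integral_eq_of_hasDerivAt_off_countable_of_le f (fun _ ↦ 0) hab
    hfinite.countable hc
    (fun r hr ↦ not_not.1 fun h ↦ hr.2 ⟨Set.Ioo_subset_Icc_self hr.1, h⟩)
    intervalIntegrable_const
  simpa [eq_comm, sub_eq_zero] using hintegral

end Calculus

section Minimizer

variable {Λ E : Type*} [AddCommGroup Λ] [Module ℝ Λ] [NormedAddCommGroup E] [InnerProductSpace ℝ E]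
  {T : Λ →ₗ[ℝ] E} {lam : Λ →ₗ[ℝ] ℝ} {J K : Λ}

/-- The infimum of `‖T J‖` over the affine hyperplane `lam J = 1`. -/
def minNorm (T : Λ →ₗ[ℝ] E) (lam : Λ →ₗ[ℝ] ℝ) : ℝ :=
  sInf ((fun J ↦ ‖T J‖) '' {J | lam J = 1})

/-- The variational characterization of the minimizers of `‖T J‖` over the affine hyperplane
`lam J = 1`. -/
structure IsMinimizer (T : Λ →ₗ[ℝ] E) (lam : Λ →ₗ[ℝ] ℝ) (J : Λ) : Prop where
  apply_eq_one : lam J = 1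
  inner_eq_zero : ∀ L, lam L = 0 → ⟪T J, T L⟫ = 0

theorem minNorm_nonneg : 0 ≤ minNorm T lam :=
  Real.sInf_nonneg (Set.forall_mem_image.2 fun _ _ ↦ norm_nonneg _)

theorem minNorm_le (hJ : lam J = 1) : minNorm T lam ≤ ‖T J‖ :=
  csInf_le ⟨0, Set.forall_mem_image.2 fun _ _ ↦ norm_nonneg _⟩ ⟨J, hJ, rfl⟩

theorem IsMinimizer.norm_sq_eq_add (hJ : IsMinimizer T lam J) (hK : lam K = 1) :
    ‖T K‖ ^ 2 = ‖T J‖ ^ 2 + ‖T (K - J)‖ ^ 2 := by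
  have horth : ⟪T J, T (K - J)⟫ = 0 := hJ.inner_eq_zero _ (by simp [hJ.apply_eq_one, hK])
  conv_lhs => rw [← add_sub_cancel J K, map_add, norm_add_sq_real, horth, mul_zero, add_zero]

theorem IsMinimizer.minNorm_eq (hJ : IsMinimizer T lam J) : minNorm T lam = ‖T J‖ := by
  refine (minNorm_le hJ.apply_eq_one).antisymm
    (le_csInf ⟨_, J, hJ.apply_eq_one, rfl⟩ (Set.forall_mem_image.2 fun K hK ↦ ?_))
  exact le_of_sq_le_sq ((le_add_of_nonneg_right (sq_nonneg _)).trans_eq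
    (hJ.norm_sq_eq_add hK).symm) (norm_nonneg _)

theorem IsMinimizer.minNorm_pos (hJ : IsMinimizer T lam J) (hker : ∀ L, T L = 0 → lam L = 0) :
    0 < minNorm T lam := by
  rw [hJ.minNorm_eq, norm_pos_iff]
  exact fun h ↦ one_ne_zero (hJ.apply_eq_one.symm.trans (hker J h))

theorem exists_apply_eq_one (hlam : lam ≠ 0) : ∃ J, lam J = 1 :=
  LinearMap.surjective hlam 1

theorem exists_isMinimizer [FiniteDimensional ℝ Λ] (hlam : lam ≠ 0) :
    ∃ J, IsMinimizer T lam J := by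
  obtain ⟨J, hJ⟩ := exists_apply_eq_one hlam
  let W : Submodule ℝ E := (LinearMap.ker lam).map T
  obtain ⟨L, hL, hLW⟩ : W.starProjection (T J) ∈ W := W.starProjection_apply_mem _
  refine ⟨J - L, by simp [hJ, LinearMap.mem_ker.1 hL], fun K hK ↦ ?_⟩
  rw [map_sub, hLW]
  exact W.starProjection_inner_eq_zero (T J) (T K) ⟨K, hK, rfl⟩

end Minimizer

section RiccatiFamily

variable {Λ : Type*} [AddCommGroup Λ] [Module ℝ Λ] {V : ℝ → Type*}
  [∀ t, NormedAddCommGroup (V t)] [∀ t, InnerProductSpace ℝ (V t)]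

/-- A linear family of fields `t ↦ ev t J` along `[α, π]`, with derivatives `t ↦ ev' t J`, that
solve a Jacobi equation with curvature form `ρ` bounded below by `1`, whose Riccati operator is
self-adjoint and which is of maximal dimension: `exists_decomp` says that the values at `t` and the
derivatives at `t` of the fields that vanish there span all derivatives. -/
structure IsRiccatiFamily (α : ℝ) (ev ev' : ∀ t, Λ →ₗ[ℝ] V t) (ρ : ℝ → Λ → Λ → ℝ) : Prop where
  selfAdjoint : ∀ t ∈ Set.Icc α Real.pi, ∀ J K, ⟪ev' t J, ev t K⟫ = ⟪ev t J, ev' t K⟫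
  hasDeriv_inner : ∀ t ∈ Set.Icc α Real.pi, ∀ J K,
    HasDerivWithinAt (fun r ↦ ⟪ev r J, ev r K⟫) (2 * ⟪ev' t J, ev t K⟫) (Set.Icc α Real.pi) t
  hasDeriv_inner' : ∀ t ∈ Set.Icc α Real.pi, ∀ J K,
    HasDerivWithinAt (fun r ↦ ⟪ev' r J, ev r K⟫) (⟪ev' t J, ev' t K⟫ - ρ t J K)
      (Set.Icc α Real.pi) t
  norm_sq_le_curv : ∀ t ∈ Set.Icc α Real.pi, ∀ J, ‖ev t J‖ ^ 2 ≤ ρ t J J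
  curv_eq_zero : ∀ t ∈ Set.Icc α Real.pi, ∀ J K, ev t K = 0 → ρ t J K = 0
  eq_zero : ∀ t ∈ Set.Icc α Real.pi, ∀ J, ev t J = 0 → ev' t J = 0 → J = 0
  exists_decomp : ∀ t ∈ Set.Icc α Real.pi, ∀ J, ∃ L N, ev t N = 0 ∧ ev' t J = ev t L + ev' t N

namespace IsRiccatiFamily

variable {α : ℝ} {ev ev' : ∀ t, Λ →ₗ[ℝ] V t} {ρ : ℝ → Λ → Λ → ℝ} {lam : Λ →ₗ[ℝ] ℝ} {t : ℝ}

theorem hasDerivAt_inner (h : IsRiccatiFamily α ev ev' ρ) (ht : t ∈ Set.Ioo α Real.pi) (J K : Λ) :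
    HasDerivAt (fun r ↦ ⟪ev r J, ev r K⟫) (2 * ⟪ev' t J, ev t K⟫) t :=
  (h.hasDeriv_inner t (Set.Ioo_subset_Icc_self ht) J K).hasDerivAt (Icc_mem_nhds ht.1 ht.2)

theorem hasDerivAt_inner' (h : IsRiccatiFamily α ev ev' ρ) (ht : t ∈ Set.Ioo α Real.pi) (J K : Λ) :
    HasDerivAt (fun r ↦ ⟪ev' r J, ev r K⟫) (⟪ev' t J, ev' t K⟫ - ρ t J K) t :=
  (h.hasDeriv_inner' t (Set.Ioo_subset_Icc_self ht) J K).hasDerivAt (Icc_mem_nhds ht.1 ht.2)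

theorem exists_isMinimizer_deriv_eq [FiniteDimensional ℝ Λ] (h : IsRiccatiFamily α ev ev' ρ)
    (ht : t ∈ Set.Icc α Real.pi) (hlam : lam ≠ 0) (hker : ∀ J, ev t J = 0 → lam J = 0) :
    ∃ J K : Λ, ∃ a : ℝ, IsMinimizer (ev t) lam J ∧ lam K = 0 ∧
      ev' t J = a • ev t J + ev t K := by
  obtain ⟨J, hJ⟩ := exists_isMinimizer (T := ev t) hlam
  obtain ⟨L, N, hN, hL⟩ := h.exists_decomp t ht J
  have hJN : lam (J - N) = 1 := by rw [map_sub, hker N hN, sub_zero, hJ.apply_eq_one]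
  have hev : ev t (J - N) = ev t J := by rw [map_sub, hN, sub_zero]
  refine ⟨J - N, L - lam L • (J - N), lam L, ⟨hJN, ?_⟩, ?_, ?_⟩
  · rw [hev]
    exact hJ.inner_eq_zero
  · rw [map_sub, map_smul, hJN, smul_eq_mul, mul_one, sub_self]
  · rw [map_sub (ev' t), hL, add_sub_cancel_right, map_sub (ev t) L, map_smul, add_sub_cancel]

/-- The derivative at `r` of `‖ev r (J - (r - t) • K)‖ ^ 2`. -/
def variationDeriv (ev ev' : ∀ t, Λ →ₗ[ℝ] V t) (t : ℝ) (J K : Λ) (r : ℝ) : ℝ :=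
  2 * ⟪ev' r J, ev r J⟫ - 2 * (⟪ev r J, ev r K⟫ + (r - t) * (2 * ⟪ev' r J, ev r K⟫))
    + (2 * (r - t) * ⟪ev r K, ev r K⟫ + (r - t) ^ 2 * (2 * ⟪ev' r K, ev r K⟫))

theorem hasDerivAt_norm_sq_variation (h : IsRiccatiFamily α ev ev' ρ) {r : ℝ}
    (hr : r ∈ Set.Ioo α Real.pi) (J K : Λ) :
    HasDerivAt (fun r ↦ ‖ev r (J - (r - t) • K)‖ ^ 2) (variationDeriv ev ev' t J K r) r := by
  have hexpand (r : ℝ) : ‖ev r (J - (r - t) • K)‖ ^ 2 =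
      ⟪ev r J, ev r J⟫ - 2 * ((r - t) * ⟪ev r J, ev r K⟫) + (r - t) ^ 2 * ⟪ev r K, ev r K⟫ := by
    simp only [map_sub, map_smul, norm_sub_sq_real, norm_smul, mul_pow, real_inner_smul_right,
      real_inner_self_eq_norm_sq, Real.norm_eq_abs, sq_abs]
  have hlin : HasDerivAt (fun r ↦ r - t) 1 r := (hasDerivAt_id r).sub_const t
  have hsq : HasDerivAt (fun r ↦ (r - t) ^ 2) (2 * (r - t)) r :=
    (hlin.pow 2).congr_deriv (by simp)
  simp only [hexpand]
  exact (((h.hasDerivAt_inner hr J J).sub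
    ((hlin.mul (h.hasDerivAt_inner hr J K)).const_mul 2)).add
    (hsq.mul (h.hasDerivAt_inner hr K K))).congr_deriv (by simp only [variationDeriv]; ring)

theorem hasDerivAt_variationDeriv (h : IsRiccatiFamily α ev ev' ρ) (ht : t ∈ Set.Ioo α Real.pi)
    (J K : Λ) : HasDerivAt (variationDeriv ev ev' t J K)
      (2 * (‖ev' t J‖ ^ 2 - ρ t J J) - 8 * ⟪ev' t J, ev t K⟫ + 2 * ‖ev t K‖ ^ 2) t := by
  have hlin : HasDerivAt (fun r ↦ r - t) 1 t := (hasDerivAt_id t).sub_const t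
  have hsq : HasDerivAt (fun r ↦ (r - t) ^ 2) (2 * (t - t)) t :=
    (hlin.pow 2).congr_deriv (by simp)
  refine ((((h.hasDerivAt_inner' ht J J).const_mul 2).sub (((h.hasDerivAt_inner ht J K).add
    (hlin.mul ((h.hasDerivAt_inner' ht J K).const_mul 2))).const_mul 2)).add
    (((hlin.const_mul 2).mul (h.hasDerivAt_inner ht K K)).add
    (hsq.mul ((h.hasDerivAt_inner' ht K K).const_mul 2)))).congr_deriv ?_
  simp only [real_inner_self_eq_norm_sq]
  ring

theorem exists_barrier (h : IsRiccatiFamily α ev ev' ρ) (ht : t ∈ Set.Ioo α Real.pi) {J K : Λ}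
    {a : ℝ} (hJ : IsMinimizer (ev t) lam J) (hK : lam K = 0) (ha : ev' t J = a • ev t J + ev t K) :
    ∃ g g' : ℝ → ℝ, (∀ r, minNorm (ev r) lam ^ 2 ≤ g r) ∧ g t = minNorm (ev t) lam ^ 2 ∧
      (∀ᶠ r in 𝓝 t, HasDerivAt g (g' r) r) ∧
      HasDerivAt g' (2 * a ^ 2 * minNorm (ev t) lam ^ 2 - 4 * ‖ev t K‖ ^ 2 - 2 * ρ t J J) t ∧
      g' t = 2 * a * minNorm (ev t) lam ^ 2 := by
  have hJK : ⟪ev t J, ev t K⟫ = 0 := hJ.inner_eq_zero K hK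
  have hJ'J : ⟪ev' t J, ev t J⟫ = a * minNorm (ev t) lam ^ 2 := by
    rw [ha, inner_add_left, real_inner_smul_left, real_inner_self_eq_norm_sq, real_inner_comm, hJK,
      hJ.minNorm_eq, add_zero]
  have hJ'K : ⟪ev' t J, ev t K⟫ = ‖ev t K‖ ^ 2 := by
    rw [ha, inner_add_left, real_inner_smul_left, hJK, real_inner_self_eq_norm_sq, mul_zero,
      zero_add]
  have hJ' : ‖ev' t J‖ ^ 2 = a ^ 2 * minNorm (ev t) lam ^ 2 + ‖ev t K‖ ^ 2 := by
    rw [ha, norm_add_sq_real, real_inner_smul_left, hJK, norm_smul, mul_pow, Real.norm_eq_abs,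
      sq_abs, hJ.minNorm_eq, mul_zero, mul_zero, add_zero]
  refine ⟨fun r ↦ ‖ev r (J - (r - t) • K)‖ ^ 2, variationDeriv ev ev' t J K, fun r ↦ ?_, ?_, ?_,
    (h.hasDerivAt_variationDeriv ht J K).congr_deriv ?_, ?_⟩
  · exact pow_le_pow_left₀ minNorm_nonneg (minNorm_le (by simp [hJ.apply_eq_one, hK])) 2
  · simp [hJ.minNorm_eq]
  · filter_upwards [Ioo_mem_nhds ht.1 ht.2] with r hr using h.hasDerivAt_norm_sq_variation hr J K
  · rw [hJ', hJ'K]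
    ring
  · simp only [variationDeriv, hJ'J, hJK, sub_self]
    ring

theorem hasSineBarrierAt_minNorm [FiniteDimensional ℝ Λ] (h : IsRiccatiFamily α ev ev' ρ)
    (ht : t ∈ Set.Ioo α Real.pi) (hlam : lam ≠ 0) (hker : ∀ J, ev t J = 0 → lam J = 0) :
    HasSineBarrierAt (fun r ↦ minNorm (ev r) lam) t := by
  have ht' := Set.Ioo_subset_Icc_self ht
  obtain ⟨J, K, a, hJ, hK, ha⟩ := h.exists_isMinimizer_deriv_eq ht' hlam hker
  obtain ⟨g, g', hle, heq, hg, hg', hgt⟩ := h.exists_barrier ht hJ hK ha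
  refine ⟨g, g', a, _, Eventually.of_forall hle, heq, hg, hg', hgt, ?_⟩
  linarith [hJ.minNorm_eq ▸ h.norm_sq_le_curv t ht' J, sq_nonneg ‖ev t K‖]

end IsRiccatiFamily

end RiccatiFamily

section BlowUp

variable {Λ : Type*} [AddCommGroup Λ] [Module ℝ Λ]

theorem exists_isProj (p : Submodule ℝ Λ) : ∃ f : Λ →ₗ[ℝ] Λ, LinearMap.IsProj p f := by
  obtain ⟨q, hq⟩ := p.subtype.exists_leftInverse_of_injective p.ker_subtype
  refine ⟨p.subtype ∘ₗ q, fun x ↦ (q x).2, fun x hx ↦ ?_⟩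
  exact congrArg Subtype.val (LinearMap.congr_fun hq ⟨x, hx⟩)

/-- The pullback of the inner product along `T`. -/
def gramForm {E : Type*} [NormedAddCommGroup E] [InnerProductSpace ℝ E] (T : Λ →ₗ[ℝ] E) :
    LinearMap.BilinForm ℝ Λ :=
  (innerₗ E).compl₁₂ T T

theorem gramForm_self {E : Type*} [NormedAddCommGroup E] [InnerProductSpace ℝ E] (T : Λ →ₗ[ℝ] E)
    (J : Λ) : gramForm T J J = ‖T J‖ ^ 2 := by
  simp [gramForm]

theorem exists_sq_le_mul_of_posDef [FiniteDimensional ℝ Λ] {Q : LinearMap.BilinForm ℝ Λ}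
    (hpos : ∀ x, x ≠ 0 → 0 < Q x x) (ℓ : Λ →ₗ[ℝ] ℝ) :
    ∃ C, 0 ≤ C ∧ ∀ x, ℓ x ^ 2 ≤ C * Q x x := by
  have hlim : ∀ x y, Tendsto (fun ε : ℝ ↦ (Q - ε • gramForm ℓ) x y) (𝓝[>] 0) (𝓝 (Q x y)) := by
    intro x y
    have hc : Continuous fun ε : ℝ ↦ Q x y - ε * gramForm ℓ x y := by fun_prop
    simpa using (hc.tendsto 0).mono_left nhdsWithin_le_nhds
  obtain ⟨ε, hε, hε₀⟩ :=
    ((eventually_pos_of_tendsto_posDef hlim hpos).and self_mem_nhdsWithin).exists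
  refine ⟨ε⁻¹, (inv_pos.2 hε₀).le, fun x ↦ (le_inv_mul_iff₀ hε₀).2 ?_⟩
  rcases eq_or_ne x 0 with rfl | hx
  · simp
  · simpa [gramForm_self] using (hε x hx).le

/-- The rescaling `(r - t)⁻¹ • p + (1 - p)`. For the projection `p` onto the fields that vanish at
`t` it keeps the Gram forms of the family nondegenerate as `r → t`. -/
def blowUp (p : Λ →ₗ[ℝ] Λ) (t r : ℝ) : Λ →ₗ[ℝ] Λ :=
  (r - t)⁻¹ • p + (LinearMap.id - p)

variable {V : ℝ → Type*} [∀ t, NormedAddCommGroup (V t)] [∀ t, InnerProductSpace ℝ (V t)]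
  {α t θ : ℝ} {ev ev' : ∀ t, Λ →ₗ[ℝ] V t} {ρ : ℝ → Λ → Λ → ℝ} {p : Λ →ₗ[ℝ] Λ} {J K : Λ}

/-- The limit of the rescaled Gram forms of the family as `r → t`. -/
def blowUpForm (ev ev' : ∀ t, Λ →ₗ[ℝ] V t) (p : Λ →ₗ[ℝ] Λ) (t : ℝ) : LinearMap.BilinForm ℝ Λ :=
  gramForm (ev' t ∘ₗ p) + gramForm (ev t)

theorem blowUpForm_self (ev ev' : ∀ t, Λ →ₗ[ℝ] V t) (p : Λ →ₗ[ℝ] Λ) (t : ℝ) (J : Λ) :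
    blowUpForm ev ev' p t J J = ‖ev' t (p J)‖ ^ 2 + ‖ev t J‖ ^ 2 := by
  simp [blowUpForm, gramForm_self]

namespace IsRiccatiFamily

theorem continuousWithinAt_inner (h : IsRiccatiFamily α ev ev' ρ) (ht : t ∈ Set.Icc α Real.pi)
    (J K : Λ) : ContinuousWithinAt (fun r ↦ ⟪ev r J, ev r K⟫) (Set.Icc α Real.pi) t :=
  (h.hasDeriv_inner t ht J K).continuousWithinAt

theorem tendsto_inner_div (h : IsRiccatiFamily α ev ev' ρ) (ht : t ∈ Set.Icc α Real.pi)
    (hJ : ev t J = 0) (K : Λ) :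
    Tendsto (fun r ↦ ⟪ev r J, ev r K⟫ / (r - t)) (𝓝[Set.Icc α Real.pi \ {t}] t) (𝓝 0) := by
  have hslope := hasDerivWithinAt_iff_tendsto_slope.1 (h.hasDeriv_inner t ht J K)
  rw [h.selfAdjoint t ht, hJ, inner_zero_left, mul_zero] at hslope
  refine hslope.congr fun r ↦ ?_
  rw [slope_def_field, hJ, inner_zero_left, sub_zero]

theorem tendsto_inner_div_sq (h : IsRiccatiFamily α ev ev' ρ) (ht : t ∈ Set.Icc α Real.pi)
    (hJ : ev t J = 0) (hK : ev t K = 0) :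
    Tendsto (fun r ↦ ⟪ev r J, ev r K⟫ / (r - t) ^ 2) (𝓝[Set.Icc α Real.pi \ {t}] t)
      (𝓝 ⟪ev' t J, ev' t K⟫) := by
  have hlim := tendsto_div_sq_of_hasDerivWithinAt (convex_Icc α Real.pi) ht
    (fun r hr ↦ h.hasDeriv_inner r hr J K) ((h.hasDeriv_inner' t ht J K).const_mul 2)
    (by rw [hJ, inner_zero_left]) (by rw [hK, inner_zero_right, mul_zero])
  rwa [h.curv_eq_zero t ht J K hK, sub_zero, mul_div_cancel_left₀ _ two_ne_zero] at hlim

theorem tendsto_gramForm_blowUp (h : IsRiccatiFamily α ev ev' ρ) (ht : t ∈ Set.Icc α Real.pi)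
    (hp : LinearMap.IsProj (LinearMap.ker (ev t)) p) (J K : Λ) :
    Tendsto (fun r ↦ gramForm (ev r ∘ₗ blowUp p t r) J K) (𝓝[Set.Icc α Real.pi \ {t}] t)
      (𝓝 (blowUpForm ev ev' p t J K)) := by
  have hexpand (r : ℝ) : gramForm (ev r ∘ₗ blowUp p t r) J K =
      ⟪ev r (p J), ev r (p K)⟫ / (r - t) ^ 2 + ⟪ev r (p J), ev r (K - p K)⟫ / (r - t)
        + ⟪ev r (p K), ev r (J - p J)⟫ / (r - t) + ⟪ev r (J - p J), ev r (K - p K)⟫ := by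
    simp only [gramForm, blowUp, LinearMap.compl₁₂_apply, LinearMap.comp_apply,
      LinearMap.add_apply, LinearMap.smul_apply, LinearMap.sub_apply, LinearMap.id_apply, map_add,
      map_smul, innerₗ_apply_apply, smul_eq_mul, div_eq_mul_inv, ← inv_pow,
      real_inner_comm (ev r (p K)) (ev r (J - p J))]
    ring
  have hpJ : ev t (p J) = 0 := hp.map_mem J
  have hpK : ev t (p K) = 0 := hp.map_mem K
  have hcont := ((h.continuousWithinAt_inner ht (J - p J) (K - p K)).mono
    (Set.sdiff_subset (t := {t}))).tendsto
  simp only [hexpand]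
  convert (((h.tendsto_inner_div_sq ht hpJ hpK).add (h.tendsto_inner_div ht hpJ (K - p K))).add
    (h.tendsto_inner_div ht hpK (J - p J))).add hcont using 2
  simp [blowUpForm, gramForm, hpJ, hpK]

theorem blowUpForm_pos (h : IsRiccatiFamily α ev ev' ρ) (ht : t ∈ Set.Icc α Real.pi)
    (hp : LinearMap.IsProj (LinearMap.ker (ev t)) p) (hJ : J ≠ 0) :
    0 < blowUpForm ev ev' p t J J := by
  rw [blowUpForm_self]
  refine (by positivity : (0 : ℝ) ≤ _).lt_of_ne' fun hzero ↦ hJ ?_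
  obtain ⟨hderiv, hvalue⟩ := (add_eq_zero_iff_of_nonneg (sq_nonneg _) (sq_nonneg _)).1 hzero
  have hJt : ev t J = 0 := by simpa using hvalue
  rw [hp.map_id J hJt] at hderiv
  exact h.eq_zero t ht J hJt (by simpa using hderiv)

theorem eventually_mul_le_norm_sq [FiniteDimensional ℝ Λ] (h : IsRiccatiFamily α ev ev' ρ)
    (ht : t ∈ Set.Icc α Real.pi) (hp : LinearMap.IsProj (LinearMap.ker (ev t)) p) (hθ : θ < 1) :
    ∀ᶠ r in 𝓝[Set.Icc α Real.pi \ {t}] t, ∀ J,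
      θ * ((r - t) ^ 2 * ‖ev' t (p J)‖ ^ 2 + ‖ev t J‖ ^ 2) ≤ ‖ev r J‖ ^ 2 := by
  filter_upwards [eventually_mul_le_of_tendsto_posDef (h.tendsto_gramForm_blowUp ht hp)
    (fun J ↦ h.blowUpForm_pos ht hp) hθ, self_mem_nhdsWithin] with r hr hrt J
  have hrt₀ : r - t ≠ 0 := sub_ne_zero.2 hrt.2
  have hpp : p (p J) = p J := hp.map_id _ (hp.map_mem J)
  have hpJ : ev t (p J) = 0 := hp.map_mem J
  have hrescaled : blowUp p t r ((r - t) • p J + (J - p J)) = J := by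
    simp [blowUp, hpp, smul_smul, inv_mul_cancel₀ hrt₀]
  have hle := hr ((r - t) • p J + (J - p J))
  rw [blowUpForm_self, gramForm_self, LinearMap.comp_apply, hrescaled] at hle
  simpa [hpp, hpJ, norm_smul, mul_pow] using hle

theorem eventually_mul_norm_sq_le [FiniteDimensional ℝ Λ] (h : IsRiccatiFamily α ev ev' ρ)
    (ht : t ∈ Set.Icc α Real.pi) (hθ₀ : 0 ≤ θ) (hθ : θ < 1) :
    ∀ᶠ r in 𝓝[Set.Icc α Real.pi] t, ∀ J, θ * ‖ev t J‖ ^ 2 ≤ ‖ev r J‖ ^ 2 := by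
  obtain ⟨p, hp⟩ := exists_isProj (LinearMap.ker (ev t))
  rw [← Set.insert_sdiff_self_of_mem ht, nhdsWithin_insert, eventually_sup, eventually_pure]
  refine ⟨fun J ↦ mul_le_of_le_one_left (sq_nonneg _) hθ.le, ?_⟩
  filter_upwards [h.eventually_mul_le_norm_sq ht hp hθ] with r hr J
  exact (mul_le_mul_of_nonneg_left (le_add_of_nonneg_left (by positivity)) hθ₀).trans (hr J)

theorem eventually_sq_mul_blowUpForm_le [FiniteDimensional ℝ Λ] (h : IsRiccatiFamily α ev ev' ρ)
    (ht : t ∈ Set.Icc α Real.pi) (hp : LinearMap.IsProj (LinearMap.ker (ev t)) p) :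
    ∀ᶠ r in 𝓝[Set.Icc α Real.pi \ {t}] t, ∀ J,
      (r - t) ^ 2 * blowUpForm ev ev' p t J J ≤ 2 * ‖ev r J‖ ^ 2 := by
  have hnear : ∀ᶠ r in 𝓝 t, (r - t) ^ 2 < 1 :=
    (by fun_prop : Continuous fun r ↦ (r - t) ^ 2).continuousAt.eventually_lt_const (by simp)
  filter_upwards [h.eventually_mul_le_norm_sq ht hp one_half_lt_one, nhdsWithin_le_nhds hnear]
    with r hr hr₁ J
  have hle := mul_le_of_le_one_left (sq_nonneg ‖ev t J‖) hr₁.le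
  rw [blowUpForm_self, mul_add]
  linarith [hr J]

theorem eventually_injective [FiniteDimensional ℝ Λ] (h : IsRiccatiFamily α ev ev' ρ)
    (ht : t ∈ Set.Icc α Real.pi) :
    ∀ᶠ r in 𝓝[Set.Icc α Real.pi \ {t}] t, ∀ J, ev r J = 0 → J = 0 := by
  obtain ⟨p, hp⟩ := exists_isProj (LinearMap.ker (ev t))
  filter_upwards [h.eventually_sq_mul_blowUpForm_le ht hp, self_mem_nhdsWithin] with r hr hrt J hJ
  by_contra hJ₀
  have hpos := mul_pos (pow_pos (abs_pos.2 (sub_ne_zero.2 hrt.2)) 2) (h.blowUpForm_pos ht hp hJ₀)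
  rw [sq_abs] at hpos
  simpa [hJ] using hpos.trans_le (hr J)

theorem exists_sq_mul_sq_le [FiniteDimensional ℝ Λ] (h : IsRiccatiFamily α ev ev' ρ)
    (ht : t ∈ Set.Icc α Real.pi) (ℓ : Λ →ₗ[ℝ] ℝ) :
    ∃ C, ∀ᶠ r in 𝓝[Set.Icc α Real.pi \ {t}] t, ∀ J,
      (r - t) ^ 2 * ℓ J ^ 2 ≤ C * ‖ev r J‖ ^ 2 := by
  obtain ⟨p, hp⟩ := exists_isProj (LinearMap.ker (ev t))
  obtain ⟨C, hC₀, hC⟩ := exists_sq_le_mul_of_posDef (fun J ↦ h.blowUpForm_pos ht hp) ℓ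
  refine ⟨C * 2, ?_⟩
  filter_upwards [h.eventually_sq_mul_blowUpForm_le ht hp] with r hr J
  calc (r - t) ^ 2 * ℓ J ^ 2 ≤ (r - t) ^ 2 * (C * blowUpForm ev ev' p t J J) :=
        mul_le_mul_of_nonneg_left (hC J) (sq_nonneg _)
    _ = C * ((r - t) ^ 2 * blowUpForm ev ev' p t J J) := mul_left_comm _ _ _
    _ ≤ C * (2 * ‖ev r J‖ ^ 2) := mul_le_mul_of_nonneg_left (hr J) hC₀
    _ = C * 2 * ‖ev r J‖ ^ 2 := (mul_assoc _ _ _).symm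

theorem exists_sq_le_of_injective [FiniteDimensional ℝ Λ] (h : IsRiccatiFamily α ev ev' ρ)
    (ht : t ∈ Set.Icc α Real.pi) (hinj : ∀ J, ev t J = 0 → J = 0) (ℓ : Λ →ₗ[ℝ] ℝ) :
    ∃ C, ∀ᶠ r in 𝓝[Set.Icc α Real.pi] t, ∀ J, ℓ J ^ 2 ≤ C * ‖ev r J‖ ^ 2 := by
  obtain ⟨C, hC₀, hC⟩ := exists_sq_le_mul_of_posDef (Q := gramForm (ev t)) (fun J hJ ↦ by
    rw [gramForm_self]
    exact pow_pos (norm_pos_iff.2 (mt (hinj J) hJ)) 2) ℓ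
  simp only [gramForm_self] at hC
  refine ⟨C * 2, ?_⟩
  filter_upwards [h.eventually_mul_norm_sq_le ht one_half_pos.le one_half_lt_one] with r hr J
  calc ℓ J ^ 2 ≤ C * ‖ev t J‖ ^ 2 := hC J
    _ ≤ C * (2 * ‖ev r J‖ ^ 2) := mul_le_mul_of_nonneg_left (by linarith [hr J]) hC₀
    _ = C * 2 * ‖ev r J‖ ^ 2 := (mul_assoc _ _ _).symm

end IsRiccatiFamily

end BlowUp

section Rigidity

theorem tendsto_zero_of_sq_le_mul {ι : Type*} {l : Filter ι} {u v : ι → ℝ} {C : ℝ}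
    (hle : ∀ᶠ i in l, u i ^ 2 ≤ C * v i) (hv : Tendsto v l (𝓝 0)) : Tendsto u l (𝓝 0) := by
  have hsqrt : Tendsto (fun i ↦ √(C * v i)) l (𝓝 0) := by
    simpa using (hv.const_mul C).sqrt
  exact squeeze_zero_norm' (hle.mono fun i hi ↦ Real.abs_le_sqrt hi) hsqrt

theorem nhdsWithin_sdiff_singleton_of_mem_nhds {X : Type*} [TopologicalSpace X] {s : Set X} {x : X}
    (hs : s ∈ 𝓝 x) : 𝓝[s \ {x}] x = 𝓝[≠] x := by
  rw [Set.sdiff_eq_compl_inter]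
  exact nhdsWithin_inter_of_mem' (nhdsWithin_le_nhds hs)

namespace IsRiccatiFamily

variable {Λ : Type*} [AddCommGroup Λ] [Module ℝ Λ] {V : ℝ → Type*}
  [∀ t, NormedAddCommGroup (V t)] [∀ t, InnerProductSpace ℝ (V t)]
  {α c t : ℝ} {ev ev' : ∀ t, Λ →ₗ[ℝ] V t} {ρ : ℝ → Λ → Λ → ℝ} {lam : Λ →ₗ[ℝ] ℝ}

theorem eventually_mul_minNorm_le [FiniteDimensional ℝ Λ] (h : IsRiccatiFamily α ev ev' ρ)
    (ht : t ∈ Set.Icc α Real.pi) (hlam : lam ≠ 0) {κ : ℝ} (hκ : κ ∈ Set.Ioo 0 1) :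
    ∀ᶠ r in 𝓝[Set.Icc α Real.pi] t, κ * minNorm (ev t) lam ≤ minNorm (ev r) lam := by
  obtain ⟨J₀, hJ₀⟩ := exists_apply_eq_one hlam
  filter_upwards [h.eventually_mul_norm_sq_le ht (sq_nonneg κ)
    (pow_lt_one₀ hκ.1.le hκ.2 two_ne_zero)] with r hr
  refine le_csInf ⟨_, J₀, hJ₀, rfl⟩ (Set.forall_mem_image.2 fun J hJ ↦ ?_)
  refine (mul_le_mul_of_nonneg_left (minNorm_le hJ) hκ.1.le).trans ?_
  exact le_of_sq_le_sq ((mul_pow _ _ _).trans_le (hr J)) (norm_nonneg _)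

theorem continuousWithinAt_minNorm [FiniteDimensional ℝ Λ] (h : IsRiccatiFamily α ev ev' ρ)
    (ht : t ∈ Set.Icc α Real.pi) (hlam : lam ≠ 0) :
    ContinuousWithinAt (fun r ↦ minNorm (ev r) lam) (Set.Icc α Real.pi) t := by
  refine tendsto_order.2 ⟨fun y hy ↦ ?_, fun y hy ↦ ?_⟩
  · have hnear : ∀ᶠ κ in 𝓝[<] (1 : ℝ), y < κ * minNorm (ev t) lam :=
      nhdsWithin_le_nhds ((continuous_mul_const _).continuousAt.eventually_const_lt (by simpa))
    obtain ⟨κ, hyκ, hκ⟩ := (hnear.and (Ioo_mem_nhdsLT zero_lt_one)).exists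
    exact (h.eventually_mul_minNorm_le ht hlam hκ).mono fun r hr ↦ hyκ.trans_le hr
  · obtain ⟨J, hJ⟩ := exists_isMinimizer (T := ev t) hlam
    replace hy : ‖ev t J‖ < y := hJ.minNorm_eq ▸ hy
    have hnorm : ContinuousWithinAt (fun r ↦ ‖ev r J‖) (Set.Icc α Real.pi) t := by
      simpa only [real_inner_self_eq_norm_sq, Real.sqrt_sq (norm_nonneg _)] using
        (h.continuousWithinAt_inner ht J J).sqrt
    exact (hnorm.eventually_lt_const hy).mono fun r hr ↦ (minNorm_le hJ.apply_eq_one).trans_lt hr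

theorem exists_majorant_minNorm_left [FiniteDimensional ℝ Λ] (h : IsRiccatiFamily α ev ev' ρ)
    (hα : α < Real.pi) (hinj : ∀ J, ev α J = 0 → J = 0) {κ : ℝ}
    (hκ : ∀ J, ⟪ev' α J, ev α J⟫ ≤ κ * ‖ev α J‖ ^ 2) (hlam : lam ≠ 0) :
    ∃ (g : ℝ → ℝ) (k : ℝ), (∀ r ∈ Set.Icc α Real.pi, minNorm (ev r) lam ≤ g r) ∧
      g α = minNorm (ev α) lam ∧ HasDerivWithinAt g k (Set.Ioi α) α ∧
      k ≤ κ * minNorm (ev α) lam := by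
  obtain ⟨J, hJ⟩ := exists_isMinimizer (T := ev α) hlam
  have hpos : 0 < ‖ev α J‖ := hJ.minNorm_eq ▸ hJ.minNorm_pos fun L hL ↦ by simp [hinj L hL]
  have hderiv : HasDerivWithinAt (fun r ↦ √⟪ev r J, ev r J⟫)
      (2 * ⟪ev' α J, ev α J⟫ / (2 * √⟪ev α J, ev α J⟫)) (Set.Ioi α) α :=
    (((h.hasDeriv_inner α (Set.left_mem_Icc.2 hα.le) J J).sqrt
      (by rw [real_inner_self_eq_norm_sq]; positivity)).mono_of_mem_nhdsWithin
        (Icc_mem_nhdsGT hα))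
  have hsqrt (r : ℝ) : √⟪ev r J, ev r J⟫ = ‖ev r J‖ := (norm_eq_sqrt_real_inner _).symm
  refine ⟨_, _, fun r _ ↦ ?_, ?_, hderiv, ?_⟩
  · exact (minNorm_le hJ.apply_eq_one).trans_eq (hsqrt r).symm
  · rw [hsqrt, hJ.minNorm_eq]
  · rw [hsqrt, hJ.minNorm_eq, mul_div_mul_left _ _ two_ne_zero, div_le_iff₀ hpos, mul_assoc, ← sq]
    exact hκ J

theorem minNorm_eq_const_mul_sin [FiniteDimensional ℝ Λ] (h : IsRiccatiFamily α ev ev' ρ)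
    (hα : α ∈ Set.Ico 0 Real.pi)
    (hleft : 0 < α → (∀ J, ev α J = 0 → J = 0) ∧
      ∀ J, ⟪ev' α J, ev α J⟫ ≤ Real.cot α * ‖ev α J‖ ^ 2)
    (hlam : lam ≠ 0) (hker : ∀ t ∈ Set.Ioo α Real.pi, ∀ J, ev t J = 0 → lam J = 0) :
    ∃ c : ℝ, ∀ t ∈ Set.Ioo α Real.pi, minNorm (ev t) lam = c * Real.sin t := by
  have hcont (t) (ht : t ∈ Set.Icc α Real.pi) := h.continuousWithinAt_minNorm ht hlam
  refine exists_eq_mul_sin_of_hasSineBarrierAt hα.1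
    (fun t ht ↦ (hcont t (Set.Ioo_subset_Icc_self ht)).mono Set.Ioo_subset_Icc_self)
    (fun t ht ↦ ?_) (fun t ht ↦ h.hasSineBarrierAt_minNorm ht hlam (hker t ht))
    fun hα₀ ↦ ⟨?_, h.exists_majorant_minNorm_left hα.2 (hleft hα₀).1 (hleft hα₀).2 hlam⟩
  · obtain ⟨J, hJ⟩ := exists_isMinimizer (T := ev t) hlam
    exact hJ.minNorm_pos (hker t ht)
  · exact (hcont α (Set.left_mem_Icc.2 hα.2.le)).mono_of_mem_nhdsWithin (Icc_mem_nhdsGE hα.2)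

/-- Equality in the barrier inequality for `c * sin` forces the error term `‖ev t K‖ ^ 2` to
vanish. -/
theorem exists_isMinimizer_deriv_eq_cot [FiniteDimensional ℝ Λ] (h : IsRiccatiFamily α ev ev' ρ)
    (hα : 0 ≤ α) (hlam : lam ≠ 0)
    (hc : ∀ r ∈ Set.Ioo α Real.pi, minNorm (ev r) lam = c * Real.sin r)
    (ht : t ∈ Set.Ioo α Real.pi) (hker : ∀ J, ev t J = 0 → lam J = 0) :
    ∃ J, IsMinimizer (ev t) lam J ∧ ev' t J = Real.cot t • ev t J := by
  have ht' := Set.Ioo_subset_Icc_self ht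
  obtain ⟨J, K, a, hJ, hK, ha⟩ := h.exists_isMinimizer_deriv_eq ht' hlam hker
  obtain ⟨g, g', hle, heq, hg, hg', hgt⟩ := h.exists_barrier ht hJ hK ha
  have hsin : 0 < Real.sin t := Real.sin_pos_of_pos_of_lt_pi (hα.trans_lt ht.1) ht.2
  have hcpos : 0 < c := pos_of_mul_pos_left (hc t ht ▸ hJ.minNorm_pos hker) hsin.le
  rw [hc t ht] at heq hg' hgt
  have hle' : ∀ᶠ r in 𝓝 t, (c * Real.sin r) ^ 2 ≤ g r := by
    filter_upwards [Ioo_mem_nhds ht.1 ht.2] with r hr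
    exact hc r hr ▸ hle r
  obtain ⟨hfirst, hsecond⟩ := second_deriv_le_of_sq_le hle' heq hg hg'
    (Eventually.of_forall fun r ↦ (Real.hasDerivAt_sin r).const_mul c)
    ((Real.hasDerivAt_cos t).const_mul c)
  have hacos : a * Real.sin t = Real.cos t := by
    refine mul_left_cancel₀ (mul_pos (mul_pos two_pos (pow_pos hcpos 2)) hsin).ne' ?_
    linear_combination hfirst - hgt
  have hcurv : (c * Real.sin t) ^ 2 ≤ ρ t J J := by
    rw [← hc t ht, hJ.minNorm_eq]
    exact h.norm_sq_le_curv t ht' J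
  have hevK : ‖ev t K‖ ^ 2 ≤ 0 := by
    rw [← hacos] at hsecond
    linarith
  refine ⟨J, hJ, ?_⟩
  rw [ha, norm_eq_zero.1 (pow_eq_zero_iff two_ne_zero |>.1 (hevK.antisymm (sq_nonneg _))),
    add_zero, Real.cot_eq_cos_div_sin, ← hacos, mul_div_cancel_right₀ _ hsin.ne']

theorem tendsto_norm_sq_sub_minNorm_sq_div_sq (h : IsRiccatiFamily α ev ev' ρ) (hα : 0 ≤ α)
    (hc : ∀ r ∈ Set.Ioo α Real.pi, minNorm (ev r) lam = c * Real.sin r)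
    (ht : t ∈ Set.Ioo α Real.pi) {J : Λ} (hJ : IsMinimizer (ev t) lam J)
    (hJ' : ev' t J = Real.cot t • ev t J) :
    Tendsto (fun r ↦ (‖ev r J‖ ^ 2 - minNorm (ev r) lam ^ 2) / (r - t) ^ 2) (𝓝[≠] t) (𝓝 0) := by
  have hsin : Real.sin t ≠ 0 := (Real.sin_pos_of_pos_of_lt_pi (hα.trans_lt ht.1) ht.2).ne'
  have hnorm : ‖ev t J‖ ^ 2 = (c * Real.sin t) ^ 2 := by rw [← hc t ht, hJ.minNorm_eq]
  have hinner : ⟪ev' t J, ev t J⟫ = c ^ 2 * (Real.sin t * Real.cos t) := by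
    rw [hJ', real_inner_smul_left, real_inner_self_eq_norm_sq, hnorm, Real.cot_eq_cos_div_sin]
    field_simp
  have hnorm' : ⟪ev' t J, ev' t J⟫ = (c * Real.cos t) ^ 2 := by
    rw [real_inner_self_eq_norm_sq, hJ', norm_smul, mul_pow, hnorm, Real.norm_eq_abs, sq_abs,
      Real.cot_eq_cos_div_sin]
    field_simp
  have hsq (r : ℝ) : HasDerivAt (fun r ↦ (c * Real.sin r) ^ 2)
      (2 * (c ^ 2 * (Real.sin r * Real.cos r))) r :=
    (((Real.hasDerivAt_sin r).const_mul c).pow 2).congr_deriv (by push_cast; ring)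
  have hlim := tendsto_div_sq_of_hasDerivWithinAt (convex_Ioo α Real.pi) ht
    (fun r hr ↦ ((h.hasDerivAt_inner hr J J).sub (hsq r)).hasDerivWithinAt)
    (((h.hasDerivAt_inner' ht J J).const_mul 2).sub
      ((((Real.hasDerivAt_sin t).mul (Real.hasDerivAt_cos t)).const_mul (c ^ 2)).const_mul
        2)).hasDerivWithinAt
    (by simp [hnorm]) (by simp [hinner])
  rw [nhdsWithin_sdiff_singleton_of_mem_nhds (Ioo_mem_nhds ht.1 ht.2)] at hlim
  have hnear : ∀ᶠ r in 𝓝[≠] t, r ∈ Set.Ioo α Real.pi :=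
    nhdsWithin_le_nhds (Ioo_mem_nhds ht.1 ht.2)
  replace hlim := hlim.congr' <| hnear.mono fun r hr ↦ by
    rw [Pi.sub_apply, real_inner_self_eq_norm_sq, ← hc r hr]
  have hnonneg := ge_of_tendsto' hlim fun r ↦ div_nonneg (sub_nonneg.2 <|
    pow_le_pow_left₀ minNorm_nonneg (minNorm_le hJ.apply_eq_one) 2) (sq_nonneg (r - t))
  have hcurv := h.norm_sq_le_curv t (Set.Ioo_subset_Icc_self ht) J
  rw [hnorm] at hcurv
  convert hlim using 2
  refine hnonneg.antisymm ?_
  rw [hnorm']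
  linarith

variable {F : ℝ → Λ}

theorem continuousAt_apply_of_tendsto [FiniteDimensional ℝ Λ] (h : IsRiccatiFamily α ev ev' ρ)
    (ht : t ∈ Set.Ioo α Real.pi)
    (hF : Tendsto (fun r ↦ ‖ev r (F r - F t)‖ ^ 2 / (r - t) ^ 2) (𝓝[≠] t) (𝓝 0))
    (ℓ : Λ →ₗ[ℝ] ℝ) : ContinuousAt (fun r ↦ ℓ (F r)) t := by
  obtain ⟨C, hC⟩ := h.exists_sq_mul_sq_le (Set.Ioo_subset_Icc_self ht) ℓ
  rw [nhdsWithin_sdiff_singleton_of_mem_nhds (Icc_mem_nhds ht.1 ht.2)] at hC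
  rw [continuousAt_iff_punctured_nhds, ← tendsto_sub_nhds_zero_iff]
  refine tendsto_zero_of_sq_le_mul (C := C) ?_ hF
  filter_upwards [hC, self_mem_nhdsWithin] with r hr hrt
  have hpos : 0 < (r - t) ^ 2 := by
    have := sub_ne_zero.2 hrt
    positivity
  rw [← map_sub, ← mul_div_assoc, le_div_iff₀ hpos, mul_comm]
  exact hr (F r - F t)

theorem hasDerivAt_apply_zero_of_tendsto [FiniteDimensional ℝ Λ] (h : IsRiccatiFamily α ev ev' ρ)
    (ht : t ∈ Set.Ioo α Real.pi) (hinj : ∀ J, ev t J = 0 → J = 0)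
    (hF : Tendsto (fun r ↦ ‖ev r (F r - F t)‖ ^ 2 / (r - t) ^ 2) (𝓝[≠] t) (𝓝 0))
    (ℓ : Λ →ₗ[ℝ] ℝ) : HasDerivAt (fun r ↦ ℓ (F r)) 0 t := by
  obtain ⟨C, hC⟩ := h.exists_sq_le_of_injective (Set.Ioo_subset_Icc_self ht) hinj ℓ
  rw [nhdsWithin_eq_nhds.2 (Icc_mem_nhds ht.1 ht.2)] at hC
  rw [hasDerivAt_iff_tendsto_slope]
  refine tendsto_zero_of_sq_le_mul (C := C) ?_ hF
  filter_upwards [nhdsWithin_le_nhds hC] with r hr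
  rw [slope_def_field, ← map_sub, div_pow, ← mul_div_assoc]
  exact div_le_div_of_nonneg_right (hr (F r - F t)) (sq_nonneg _)

theorem eq_of_tendsto [FiniteDimensional ℝ Λ] (h : IsRiccatiFamily α ev ev' ρ)
    (hF : ∀ t ∈ Set.Ioo α Real.pi,
      Tendsto (fun r ↦ ‖ev r (F r - F t)‖ ^ 2 / (r - t) ^ 2) (𝓝[≠] t) (𝓝 0))
    {a b : ℝ} (ha : a ∈ Set.Ioo α Real.pi) (hb : b ∈ Set.Ioo α Real.pi) : F a = F b := by
  wlog hab : a ≤ b generalizing a b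
  · exact (this hb ha (le_of_not_ge hab)).symm
  rw [← sub_eq_zero, ← Module.forall_dual_apply_eq_zero_iff ℝ]
  intro ℓ
  have hsub {t : ℝ} (ht : t ∈ Set.Icc a b) : t ∈ Set.Ioo α Real.pi :=
    ⟨ha.1.trans_le ht.1, ht.2.trans_lt hb.2⟩
  rw [map_sub, sub_eq_zero]
  refine eq_of_hasDerivAt_zero_off_isolated (f := fun r ↦ ℓ (F r)) hab (fun t ht ↦
    (h.continuousAt_apply_of_tendsto (hsub ht) (hF t (hsub ht)) ℓ).continuousWithinAt) fun t ht ↦ ?_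
  have hinj := h.eventually_injective (Set.Ioo_subset_Icc_self (hsub ht))
  rw [nhdsWithin_sdiff_singleton_of_mem_nhds (Icc_mem_nhds (hsub ht).1 (hsub ht).2)] at hinj
  filter_upwards [hinj, nhdsWithin_le_nhds (Ioo_mem_nhds (hsub ht).1 (hsub ht).2)] with r hr hrI
    using h.hasDerivAt_apply_zero_of_tendsto hrI hr (hF r hrI) ℓ

theorem exists_cot_field [FiniteDimensional ℝ Λ] (h : IsRiccatiFamily α ev ev' ρ)
    (hα : α ∈ Set.Ico 0 Real.pi)
    (hleft : 0 < α → (∀ J, ev α J = 0 → J = 0) ∧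
      ∀ J, ⟪ev' α J, ev α J⟫ ≤ Real.cot α * ‖ev α J‖ ^ 2)
    (hlam : lam ≠ 0) (hker : ∀ t ∈ Set.Ioo α Real.pi, ∀ J, ev t J = 0 → lam J = 0) :
    ∃ J, lam J = 1 ∧ ∀ t ∈ Set.Ioo α Real.pi, ev' t J = Real.cot t • ev t J := by
  obtain ⟨c, hc⟩ := h.minNorm_eq_const_mul_sin hα hleft hlam hker
  choose! F hF hF' using fun t (ht : t ∈ Set.Ioo α Real.pi) ↦
    h.exists_isMinimizer_deriv_eq_cot hα.1 hlam hc ht (hker t ht)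
  have hgap (t) (ht : t ∈ Set.Ioo α Real.pi) :
      Tendsto (fun r ↦ ‖ev r (F r - F t)‖ ^ 2 / (r - t) ^ 2) (𝓝[≠] t) (𝓝 0) := by
    refine (h.tendsto_norm_sq_sub_minNorm_sq_div_sq hα.1 hc ht (hF t ht) (hF' t ht)).congr' ?_
    filter_upwards [nhdsWithin_le_nhds (Ioo_mem_nhds ht.1 ht.2)] with r hr
    rw [(hF r hr).minNorm_eq, (hF r hr).norm_sq_eq_add (hF t ht).apply_eq_one,
      add_sub_cancel_left, ← norm_neg, ← map_neg, neg_sub]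
  obtain ⟨m, hm⟩ := Set.nonempty_Ioo.2 hα.2
  exact ⟨F m, (hF m hm).apply_eq_one, fun t ht ↦ h.eq_of_tendsto hgap ht hm ▸ hF' t ht⟩

end IsRiccatiFamily

end Rigidity

/-! ### Coordinate frames and covariant derivatives -/

section CovariantDerivative

variable {E : Type*} [NormedAddCommGroup E] [NormedSpace ℝ E]
  {H : Type*} [TopologicalSpace H] {I : ModelWithCorners ℝ E H}
  {M : Type*} [TopologicalSpace M] [ChartedSpace H M] {x : M}
  {F : Type*} [NormedAddCommGroup F] [NormedSpace ℝ F]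
  {V : M → Type*} [TopologicalSpace (TotalSpace F V)] [∀ x, AddCommGroup (V x)]
  [∀ x, Module ℝ (V x)] [∀ x, TopologicalSpace (V x)] [FiberBundle F V] [VectorBundle ℝ F V]

theorem extend_apply_eq_symmₗ (v : V x) {y : M} (hy : y ∈ (trivializationAt F V x).baseSet) :
    extend F v y =
      (trivializationAt F V x).symmₗ ℝ y ((trivializationAt F V x).linearMapAt ℝ x v) := by
  rw [(trivializationAt F V x).linearMapAt_apply, if_pos (mem_baseSet_trivializationAt F V x),
    (trivializationAt F V x).symmₗ_apply hy]
  rfl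

theorem extend_sum_smul_apply {ι : Type*} (s : Finset ι) (c : ι → ℝ) (v : ι → V x) {y : M}
    (hy : y ∈ (trivializationAt F V x).baseSet) :
    extend F (∑ i ∈ s, c i • v i) y = ∑ i ∈ s, c i • extend F (v i) y := by
  simp only [extend_apply_eq_symmₗ _ hy, map_sum, map_smul]

variable [∀ x, IsTopologicalAddGroup (V x)] [∀ x, ContinuousSMul ℝ (V x)]

theorem covariantDerivative_sum_smul_apply {ι : Type*} {s : Finset ι}
    (cov : CovariantDerivative I F V) {f : ι → M → ℝ} {Y : ι → Π x, V x}
    (hf : ∀ i ∈ s, MDiffAt (f i) x) (hY : ∀ i ∈ s, MDiffAt (T% (Y i)) x) (v : TangentSpace I x) :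
    cov (∑ i ∈ s, f i • Y i) x v =
      ∑ i ∈ s, (f i x • cov (Y i) x v + d% (f i) x v • Y i x) := by
  classical
  induction s using Finset.induction_on with
  | empty => simp
  | insert i s his ih =>
    have hterm : ∀ j ∈ insert i s, MDiffAt (T% (f j • Y j)) x := fun j hj ↦
      (hf j hj).smul_section (hY j hj)
    have hsum : MDiffAt (T% (∑ j ∈ s, f j • Y j)) x := by
      simpa only [Finset.sum_apply] using MDifferentiableAt.sum_section fun j hj ↦
        hterm j (Finset.mem_insert_of_mem hj)
    rw [Finset.sum_insert his, Finset.sum_insert his, cov.isCovariantDerivativeOnUniv.add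
      (hterm i (Finset.mem_insert_self i s)) hsum, add_apply,
      ih (fun j hj ↦ hf j (Finset.mem_insert_of_mem hj))
        fun j hj ↦ hY j (Finset.mem_insert_of_mem hj),
      cov.isCovariantDerivativeOnUniv.leibniz (hY i (Finset.mem_insert_self i s))
        (hf i (Finset.mem_insert_self i s))]
    rfl

theorem covariantDerivative_apply_eq_sum {ι : Type*} {s : Finset ι}
    (cov : CovariantDerivative I F V) {f : ι → M → ℝ} {Y : ι → Π x, V x} {Z : Π x, V x}
    (hf : ∀ i ∈ s, MDiffAt (f i) x) (hY : ∀ i ∈ s, MDiffAt (T% (Y i)) x)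
    (hZ : ∀ᶠ y in 𝓝 x, Z y = ∑ i ∈ s, f i y • Y i y) (v : TangentSpace I x) :
    cov Z x v = ∑ i ∈ s, (f i x • cov (Y i) x v + d% (f i) x v • Y i x) := by
  have hsum : MDiffAt (T% (∑ i ∈ s, f i • Y i)) x := by
    simpa only [Finset.sum_apply] using MDifferentiableAt.sum_section fun i hi ↦
      (hf i hi).smul_section (hY i hi)
  have hZ' : ∀ᶠ y in 𝓝 x, Z y = (∑ i ∈ s, f i • Y i) y := by simpa [Finset.sum_apply] using hZ
  rw [← covariantDerivative_sum_smul_apply cov hf hY]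
  exact congr($(cov.isCovariantDerivativeOnUniv.congr_of_eventuallyEq
    (hsum.congr_of_eventuallyEq (hZ'.mono fun y hy ↦ by simp only [hy])) hsum
    Filter.univ_mem hZ') v)

theorem covariantDerivative_extend_sum_smul {ι : Type*} {s : Finset ι}
    (cov : CovariantDerivative I F V) (c : ι → ℝ) (v : ι → V x) (w : TangentSpace I x) :
    cov (extend F (∑ i ∈ s, c i • v i)) x w = ∑ i ∈ s, c i • cov (extend F (v i)) x w := by
  rw [covariantDerivative_apply_eq_sum cov (f := fun i _ ↦ c i) (fun _ _ ↦ mdifferentiableAt_const)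
    (fun i _ ↦ mdifferentiableAt_extend I F (v i))
    (Filter.mem_of_superset ((trivializationAt F V x).open_baseSet.mem_nhds
      (mem_baseSet_trivializationAt F V x)) fun y hy ↦ extend_sum_smul_apply s c v hy)]
  simp [mvfderiv_const]

theorem covariantDerivative_apply_eq_symm_add
    [ContMDiffVectorBundle 1 F V I] [FiniteDimensional ℝ F]
    (cov : CovariantDerivative I F V) {Y : Π x, V x} (hY : MDiffAt (T% Y) x)
    (w : TangentSpace I x) :
    cov Y x w = (trivializationAt F V x).symmₗ ℝ x
        (d% (fun y ↦ (trivializationAt F V x ⟨y, Y y⟩).2) x w) + cov (extend F (Y x)) x w := by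
  set e := trivializationAt F V x
  set b := Module.finBasis ℝ F
  set φ : M → F := fun y ↦ (e ⟨y, Y y⟩).2
  have hx : x ∈ e.baseSet := mem_baseSet_trivializationAt F V x
  have hφ : MDiffAt φ x := (e.mdifferentiableAt_section_iff I Y hx).1 hY
  let c (i) : F →L[ℝ] ℝ := LinearMap.toContinuousLinearMap (b.coord i)
  have hc (a : F) : ∑ i, c i a • b i = a := b.sum_repr a
  have hf (i) : HasMFDerivAt I 𝓘(ℝ, ℝ) (fun y ↦ c i (φ y)) x ((c i).comp (mfderiv I 𝓘(ℝ, F) φ x)) :=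
    (c i).hasMFDerivAt.comp x hφ.hasMFDerivAt
  have hdf (i) : d% (fun y ↦ c i (φ y)) x w = c i (d% φ x w) := by
    simp only [mvfderiv, (hf i).mfderiv]
    rfl
  have hext (i) {y : M} (hy : y ∈ e.baseSet) :
      extend F (e.symmₗ ℝ x (b i)) y = e.symmₗ ℝ y (b i) := by
    rw [extend_apply_eq_symmₗ _ hy, e.linearMapAt_symmₗ hx]
  have hsum {y : M} (hy : y ∈ e.baseSet) :
      Y y = ∑ i, c i (φ y) • extend F (e.symmₗ ℝ x (b i)) y := by
    calc Y y = e.symmₗ ℝ y (∑ i, c i (φ y) • b i) := by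
          rw [hc, ← e.symmₗ_linearMapAt (R := ℝ) hy (Y y), e.linearMapAt_apply, if_pos hy]
      _ = _ := by simp only [hext _ hy, map_sum, map_smul]
  rw [covariantDerivative_apply_eq_sum cov (fun i _ ↦ (hf i).mdifferentiableAt)
    (fun i _ ↦ mdifferentiableAt_extend I F _) (Filter.mem_of_superset
      (e.open_baseSet.mem_nhds hx) fun y hy ↦ hsum hy), Finset.sum_add_distrib, add_comm]
  congr 1
  · simp only [hdf, hext _ hx, ← map_smul, ← map_sum, hc]
    rfl
  · rw [← covariantDerivative_extend_sum_smul, hsum hx]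
    simp only [extend_apply_self]

end CovariantDerivative

/-! ### Fields along curves -/

section Curve

variable {E : Type*} [NormedAddCommGroup E] [NormedSpace ℝ E]
  {H : Type*} [TopologicalSpace H] {I : ModelWithCorners ℝ E H}
  {M : Type*} [TopologicalSpace M] [ChartedSpace H M] {γ : ℝ → M} {s : Set ℝ}

theorem hasDerivWithinAt_comp_curve {F : Type*} [NormedAddCommGroup F] [NormedSpace ℝ F]
    {f : M → F} (t : s) (hf : MDiffAt f (γ t)) (hγ : MDiffAt[s] γ t) :
    HasDerivWithinAt (fun r ↦ f (γ r)) (d% f (γ t) (velocity I γ s t)) s t := by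
  have h := hf.hasMFDerivAt.comp_hasMFDerivWithinAt (t : ℝ) hγ.hasMFDerivWithinAt
  rw [hasMFDerivWithinAt_iff_hasFDerivWithinAt] at h
  have h' : HasFDerivWithinAt (fun r ↦ f (γ r))
      ((d% f (γ t)).comp (mfderivWithin 𝓘(ℝ, ℝ) I γ s t) : ℝ →L[ℝ] F) s t := h
  exact h'.hasDerivWithinAt

namespace FieldAlong

/-- The extension by zero of a field along `γ` on `s` to all parameters. -/
def ext (V : FieldAlong I γ s) (r : ℝ) : TangentSpace I (γ r) := (V.lift r).2

theorem ext_of_mem (V : FieldAlong I γ s) {r : ℝ} (hr : r ∈ s) : V.ext r = V ⟨r, hr⟩ := by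
  simp only [ext, lift, dif_pos hr]

theorem ext_apply (V : FieldAlong I γ s) (t : s) : V.ext t = V t := V.ext_of_mem t.2

theorem ext_of_notMem (V : FieldAlong I γ s) {r : ℝ} (hr : r ∉ s) : V.ext r = 0 := by
  simp only [ext, lift, dif_neg hr]

theorem ext_add (V W : FieldAlong I γ s) (r : ℝ) : (V + W).ext r = V.ext r + W.ext r := by
  by_cases hr : r ∈ s
  · simp only [ext_of_mem _ hr, Pi.add_apply]
  · simp only [ext_of_notMem _ hr, add_zero]

theorem ext_smul (c : ℝ) (V : FieldAlong I γ s) (r : ℝ) : (c • V).ext r = c • V.ext r := by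
  by_cases hr : r ∈ s
  · simp only [ext_of_mem _ hr, Pi.smul_apply]
  · simp only [ext_of_notMem _ hr, smul_zero]

end FieldAlong

/-- Pointwise product of a function of the parameter and a field along `γ`. -/
def FieldAlong.mulBy (f : ℝ → ℝ) (V : FieldAlong I γ s) : FieldAlong I γ s := fun t ↦ f t • V t

theorem FieldAlong.ext_mulBy (f : ℝ → ℝ) (V : FieldAlong I γ s) (r : ℝ) :
    (V.mulBy f).ext r = f r • V.ext r := by
  by_cases hr : r ∈ s
  · simp only [ext_of_mem _ hr, mulBy]
  · simp only [ext_of_notMem _ hr, smul_zero]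

variable [RiemannianBundle (fun x : M ↦ TangentSpace I x)] [FiniteDimensional ℝ E]
  [CompleteSpace E] [IsManifold I ∞ M]
  [IsContMDiffRiemannianBundle I ∞ E (fun x : M ↦ TangentSpace I x)]

theorem FieldAlong.covDeriv_apply_eq_sum {ι : Type*} {S : Finset ι} (V : FieldAlong I γ s) (t : s)
    (hγ : MDiffAt[s] γ t) (hs : UniqueDiffWithinAt ℝ s t) {f : ι → ℝ → ℝ} {f' : ι → ℝ}
    {Y : ι → Π x : M, TangentSpace I x} (hf : ∀ i ∈ S, HasDerivWithinAt (f i) (f' i) s t)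
    (hY : ∀ i ∈ S, MDiffAt (T% (Y i)) (γ t))
    (hV : ∀ᶠ r in 𝓝[s] (t : ℝ), V.ext r = ∑ i ∈ S, f i r • Y i (γ r)) :
    V.covDeriv t = ∑ i ∈ S,
      (f' i • Y i (γ t) + f i t • leviCivita (Y i) (γ t) (velocity I γ s t)) := by
  set e := trivializationAt E (TangentSpace I : M → Type _) (γ t)
  have hx : γ t ∈ e.baseSet := mem_baseSet_trivializationAt E (TangentSpace I) (γ t)
  set φ : ι → M → E := fun i y ↦ (e ⟨y, Y i y⟩).2
  have hφ (i) (hi : i ∈ S) : MDiffAt (φ i) (γ t) :=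
    (e.mdifferentiableAt_section_iff I (Y i) hx).1 (hY i hi)
  have hVt : V t = ∑ i ∈ S, f i t • Y i (γ t) := by
    rw [← V.ext_apply, hV.self_of_nhdsWithin t.2]
  have hderiv : HasDerivWithinAt (fun r ↦ (e (V.lift r)).2) (∑ i ∈ S,
      (f i t • d% (φ i) (γ t) (velocity I γ s t) + f' i • φ i (γ t))) s t := by
    have hbase : ∀ᶠ r in 𝓝[s] (t : ℝ), γ r ∈ e.baseSet :=
      hγ.continuousWithinAt.eventually (e.open_baseSet.mem_nhds hx)
    have heq : ∀ᶠ r in 𝓝[s] (t : ℝ), (e (V.lift r)).2 = ∑ i ∈ S, f i r • φ i (γ r) := by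
      filter_upwards [hbase, hV] with r hr hVr
      have hlin (v : TangentSpace I (γ r)) : (e ⟨γ r, v⟩).2 = e.linearMapAt ℝ (γ r) v := by
        rw [e.linearMapAt_apply, if_pos hr]
      change (e ⟨γ r, V.ext r⟩).2 = _
      simp only [hVr, φ, hlin, map_sum, map_smul]
    exact (HasDerivWithinAt.fun_sum fun i hi ↦
      (hf i hi).smul (hasDerivWithinAt_comp_curve t (hφ i hi) hγ)).congr_of_eventuallyEq heq
        (heq.self_of_nhdsWithin t.2)
  have hself (i) : e.symmₗ ℝ (γ t) (φ i (γ t)) = Y i (γ t) := by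
    rw [← e.symmₗ_linearMapAt (R := ℝ) hx (Y i (γ t)), e.linearMapAt_apply, if_pos hx]
  calc V.covDeriv t
      = e.symmₗ ℝ (γ t) (derivWithin (fun r ↦ (e (V.lift r)).2) s t)
        + leviCivita (extend E (V t)) (γ t) (velocity I γ s t) := by
        rw [e.symmₗ_apply hx]
        rfl
    _ = ∑ i ∈ S, (f i t • e.symmₗ ℝ (γ t) (d% (φ i) (γ t) (velocity I γ s t))
          + f' i • Y i (γ t)
          + f i t • leviCivita (extend E (Y i (γ t))) (γ t) (velocity I γ s t)) := by
        rw [hderiv.derivWithin hs, hVt, covariantDerivative_extend_sum_smul,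
          Finset.sum_add_distrib (g := fun i ↦ f i t • leviCivita _ _ _)]
        simp only [map_sum, map_add, map_smul, hself]
    _ = _ := Finset.sum_congr rfl fun i hi ↦ by
        rw [covariantDerivative_apply_eq_symm_add leviCivita (hY i hi)]
        module

end Curve

section CoordFrame

variable {E : Type*} [NormedAddCommGroup E] [NormedSpace ℝ E]
  {H : Type*} [TopologicalSpace H] {I : ModelWithCorners ℝ E H}
  {M : Type*} [TopologicalSpace M] [ChartedSpace H M] [IsManifold I ∞ M] {x₀ x : M}
  {γ : ℝ → M} {s : Set ℝ}

variable (I) in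
theorem eventually_mem_baseSet_trivializationAt (x : M) :
    ∀ᶠ y in 𝓝 x, y ∈ (trivializationAt E (TangentSpace I) x).baseSet :=
  (trivializationAt E (TangentSpace I) x).open_baseSet.mem_nhds
    (mem_baseSet_trivializationAt E (TangentSpace I) x)

theorem FieldAlong.IsSmooth.contMDiffOn_curve {V : FieldAlong I γ s} (hV : V.IsSmooth) :
    ContMDiffOn 𝓘(ℝ, ℝ) I ∞ γ s := fun t ht ↦ (contMDiffWithinAt_totalSpace.1 (hV t ht)).1

theorem FieldAlong.contMDiffWithinAt_lift_of_eventually_eq_sum {ι : Type*} {S : Finset ι}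
    {V : FieldAlong I γ s} {t : s} (hγ : ContMDiffWithinAt 𝓘(ℝ, ℝ) I ∞ γ s t) {f : ι → ℝ → ℝ}
    {Y : ι → Π x : M, TangentSpace I x} (hf : ∀ i ∈ S, ContDiffWithinAt ℝ ∞ (f i) s t)
    (hY : ∀ i ∈ S, CMDiffAt ∞ (T% (Y i)) (γ t))
    (hV : ∀ᶠ r in 𝓝[s] (t : ℝ), V.ext r = ∑ i ∈ S, f i r • Y i (γ r)) :
    ContMDiffWithinAt 𝓘(ℝ, ℝ) I.tangent ∞ V.lift s t := by
  set e := trivializationAt E (TangentSpace I : M → Type _) (γ t)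
  have hx : γ t ∈ e.baseSet := mem_baseSet_trivializationAt E (TangentSpace I) (γ t)
  have hcoord (i) (hi : i ∈ S) : ContDiffWithinAt ℝ ∞ (fun r ↦ (e ⟨γ r, Y i (γ r)⟩).2) s t :=
    (((e.contMDiffAt_section_iff hx).1 (hY i hi)).comp_contMDiffWithinAt _ hγ).contDiffWithinAt
  have heq : ∀ᶠ r in 𝓝[s] (t : ℝ),
      (e (V.lift r)).2 = ∑ i ∈ S, f i r • (e ⟨γ r, Y i (γ r)⟩).2 := by
    filter_upwards [hγ.continuousWithinAt.eventually (eventually_mem_baseSet_trivializationAt I _),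
      hV] with r hr hVr
    have hlin (v : TangentSpace I (γ r)) : (e ⟨γ r, v⟩).2 = e.linearMapAt ℝ (γ r) v := by
      rw [e.linearMapAt_apply, if_pos hr]
    change (e ⟨γ r, V.ext r⟩).2 = _
    simp only [hVr, hlin, map_sum, map_smul]
  exact contMDiffWithinAt_totalSpace.2 ⟨hγ, ((ContDiffWithinAt.sum fun i hi ↦
    (hf i hi).smul (hcoord i hi)).congr_of_eventuallyEq heq
      (heq.self_of_nhdsWithin t.2)).contMDiffWithinAt⟩

variable [FiniteDimensional ℝ E]

variable (I) in
/-- The frame of vector fields with constant coordinates in the preferred chart at `x₀`. -/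
def coordFrame (x₀ : M) (i : Fin (Module.finrank ℝ E)) : Π y : M, TangentSpace I y :=
  (trivializationAt E (TangentSpace I) x₀).localFrame (Module.finBasis ℝ E) i

theorem contMDiffAt_coordFrame (hx : x ∈ (trivializationAt E (TangentSpace I) x₀).baseSet)
    (i : Fin (Module.finrank ℝ E)) : CMDiffAt ∞ (T% (coordFrame I x₀ i)) x :=
  contMDiffAt_localFrame_of_mem ∞ _ _ _ hx

theorem contMDiffAt_coordFrame_self (x : M) (i : Fin (Module.finrank ℝ E)) :
    CMDiffAt ∞ (T% (coordFrame I x i)) x :=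
  contMDiffAt_coordFrame (mem_baseSet_trivializationAt E (TangentSpace I) x) i

theorem mdifferentiableAt_coordFrame
    (hx : x ∈ (trivializationAt E (TangentSpace I) x₀).baseSet) (i : Fin (Module.finrank ℝ E)) :
    MDiffAt (T% (coordFrame I x₀ i)) x :=
  (contMDiffAt_coordFrame hx i).mdifferentiableAt (by simp)

theorem sum_repr_smul_coordFrame (hx : x ∈ (trivializationAt E (TangentSpace I) x₀).baseSet)
    (v : TangentSpace I x) : ∑ i, (Module.finBasis ℝ E).repr
      (trivializationAt E (TangentSpace I) x₀ ⟨x, v⟩).2 i • coordFrame I x₀ i x = v := by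
  set e := trivializationAt E (TangentSpace I : M → Type _) x₀
  have hframe (i) : coordFrame I x₀ i x = e.symmₗ ℝ x (Module.finBasis ℝ E i) := by
    rw [coordFrame, e.localFrame_apply_of_mem_baseSet _ hx, e.symmₗ_apply hx]
    rfl
  simp only [hframe, ← map_smul, ← map_sum, Module.Basis.sum_repr]
  conv_rhs => rw [← e.symmₗ_linearMapAt (R := ℝ) hx v, e.linearMapAt_apply, if_pos hx]

theorem exists_eventually_eq_sum_coordFrame {Y : Π y : M, TangentSpace I y}
    (hY : MDiffAt (T% Y) x) : ∃ f : Fin (Module.finrank ℝ E) → M → ℝ,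
      (∀ i, MDiffAt (f i) x) ∧ ∀ᶠ y in 𝓝 x, Y y = ∑ i, f i y • coordFrame I x i y := by
  set e := trivializationAt E (TangentSpace I : M → Type _) x
  refine ⟨fun i y ↦ (Module.finBasis ℝ E).repr (e ⟨y, Y y⟩).2 i, fun i ↦ ?_, ?_⟩
  · exact (LinearMap.toContinuousLinearMap
      ((Module.finBasis ℝ E).coord i)).mdifferentiableAt.comp x
      ((e.mdifferentiableAt_section_iff I Y (mem_baseSet_trivializationAt E _ x)).1 hY)
  · exact (eventually_mem_baseSet_trivializationAt I x).mono fun y hy ↦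
      (sum_repr_smul_coordFrame hy (Y y)).symm

namespace FieldAlong

theorem IsSmooth.exists_eventually_eq_sum_coordFrame {V : FieldAlong I γ s} (hV : V.IsSmooth)
    (t : s) : ∃ f : Fin (Module.finrank ℝ E) → ℝ → ℝ, (∀ i, ContDiffWithinAt ℝ ∞ (f i) s t) ∧
      ∀ᶠ r in 𝓝[s] (t : ℝ), V.ext r = ∑ i, f i r • coordFrame I (γ t) i (γ r) := by
  set e := trivializationAt E (TangentSpace I : M → Type _) (γ t)
  refine ⟨fun i r ↦ (Module.finBasis ℝ E).repr (e (V.lift r)).2 i, fun i ↦ ?_, ?_⟩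
  · have hcoord : ContDiffWithinAt ℝ ∞ (fun r ↦ (e (V.lift r)).2) s t :=
      (contMDiffWithinAt_totalSpace.1 (hV t t.2)).2.contDiffWithinAt
    exact (LinearMap.toContinuousLinearMap
      ((Module.finBasis ℝ E).coord i)).contDiff.contDiffAt.comp_contDiffWithinAt _ hcoord
  · have hcont := (hV.contMDiffOn_curve t t.2).continuousWithinAt
    exact (hcont.eventually (eventually_mem_baseSet_trivializationAt I (γ t))).mono fun r hr ↦
      (sum_repr_smul_coordFrame hr (V.ext r)).symm

theorem IsSmooth.add {V W : FieldAlong I γ s} (hV : V.IsSmooth) (hW : W.IsSmooth) :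
    (V + W).IsSmooth := by
  intro t ht
  obtain ⟨f, hf, hVf⟩ := hV.exists_eventually_eq_sum_coordFrame ⟨t, ht⟩
  obtain ⟨g, hg, hWg⟩ := hW.exists_eventually_eq_sum_coordFrame ⟨t, ht⟩
  refine contMDiffWithinAt_lift_of_eventually_eq_sum (S := .univ) (t := ⟨t, ht⟩)
    (hV.contMDiffOn_curve t ht) (fun i _ ↦ (hf i).add (hg i))
    (fun i _ ↦ contMDiffAt_coordFrame_self _ i) ?_
  filter_upwards [hVf, hWg] with r hVr hWr
  simp only [ext_add, hVr, hWr, add_smul, Finset.sum_add_distrib]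

theorem IsSmooth.mulBy {f : ℝ → ℝ} (hf : ContDiffOn ℝ ∞ f s) {V : FieldAlong I γ s}
    (hV : V.IsSmooth) : (V.mulBy f).IsSmooth := by
  intro t ht
  obtain ⟨g, hg, hVg⟩ := hV.exists_eventually_eq_sum_coordFrame ⟨t, ht⟩
  refine contMDiffWithinAt_lift_of_eventually_eq_sum (S := .univ) (t := ⟨t, ht⟩)
    (hV.contMDiffOn_curve t ht) (fun i _ ↦ (hf t ht).mul (hg i))
    (fun i _ ↦ contMDiffAt_coordFrame_self _ i) ?_
  filter_upwards [hVg] with r hVr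
  simp only [ext_mulBy, hVr, Finset.smul_sum, mul_smul]

theorem IsSmooth.smul (c : ℝ) {V : FieldAlong I γ s} (hV : V.IsSmooth) : (c • V).IsSmooth :=
  hV.mulBy (f := fun _ ↦ c) contDiffOn_const

end FieldAlong

end CoordFrame

namespace FieldAlong

variable {E : Type*} [NormedAddCommGroup E] [NormedSpace ℝ E]
  {H : Type*} [TopologicalSpace H] {I : ModelWithCorners ℝ E H}
  {M : Type*} [TopologicalSpace M] [ChartedSpace H M] {γ : ℝ → M} {s : Set ℝ}
  [RiemannianBundle (fun x : M ↦ TangentSpace I x)] [FiniteDimensional ℝ E]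
  [CompleteSpace E] [IsManifold I ∞ M]
  [IsContMDiffRiemannianBundle I ∞ E (fun x : M ↦ TangentSpace I x)]
  {V W : FieldAlong I γ s}

theorem IsSmooth.covDeriv_apply_eq_sum (hs : UniqueDiffOn ℝ s) (hV : V.IsSmooth) (t : s)
    {f : Fin (Module.finrank ℝ E) → ℝ → ℝ} {f' : Fin (Module.finrank ℝ E) → ℝ}
    (hf : ∀ i, HasDerivWithinAt (f i) (f' i) s t)
    (hVf : ∀ᶠ r in 𝓝[s] (t : ℝ), V.ext r = ∑ i, f i r • coordFrame I (γ t) i (γ r)) :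
    V.covDeriv t = ∑ i, (f' i • coordFrame I (γ t) i (γ t) +
      f i t • leviCivita (coordFrame I (γ t) i) (γ t) (velocity I γ s t)) :=
  V.covDeriv_apply_eq_sum t ((hV.contMDiffOn_curve t t.2).mdifferentiableWithinAt (by simp))
    (hs t t.2) (fun i _ ↦ hf i)
    (fun i _ ↦ (contMDiffAt_coordFrame_self _ i).mdifferentiableAt (by simp)) hVf

theorem IsSmooth.exists_frame_expansion (hs : UniqueDiffOn ℝ s) (hV : V.IsSmooth) (t : s) :
    ∃ (f : Fin (Module.finrank ℝ E) → ℝ → ℝ) (f' : Fin (Module.finrank ℝ E) → ℝ),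
      (∀ i, HasDerivWithinAt (f i) (f' i) s t) ∧
      (∀ᶠ r in 𝓝[s] (t : ℝ), V.ext r = ∑ i, f i r • coordFrame I (γ t) i (γ r)) ∧
      V.covDeriv t = ∑ i, (f' i • coordFrame I (γ t) i (γ t) +
        f i t • leviCivita (coordFrame I (γ t) i) (γ t) (velocity I γ s t)) := by
  obtain ⟨f, hf, hVf⟩ := hV.exists_eventually_eq_sum_coordFrame t
  have hf' (i) := ((hf i).differentiableWithinAt (by simp)).hasDerivWithinAt
  exact ⟨f, _, hf', hVf, hV.covDeriv_apply_eq_sum hs t hf' hVf⟩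

theorem covDeriv_add (hs : UniqueDiffOn ℝ s) (hV : V.IsSmooth) (hW : W.IsSmooth) :
    (V + W).covDeriv = V.covDeriv + W.covDeriv := by
  ext1 t
  obtain ⟨f, f', hf, hVf, hV'⟩ := hV.exists_frame_expansion hs t
  obtain ⟨g, g', hg, hWg, hW'⟩ := hW.exists_frame_expansion hs t
  have hsum : ∀ᶠ r in 𝓝[s] (t : ℝ), (V + W).ext r =
      ∑ i, (f i + g i) r • coordFrame I (γ t) i (γ r) := by
    filter_upwards [hVf, hWg] with r hVr hWr
    simp only [ext_add, hVr, hWr, Pi.add_apply, add_smul, Finset.sum_add_distrib]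
  rw [(hV.add hW).covDeriv_apply_eq_sum hs t (fun i ↦ (hf i).add (hg i)) hsum, Pi.add_apply, hV',
    hW', ← Finset.sum_add_distrib]
  exact Finset.sum_congr rfl fun i _ ↦ by simp only [Pi.add_apply]; module

theorem covDeriv_mulBy_apply (hs : UniqueDiffOn ℝ s) {f : ℝ → ℝ} (hf : ContDiffOn ℝ ∞ f s)
    (hV : V.IsSmooth) {t : s} {f' : ℝ} (hf' : HasDerivWithinAt f f' s t) :
    (V.mulBy f).covDeriv t = f' • V t + f t • V.covDeriv t := by
  obtain ⟨g, g', hg, hVg, hV'⟩ := hV.exists_frame_expansion hs t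
  have hprod : ∀ᶠ r in 𝓝[s] (t : ℝ), (V.mulBy f).ext r =
      ∑ i, (f * g i) r • coordFrame I (γ t) i (γ r) := by
    filter_upwards [hVg] with r hVr
    simp only [ext_mulBy, hVr, Finset.smul_sum, mul_smul, Pi.mul_apply]
  rw [(hV.mulBy hf).covDeriv_apply_eq_sum hs t (fun i ↦ hf'.mul (hg i)) hprod, hV',
    ← V.ext_apply, hVg.self_of_nhdsWithin t.2, Finset.smul_sum, Finset.smul_sum,
    ← Finset.sum_add_distrib]
  exact Finset.sum_congr rfl fun i _ ↦ by simp only [Pi.mul_apply]; module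

theorem covDeriv_smul (hs : UniqueDiffOn ℝ s) (c : ℝ) (hV : V.IsSmooth) :
    (c • V).covDeriv = c • V.covDeriv := by
  ext1 t
  have h := covDeriv_mulBy_apply hs contDiffOn_const hV (hasDerivWithinAt_const (t : ℝ) s c)
  rwa [zero_smul, zero_add] at h

theorem hasDerivWithinAt_inner (hs : UniqueDiffOn ℝ s) (hV : V.IsSmooth) (hW : W.IsSmooth)
    (t : s) : HasDerivWithinAt (fun r ↦ inner ℝ (V.ext r) (W.ext r))
      (inner ℝ (V.covDeriv t) (W t) + inner ℝ (V t) (W.covDeriv t)) s t := by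
  obtain ⟨f, f', hf, hVf, hV'⟩ := hV.exists_frame_expansion hs t
  obtain ⟨g, g', hg, hWg, hW'⟩ := hW.exists_frame_expansion hs t
  set e := coordFrame I (γ t)
  set v := velocity I γ s t
  have he (i) : MDiffAt (T% (e i)) (γ t) :=
    (contMDiffAt_coordFrame_self _ i).mdifferentiableAt (by simp)
  have hgram (i j) : HasDerivWithinAt (fun r ↦ inner ℝ (e i (γ r)) (e j (γ r)))
      (inner ℝ (leviCivita (e i) (γ t) v) (e j (γ t))
        + inner ℝ (e i (γ t)) (leviCivita (e j) (γ t) v)) s t := by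
    have hmetric := leviCivita_metric (extend_mdiff v) (he i) (he j)
    rw [extend_apply_self] at hmetric
    rw [← hmetric]
    exact hasDerivWithinAt_comp_curve t (mdiff_inner (he i) (he j))
      ((hV.contMDiffOn_curve t t.2).mdifferentiableWithinAt (by simp))
  have hexpand : ∀ᶠ r in 𝓝[s] (t : ℝ), inner ℝ (V.ext r) (W.ext r) =
      ∑ i, ∑ j, f i r * g j r * inner ℝ (e i (γ r)) (e j (γ r)) := by
    filter_upwards [hVf, hWg] with r hVr hWr
    rw [hVr, hWr, sum_inner]
    simp only [inner_sum, real_inner_smul_left, real_inner_smul_right]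
    exact Finset.sum_congr rfl fun i _ ↦ Finset.sum_congr rfl fun j _ ↦ by ring
  refine ((HasDerivWithinAt.fun_sum fun i _ ↦ HasDerivWithinAt.fun_sum fun j _ ↦
    ((hf i).mul (hg j)).mul (hgram i j)).congr_of_eventuallyEq hexpand
      (hexpand.self_of_nhdsWithin t.2)).congr_deriv ?_
  rw [hV', hW', ← V.ext_apply, ← W.ext_apply, hVf.self_of_nhdsWithin t.2,
    hWg.self_of_nhdsWithin t.2]
  rw [sum_inner, sum_inner, ← Finset.sum_add_distrib]
  simp only [inner_sum, ← Finset.sum_add_distrib]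
  refine Finset.sum_congr rfl fun i _ ↦ Finset.sum_congr rfl fun j _ ↦ ?_
  simp only [inner_add_left, inner_add_right, real_inner_smul_left, real_inner_smul_right,
    Pi.mul_apply]
  ring

end FieldAlong

/-! ### Smoothness of covariant derivatives -/

section Smooth

variable {E : Type*} [NormedAddCommGroup E] [NormedSpace ℝ E]
  {H : Type*} [TopologicalSpace H] {I : ModelWithCorners ℝ E H}
  {M : Type*} [TopologicalSpace M] [ChartedSpace H M] {x₀ x : M} {γ : ℝ → M} {s : Set ℝ}

theorem contMDiffAt_det {ι : Type*} [Fintype ι] [DecidableEq ι] {A : M → Matrix ι ι ℝ}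
    (hA : ∀ i j, CMDiffAt ∞ (fun y ↦ A y i j) x) : CMDiffAt ∞ (fun y ↦ (A y).det) x := by
  simp only [Matrix.det_apply']
  exact contMDiffAt_finsetSum fun σ _ ↦
    contMDiffAt_const.mul (contMDiffAt_finsetProd fun i _ ↦ hA _ _)

theorem contMDiffAt_of_mulVec {ι : Type*} [Fintype ι] [DecidableEq ι] {A : M → Matrix ι ι ℝ}
    {c : M → ι → ℝ} (hA : ∀ i j, CMDiffAt ∞ (fun y ↦ A y i j) x) (hdet : (A x).det ≠ 0)
    (hc : ∀ i, CMDiffAt ∞ (fun y ↦ (A y).mulVec (c y) i) x) (i : ι) :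
    CMDiffAt ∞ (fun y ↦ c y i) x := by
  have hD := contMDiffAt_det hA
  have hN : CMDiffAt ∞ (fun y ↦ (A y).cramer ((A y).mulVec (c y)) i) x := by
    simp only [Matrix.cramer_apply]
    refine contMDiffAt_det fun j k ↦ ?_
    simp only [Matrix.updateCol_apply]
    split_ifs
    · exact hc j
    · exact hA j k
  refine (hN.div₀ hD hdet).congr_of_eventuallyEq ?_
  filter_upwards [hD.continuousAt.eventually_ne hdet] with y hy
  rw [Pi.div_apply, eq_div_iff hy, Matrix.cramer_eq_adjugate_mulVec, Matrix.mulVec_mulVec,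
    Matrix.adjugate_mul, Matrix.smul_mulVec, Matrix.one_mulVec, Pi.smul_apply, smul_eq_mul,
    mul_comm]

theorem contDiffWithinAt_derivWithin {F : Type*} [NormedAddCommGroup F] [NormedSpace ℝ F]
    {f : ℝ → F} (hs : UniqueDiffOn ℝ s) {t : ℝ} (ht : t ∈ s) (hf : ContDiffWithinAt ℝ ∞ f s t) :
    ContDiffWithinAt ℝ ∞ (derivWithin f s) s t :=
  (hf.fderivWithin_right (m := ∞) hs (by simp) ht).clm_apply contDiffWithinAt_const

variable [IsManifold I ∞ M] {X Y : Π x : M, TangentSpace I x}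

theorem eventually_mdifferentiableAt (hX : CMDiffAt ∞ (T% X) x) :
    ∀ᶠ y in 𝓝 x, MDiffAt (T% X) y :=
  ((contMDiffAt_iff_contMDiffAt_nhds (n := 1) (by simp)).1 (hX.of_le (by simp))).mono
    fun _ hy ↦ hy.mdifferentiableAt (by simp)

theorem contMDiffAt_mvfderiv {f : M → ℝ} (hf : CMDiffAt ∞ f x) (hX : CMDiffAt ∞ (T% X) x) :
    CMDiffAt ∞ (fun y ↦ d% f y (X y)) x := by
  have hdf := ContMDiffAt.mfderiv_const (m := ∞) hf (by simp)
  refine (contMDiffAt_totalSpace.1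
    (ContMDiffAt.clm_apply_of_inCoordinates hdf hX hf)).2.congr_of_eventuallyEq ?_
  filter_upwards with y
  rw [trivializationAt_model_space_apply]
  rfl

theorem contMDiffAt_mlieBracket [CompleteSpace E] (hX : CMDiffAt ∞ (T% X) x)
    (hY : CMDiffAt ∞ (T% Y) x) : CMDiffAt ∞ (T% (mlieBracket I X Y)) x :=
  haveI : IsManifold I (minSmoothness ℝ 2) M := IsManifold.of_le (n := ∞) (by
    rw [minSmoothness_of_isRCLikeNormedField]; exact ENat.LEInfty.out)
  haveI : IsManifold I (((⊤ : ℕ∞) : ℕ∞ω) + 1) M := IsManifold.of_le (n := ∞) (by simp)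
  ContMDiffAt.mlieBracket_vectorField (m := ⊤) (n := ⊤) hX hY (by simp)

theorem linearIndependent_coordFrame [FiniteDimensional ℝ E]
    (hx : x ∈ (trivializationAt E (TangentSpace I) x₀).baseSet) :
    LinearIndependent ℝ fun i ↦ coordFrame I x₀ i x :=
  (Trivialization.isLocalFrameOn_localFrame_baseSet I ∞ (trivializationAt E (TangentSpace I) x₀)
    (Module.finBasis ℝ E)).linearIndependent hx

theorem isSmooth_velocity (hγ : ContMDiffOn 𝓘(ℝ, ℝ) I ∞ γ s) (hs : UniqueDiffOn ℝ s) :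
    (velocity I γ s).IsSmooth := by
  intro t ht
  set e := trivializationAt E (TangentSpace I : M → Type _) (γ t)
  have hcoord {r : ℝ} (hr : r ∈ s) (hre : γ r ∈ e.baseSet) :
      (e ((velocity I γ s).lift r)).2 = derivWithin (fun r ↦ extChartAt I (γ t) (γ r)) s r := by
    have hchart : MDiffAt (extChartAt I (γ t)) (γ r) :=
      (contMDiffAt_extChartAt' (n := ∞) hre).mdifferentiableAt (by simp)
    rw [(hasDerivWithinAt_comp_curve ⟨r, hr⟩ hchart
      ((hγ r hr).mdifferentiableWithinAt (by simp))).derivWithin (hs r hr)]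
    change (e ⟨γ r, (velocity I γ s).ext r⟩).2 = _
    rw [FieldAlong.ext_of_mem _ hr,
      ← Trivialization.continuousLinearMapAt_apply_of_mem (R := ℝ) e hre,
      TangentBundle.continuousLinearMapAt_trivializationAt hre]
    rfl
  have hsmooth : ContDiffWithinAt ℝ ∞ (fun r ↦ extChartAt I (γ t) (γ r)) s t :=
    (contMDiffAt_extChartAt.comp_contMDiffWithinAt t (hγ t ht)).contDiffWithinAt
  refine contMDiffWithinAt_totalSpace.2 ⟨hγ t ht, ContDiffWithinAt.contMDiffWithinAt
    ((contDiffWithinAt_derivWithin hs ht hsmooth).congr_of_eventuallyEq ?_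
      (hcoord ht (mem_baseSet_trivializationAt E _ _)))⟩
  filter_upwards [self_mem_nhdsWithin, (hγ t ht).continuousWithinAt.eventually
    (eventually_mem_baseSet_trivializationAt I _)] with r hr hre
  exact hcoord hr hre

variable [RiemannianBundle (fun x : M ↦ TangentSpace I x)]

variable [IsContMDiffRiemannianBundle I ∞ E (fun x : M ↦ TangentSpace I x)]

theorem contMDiffAt_inner (hX : CMDiffAt ∞ (T% X) x) (hY : CMDiffAt ∞ (T% Y) x) :
    CMDiffAt ∞ (fun y ↦ inner ℝ (X y) (Y y)) x :=
  ContMDiffAt.inner_bundle (IB := I) (F := E) (E := fun x : M ↦ TangentSpace I x)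
    (b := fun y ↦ y) hX hY

variable [FiniteDimensional ℝ E]

theorem contMDiffAt_of_inner_coordFrame
    (hY : ∀ i, CMDiffAt ∞ (fun y ↦ inner ℝ (coordFrame I x i y) (Y y)) x) :
    CMDiffAt ∞ (T% Y) x := by
  have hx := mem_baseSet_trivializationAt E (TangentSpace I) x
  set c : M → Fin (Module.finrank ℝ E) → ℝ := fun y i ↦
    (Module.finBasis ℝ E).repr (trivializationAt E (TangentSpace I) x ⟨y, Y y⟩).2 i
  have hYc : ∀ᶠ y in 𝓝 x, Y y = ∑ i, c y i • coordFrame I x i y :=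
    (eventually_mem_baseSet_trivializationAt I x).mono fun y hy ↦
      (sum_repr_smul_coordFrame hy (Y y)).symm
  have hc : ∀ i, CMDiffAt ∞ (fun y ↦ c y i) x := by
    refine contMDiffAt_of_mulVec (A := fun y ↦ Matrix.gram ℝ fun i ↦ coordFrame I x i y)
      (fun i j ↦ ?_) ?_ fun i ↦ ?_
    · simp only [Matrix.gram_apply]
      exact contMDiffAt_inner (contMDiffAt_coordFrame_self x i) (contMDiffAt_coordFrame_self x j)
    · exact Matrix.det_gram_ne_zero_iff_linearIndependent.2 (linearIndependent_coordFrame hx)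
    · refine (hY i).congr_of_eventuallyEq ?_
      filter_upwards [hYc] with y hy
      simp only [hy, inner_sum, real_inner_smul_right, Matrix.mulVec, dotProduct,
        Matrix.gram_apply, mul_comm]
  have hsum : CMDiffAt ∞ (T% (fun y ↦ ∑ i, c y i • coordFrame I x i y)) x :=
    ContMDiffAt.sum_section fun i _ ↦ (hc i).smul_section (contMDiffAt_coordFrame_self x i)
  exact hsum.congr_of_eventuallyEq (hYc.mono fun y hy ↦ by simp only [hy])

variable [CompleteSpace E]

theorem contMDiffAt_leviCivita (hX : CMDiffAt ∞ (T% X) x) (hY : CMDiffAt ∞ (T% Y) x) :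
    CMDiffAt ∞ (T% (fun y ↦ leviCivita Y y (X y))) x := by
  refine contMDiffAt_of_inner_coordFrame fun i ↦ ?_
  have hZ := contMDiffAt_coordFrame_self (I := I) x i
  have hkoszul : CMDiffAt ∞ (fun y ↦ koszul X Y (coordFrame I x i) y) x :=
    contMDiffAt_const.mul ((((((contMDiffAt_mvfderiv (contMDiffAt_inner hY hZ) hX).add
      (contMDiffAt_mvfderiv (contMDiffAt_inner hX hZ) hY)).sub
      (contMDiffAt_mvfderiv (contMDiffAt_inner hX hY) hZ)).add
      (contMDiffAt_inner (contMDiffAt_mlieBracket hX hY) hZ)).sub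
      (contMDiffAt_inner (contMDiffAt_mlieBracket hX hZ) hY)).sub
      (contMDiffAt_inner (contMDiffAt_mlieBracket hY hZ) hX))
  refine hkoszul.congr_of_eventuallyEq ?_
  filter_upwards [eventually_mdifferentiableAt hX, eventually_mdifferentiableAt hY,
    eventually_mdifferentiableAt hZ] with y hXy hYy hZy
  rw [real_inner_comm, inner_leviCivita hXy hYy hZy]

theorem FieldAlong.IsSmooth.covDeriv (hs : UniqueDiffOn ℝ s) {V : FieldAlong I γ s}
    (hV : V.IsSmooth) : V.covDeriv.IsSmooth := by
  intro t ht
  have hγ := hV.contMDiffOn_curve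
  obtain ⟨f, hf, hVf⟩ := hV.exists_eventually_eq_sum_coordFrame ⟨t, ht⟩
  obtain ⟨g, hg, hvg⟩ := (isSmooth_velocity hγ hs).exists_eventually_eq_sum_coordFrame ⟨t, ht⟩
  set e := coordFrame I (γ t)
  have he (i) : CMDiffAt ∞ (T% (e i)) (γ t) := contMDiffAt_coordFrame_self _ i
  have hf' (i) : ContDiffWithinAt ℝ ∞ (derivWithin (f i) s) s t :=
    contDiffWithinAt_derivWithin hs ht (hf i)
  have hdiff : ∀ᶠ r in 𝓝[s] t, ∀ i, DifferentiableWithinAt ℝ (f i) s r := by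
    refine Filter.eventually_all.2 fun i ↦ ?_
    have hf1 : ContDiffWithinAt ℝ 1 (f i) s t := (hf i).of_le (by simp)
    have hev := hf1.eventually (by simp)
    rw [Set.insert_eq_of_mem ht] at hev
    exact hev.mono fun r hr ↦ hr.differentiableWithinAt (by simp)
  refine contMDiffWithinAt_lift_of_eventually_eq_sum (S := .univ) (t := ⟨t, ht⟩) (hγ t ht)
    (f := Sum.elim (fun i ↦ derivWithin (f i) s) fun p : _ × _ ↦ f p.1 * g p.2)
    (Y := Sum.elim e fun p y ↦ leviCivita (e p.1) y (e p.2 y))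
    (Sum.rec (fun i _ ↦ hf' i) fun p _ ↦ (hf p.1).mul (hg p.2))
    (Sum.rec (fun i _ ↦ he i) fun p _ ↦ contMDiffAt_leviCivita (he p.2) (he p.1)) ?_
  filter_upwards [self_mem_nhdsWithin, hdiff, hvg, eventually_eventually_nhdsWithin.2 hVf,
    (hγ t ht).continuousWithinAt.eventually (eventually_mem_baseSet_trivializationAt I _)]
    with r hr hfr hvr hVr hre
  have hv : velocity I γ s ⟨r, hr⟩ = ∑ i, g i r • e i (γ r) := by
    rw [← hvr, ext_of_mem _ hr]
  rw [ext_of_mem _ hr, V.covDeriv_apply_eq_sum ⟨r, hr⟩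
    ((hγ r hr).mdifferentiableWithinAt (by simp)) (hs r hr)
    (fun i _ ↦ (hfr i).hasDerivWithinAt) (fun i _ ↦ mdifferentiableAt_coordFrame hre i) hVr,
    Fintype.sum_sum_type, Fintype.sum_prod_type, Finset.sum_add_distrib, hv]
  simp only [map_sum, map_smul, Finset.smul_sum, smul_smul, Sum.elim_inl, Sum.elim_inr,
    Pi.mul_apply]
  rfl

end Smooth

/-! ### The curvature tensor -/

section Bracket

variable {E : Type*} [NormedAddCommGroup E] [NormedSpace ℝ E] [CompleteSpace E]
  {H : Type*} [TopologicalSpace H] {I : ModelWithCorners ℝ E H}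
  {M : Type*} [TopologicalSpace M] [ChartedSpace H M] [IsManifold I ∞ M] {x : M}
  {X Y Z : Π x : M, TangentSpace I x}

theorem mlieBracket_jacobi (hX : CMDiffAt ∞ (T% X) x) (hY : CMDiffAt ∞ (T% Y) x)
    (hZ : CMDiffAt ∞ (T% Z) x) :
    mlieBracket I X (mlieBracket I Y Z) x =
      mlieBracket I (mlieBracket I X Y) Z x + mlieBracket I Y (mlieBracket I X Z) x := by
  have hle (k : ℕ∞ω) (hk : k ≤ ∞) : minSmoothness ℝ k ≤ ∞ := by
    rwa [minSmoothness_of_isRCLikeNormedField]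
  have : IsManifold I (minSmoothness ℝ 3) M :=
    IsManifold.of_le (n := ∞) (hle 3 ENat.LEInfty.out)
  have h2 := hle 2 ENat.LEInfty.out
  exact leibniz_identity_mlieBracket_apply (hX.of_le h2) (hY.of_le h2) (hZ.of_le h2)

/-- Compare the coefficients of `Z x` in the Jacobi identity for `X`, `Y` and `f • Z`. -/
theorem mvfderiv_mlieBracket_smul {f : M → ℝ} (hf : CMDiffAt ∞ f x) (hX : CMDiffAt ∞ (T% X) x)
    (hY : CMDiffAt ∞ (T% Y) x) (hZ : CMDiffAt ∞ (T% Z) x) :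
    d% f x (mlieBracket I X Y x) • Z x =
      (d% (fun y ↦ d% f y (Y y)) x (X x) - d% (fun y ↦ d% f y (X y)) x (Y x)) • Z x := by
  have hmd {W : Π x : M, TangentSpace I x} (hW : CMDiffAt ∞ (T% W) x) : MDiffAt (T% W) x :=
    hW.mdifferentiableAt (by simp)
  have hmf {g : M → ℝ} (hg : CMDiffAt ∞ g x) : MDiffAt g x := hg.mdifferentiableAt (by simp)
  have hfnear : ∀ᶠ y in 𝓝 x, MDiffAt f y :=
    ((contMDiffAt_iff_contMDiffAt_nhds (n := 1) (by simp)).1 (hf.of_le (by simp))).mono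
      fun _ hy ↦ hy.mdifferentiableAt (by simp)
  have hexpand {V W : Π x : M, TangentSpace I x} (hV : CMDiffAt ∞ (T% V) x) :
      mlieBracket I W (mlieBracket I V (f • Z)) x =
        d% (fun y ↦ d% f y (V y)) x (W x) • Z x + d% f x (V x) • mlieBracket I W Z x
        + (d% f x (W x) • mlieBracket I V Z x + f x • mlieBracket I W (mlieBracket I V Z) x) := by
    have hV' : mlieBracket I V (f • Z) =ᶠ[𝓝 x]
        (fun y ↦ d% f y (V y)) • Z + f • mlieBracket I V Z := by
      filter_upwards [hfnear, eventually_mdifferentiableAt hZ] with y hfy hZy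
      exact mlieBracket_smul_right hfy hZy
    have hdf := contMDiffAt_mvfderiv hf hV
    have hVZ := contMDiffAt_mlieBracket hV hZ
    rw [Filter.EventuallyEq.rfl.mlieBracket_vectorField_eq hV',
      mlieBracket_add_right (hmd (hdf.smul_section hZ)) (hmd (hf.smul_section hVZ)),
      mlieBracket_smul_right (hmf hdf) (hmd hZ), mlieBracket_smul_right (hmf hf) (hmd hVZ)]
  have hjacobi := mlieBracket_jacobi hX hY (hf.smul_section hZ)
  change mlieBracket I X (mlieBracket I Y (f • Z)) x =
    mlieBracket I (mlieBracket I X Y) (f • Z) x + mlieBracket I Y (mlieBracket I X (f • Z)) x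
    at hjacobi
  rw [hexpand hY, hexpand hX, mlieBracket_smul_right (hmf hf) (hmd hZ),
    mlieBracket_jacobi hX hY hZ] at hjacobi
  linear_combination (norm := module) -hjacobi

theorem mvfderiv_mlieBracket {f : M → ℝ} (hf : CMDiffAt ∞ f x)
    (hX : CMDiffAt ∞ (T% X) x) (hY : CMDiffAt ∞ (T% Y) x) :
    d% f x (mlieBracket I X Y x) =
      d% (fun y ↦ d% f y (Y y)) x (X x) - d% (fun y ↦ d% f y (X y)) x (Y x) := by
  by_contra hne
  have hzero (w : TangentSpace I x) : w = 0 := by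
    have h := mvfderiv_mlieBracket_smul hf hX hY (contMDiffAt_extend I E w)
    rw [extend_apply_self] at h
    exact (smul_eq_zero.1 (sub_eq_zero.2 h ▸ sub_smul _ _ w)).resolve_left (sub_ne_zero.2 hne)
  apply hne
  rw [hzero (mlieBracket I X Y x), hzero (X x), hzero (Y x)]
  simp only [map_zero, sub_zero]

end Bracket

section Curvature

variable {E : Type*} [NormedAddCommGroup E] [NormedSpace ℝ E] [FiniteDimensional ℝ E]
  {H : Type*} [TopologicalSpace H] {I : ModelWithCorners ℝ E H}
  {M : Type*} [TopologicalSpace M] [ChartedSpace H M] [IsManifold I ∞ M]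
  [RiemannianBundle (fun x : M ↦ TangentSpace I x)]
  [IsContMDiffRiemannianBundle I ∞ E (fun x : M ↦ TangentSpace I x)]
  {x : M}

omit [FiniteDimensional ℝ E] in
theorem eventually_norm_le_of_contMDiffAt {X : Π x : M, TangentSpace I x}
    (hX : CMDiffAt ∞ (T% X) x) : ∀ᶠ y in 𝓝 x, ‖X y‖ ≤ 1 + ‖X x‖ := by
  have hcont : ContinuousAt (fun y ↦ ‖X y‖) x := by
    simpa only [real_inner_self_eq_norm_sq, Real.sqrt_sq (norm_nonneg _)] using
      (contMDiffAt_inner hX hX).continuousAt.sqrt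
  filter_upwards [hcont.eventually (gt_mem_nhds (lt_one_add ‖X x‖))] with y hy using hy.le

omit [IsContMDiffRiemannianBundle I ∞ E (fun x : M ↦ TangentSpace I x)] in
theorem exists_abs_repr_le [IsContinuousRiemannianBundle E (fun x : M ↦ TangentSpace I x)]
    (x₀ : M) :
    ∃ A : ℝ, ∀ᶠ x in 𝓝 x₀, ∀ (i : Fin (Module.finrank ℝ E)) (v : TangentSpace I x),
      |(Module.finBasis ℝ E).repr (trivializationAt E (TangentSpace I) x₀ ⟨x, v⟩).2 i|
        ≤ A * ‖v‖ := by
  obtain ⟨B, -, hB⟩ := eventually_norm_trivializationAt_lt E (fun x : M ↦ TangentSpace I x) x₀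
  set L : E →L[ℝ] Fin (Module.finrank ℝ E) → ℝ :=
    (Module.finBasis ℝ E).equivFunL.toContinuousLinearMap
  refine ⟨‖L‖ * B, ?_⟩
  filter_upwards [hB, eventually_mem_baseSet_trivializationAt I x₀] with x hBx hx i v
  set e := trivializationAt E (TangentSpace I : M → Type _) x₀
  calc |(Module.finBasis ℝ E).repr (e ⟨x, v⟩).2 i|
      ≤ ‖L (e ⟨x, v⟩).2‖ := norm_le_pi_norm (L (e ⟨x, v⟩).2) i
    _ ≤ ‖L‖ * ‖e.continuousLinearMapAt ℝ x v‖ := by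
        rw [Trivialization.continuousLinearMapAt_apply_of_mem (R := ℝ) e hx]
        exact L.le_opNorm _
    _ ≤ ‖L‖ * (B * ‖v‖) := by
        gcongr
        exact ContinuousLinearMap.le_of_opNorm_le _ hBx.le v
    _ = ‖L‖ * B * ‖v‖ := (mul_assoc _ _ _).symm

variable [CompleteSpace E] {X Y W Z : Π x : M, TangentSpace I x}

/-- The curvature operator `∇_X ∇_Y W - ∇_Y ∇_X W - ∇_[X,Y] W` on vector fields. -/
def curvatureOp (X Y W : Π x : M, TangentSpace I x) (x : M) : TangentSpace I x :=
  leviCivita (fun y ↦ leviCivita W y (Y y)) x (X x)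
    - leviCivita (fun y ↦ leviCivita W y (X y)) x (Y x)
    - leviCivita W x (mlieBracket I X Y x)

theorem curvature_eq_curvatureOp_extend (u v w : TangentSpace I x) :
    curvature u v w = curvatureOp (extend E u) (extend E v) (extend E w) x := by
  simp only [curvature, curvatureOp, extend_apply_self]

theorem curvatureOp_swap (X Y W : Π x : M, TangentSpace I x) (x : M) :
    curvatureOp X Y W x = -curvatureOp Y X W x := by
  rw [curvatureOp, curvatureOp, mlieBracket_swap_apply (V := X), map_neg]
  abel

theorem contMDiffAt_curvatureOp (hX : CMDiffAt ∞ (T% X) x) (hY : CMDiffAt ∞ (T% Y) x)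
    (hW : CMDiffAt ∞ (T% W) x) : CMDiffAt ∞ (T% (curvatureOp X Y W)) x :=
  ((contMDiffAt_leviCivita hX (contMDiffAt_leviCivita hY hW)).sub_section
    (contMDiffAt_leviCivita hY (contMDiffAt_leviCivita hX hW))).sub_section
    (contMDiffAt_leviCivita (contMDiffAt_mlieBracket hX hY) hW)

theorem mdifferentiableAt_leviCivita (hX : MDiffAt (T% X) x) (hW : CMDiffAt ∞ (T% W) x) :
    MDiffAt (T% (fun y ↦ leviCivita W y (X y))) x := by
  obtain ⟨f, hf, hXf⟩ := exists_eventually_eq_sum_coordFrame hX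
  have hframe (i) : MDiffAt (T% (fun y ↦ leviCivita W y (coordFrame I x i y))) x :=
    (contMDiffAt_leviCivita (contMDiffAt_coordFrame_self x i) hW).mdifferentiableAt (by simp)
  refine (MDifferentiableAt.sum_section (s := Finset.univ) fun i _ ↦
    (hf i).smul_section (hframe i)).congr_of_eventuallyEq ?_
  filter_upwards [hXf] with y hy
  simp only [hy, map_sum, map_smul, Pi.smul_apply']

theorem tensorialAt_curvatureOp (hW : CMDiffAt ∞ (T% W) x) :
    TensorialAt I E (curvatureOp · Y W x) x where
  smul {f X} hf hX := by
    have hsmul : (fun y ↦ leviCivita W y ((f • X) y)) = f • fun y ↦ leviCivita W y (X y) :=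
      funext fun y ↦ map_smul _ _ _
    simp only [curvatureOp]
    rw [hsmul, leviCivita.isCovariantDerivativeOnUniv.leibniz
      (mdifferentiableAt_leviCivita hX hW) hf, mlieBracket_smul_left hf hX]
    simp only [Pi.smul_apply', map_smul, map_add, map_neg, neg_smul, add_apply, smul_apply,
      ContinuousLinearMap.smulRight_apply]
    module
  add {X X'} hX hX' := by
    have hadd : (fun y ↦ leviCivita W y ((X + X') y)) =
        (fun y ↦ leviCivita W y (X y)) + fun y ↦ leviCivita W y (X' y) :=
      funext fun y ↦ map_add _ _ _
    simp only [curvatureOp]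
    rw [hadd, leviCivita.isCovariantDerivativeOnUniv.add
      (mdifferentiableAt_leviCivita hX hW) (mdifferentiableAt_leviCivita hX' hW),
      mlieBracket_add_left hX hX']
    simp only [Pi.add_apply, map_add, add_apply]
    module

theorem mvfderiv_mvfderiv_inner (hX : MDiffAt (T% X) x) (hY : CMDiffAt ∞ (T% Y) x)
    (hW : CMDiffAt ∞ (T% W) x) (hZ : CMDiffAt ∞ (T% Z) x) :
    d% (fun y ↦ d% (fun z ↦ inner ℝ (W z) (Z z)) y (Y y)) x (X x) =
      inner ℝ (leviCivita (fun y ↦ leviCivita W y (Y y)) x (X x)) (Z x)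
      + inner ℝ (leviCivita W x (Y x)) (leviCivita Z x (X x))
      + (inner ℝ (leviCivita W x (X x)) (leviCivita Z x (Y x))
      + inner ℝ (W x) (leviCivita (fun y ↦ leviCivita Z y (Y y)) x (X x))) := by
  have hmd {V : Π x : M, TangentSpace I x} (hV : CMDiffAt ∞ (T% V) x) : MDiffAt (T% V) x :=
    hV.mdifferentiableAt (by simp)
  have hmf {f : M → ℝ} (hf : CMDiffAt ∞ f x) : MDiffAt f x := hf.mdifferentiableAt (by simp)
  have hWY := contMDiffAt_leviCivita hY hW
  have hZY := contMDiffAt_leviCivita hY hZ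
  have hfirst : (fun y ↦ d% (fun z ↦ inner ℝ (W z) (Z z)) y (Y y)) =ᶠ[𝓝 x]
      fun y ↦ inner ℝ (leviCivita W y (Y y)) (Z y) + inner ℝ (W y) (leviCivita Z y (Y y)) := by
    filter_upwards [eventually_mdifferentiableAt hY, eventually_mdifferentiableAt hW,
      eventually_mdifferentiableAt hZ] with y hYy hWy hZy using leviCivita_metric hYy hWy hZy
  have hsecond : d% (fun y ↦ d% (fun z ↦ (inner ℝ (W z) (Z z) : ℝ)) y (Y y)) x =
      d% (fun y ↦ (inner ℝ (leviCivita W y (Y y)) (Z y) : ℝ)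
        + inner ℝ (W y) (leviCivita Z y (Y y))) x :=
    Filter.EventuallyEq.mfderiv_eq (I' := 𝓘(ℝ, ℝ)) hfirst
  rw [hsecond, mvfderiv_fun_add (hmf (contMDiffAt_inner hWY hZ)) (hmf (contMDiffAt_inner hW hZY)),
    add_apply, leviCivita_metric hX (hmd hWY) (hmd hZ), leviCivita_metric hX (hmd hW) (hmd hZY)]

theorem inner_curvatureOp (hX : CMDiffAt ∞ (T% X) x) (hY : CMDiffAt ∞ (T% Y) x)
    (hW : CMDiffAt ∞ (T% W) x) (hZ : CMDiffAt ∞ (T% Z) x) :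
    inner ℝ (curvatureOp X Y W x) (Z x) = -inner ℝ (W x) (curvatureOp X Y Z x) := by
  have hmd {V : Π x : M, TangentSpace I x} (hV : CMDiffAt ∞ (T% V) x) : MDiffAt (T% V) x :=
    hV.mdifferentiableAt (by simp)
  have hbracket := mvfderiv_mlieBracket (contMDiffAt_inner hW hZ) hX hY
  rw [leviCivita_metric (hmd (contMDiffAt_mlieBracket hX hY)) (hmd hW) (hmd hZ),
    mvfderiv_mvfderiv_inner (hmd hX) hY hW hZ, mvfderiv_mvfderiv_inner (hmd hY) hX hW hZ]
    at hbracket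
  simp only [curvatureOp, inner_sub_left, inner_sub_right]
  linarith

theorem curvature_swap (u v w : TangentSpace I x) : curvature u v w = -curvature v u w := by
  rw [curvature_eq_curvatureOp_extend, curvatureOp_swap, ← curvature_eq_curvatureOp_extend]

theorem inner_curvature (u v w z : TangentSpace I x) :
    inner ℝ (curvature u v w) z = -inner ℝ w (curvature u v z) := by
  have h := inner_curvatureOp (contMDiffAt_extend I E u) (contMDiffAt_extend I E v)
    (contMDiffAt_extend I E w) (contMDiffAt_extend I E z)
  simpa only [curvature_eq_curvatureOp_extend, extend_apply_self] using h

theorem curvature_eq_curvatureOp (hX : CMDiffAt ∞ (T% X) x) (hY : CMDiffAt ∞ (T% Y) x)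
    (hW : CMDiffAt ∞ (T% W) x) : curvature (X x) (Y x) (W x) = curvatureOp X Y W x := by
  have hleft {X Y W : Π x : M, TangentSpace I x} (hX : CMDiffAt ∞ (T% X) x)
      (hW : CMDiffAt ∞ (T% W) x) :
      curvatureOp (extend E (X x)) Y W x = curvatureOp X Y W x :=
    (tensorialAt_curvatureOp hW).pointwise (extend_mdiff _) (hX.mdifferentiableAt (by simp))
      (extend_apply_self _ _)
  have hext (v : TangentSpace I x) : CMDiffAt ∞ (T% (extend E v)) x := contMDiffAt_extend I E v
  refine ext_inner_right ℝ fun z ↦ ?_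
  rw [inner_curvature, curvature_eq_curvatureOp_extend, hleft hX (hext z), curvatureOp_swap,
    hleft hY (hext z), ← curvatureOp_swap, ← inner_curvatureOp hX hY hW (hext z),
    extend_apply_self]

theorem curvature_sum_smul_left {ι : Type*} [Fintype ι] (c : ι → ℝ) (u : ι → TangentSpace I x)
    (v w : TangentSpace I x) :
    curvature (∑ i, c i • u i) v w = ∑ i, c i • curvature (u i) v w := by
  have hT := tensorialAt_curvatureOp (Y := extend E v) (contMDiffAt_extend I E w)
  have hlin (u : TangentSpace I x) : curvature u v w = TensorialAt.mkHom _ x hT u := by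
    rw [hT.mkHom_apply_eq_extend, curvature_eq_curvatureOp_extend]
  simp only [hlin, map_sum, map_smul]

theorem curvature_sum_smul_middle {ι : Type*} [Fintype ι] (c : ι → ℝ) (u : TangentSpace I x)
    (v : ι → TangentSpace I x) (w : TangentSpace I x) :
    curvature u (∑ i, c i • v i) w = ∑ i, c i • curvature u (v i) w := by
  simp only [curvature_swap u, curvature_sum_smul_left, smul_neg, Finset.sum_neg_distrib]

theorem curvature_sum_smul_right {ι : Type*} [Fintype ι] (c : ι → ℝ) (u v : TangentSpace I x)
    (w : ι → TangentSpace I x) :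
    curvature u v (∑ i, c i • w i) = ∑ i, c i • curvature u v (w i) := by
  refine ext_inner_right ℝ fun z ↦ ?_
  simp only [sum_inner, real_inner_smul_left, inner_curvature, mul_neg, Finset.sum_neg_distrib]

theorem exists_norm_curvature_le (x₀ : M) :
    ∃ C : ℝ, ∀ᶠ x in 𝓝 x₀, ∀ u v w : TangentSpace I x,
      ‖curvature u v w‖ ≤ C * ‖u‖ * ‖v‖ * ‖w‖ := by
  have : IsContinuousRiemannianBundle E (fun x : M ↦ TangentSpace I x) := by
    obtain ⟨g, hg, hinner⟩ := IsContMDiffRiemannianBundle.exists_contMDiff (IB := I) (n := ∞)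
      (F := E) (E := fun x : M ↦ TangentSpace I x)
    exact ⟨g, hg.continuous, hinner⟩
  obtain ⟨A, hA⟩ := exists_abs_repr_le (I := I) (E := E) x₀
  set K := fun i j k ↦ curvatureOp (coordFrame I x₀ i) (coordFrame I x₀ j) (coordFrame I x₀ k)
  have hK : ∀ᶠ x in 𝓝 x₀, ∀ i j k, ‖K i j k x‖ ≤ 1 + ‖K i j k x₀‖ :=
    Filter.eventually_all.2 fun i ↦ Filter.eventually_all.2 fun j ↦ Filter.eventually_all.2 fun k ↦
      eventually_norm_le_of_contMDiffAt (contMDiffAt_curvatureOp (contMDiffAt_coordFrame_self x₀ i)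
        (contMDiffAt_coordFrame_self x₀ j) (contMDiffAt_coordFrame_self x₀ k))
  refine ⟨∑ k, ∑ j, ∑ i, A * (A * (A * (1 + ‖K i j k x₀‖))), ?_⟩
  filter_upwards [hA, eventually_mem_baseSet_trivializationAt I x₀, hK] with x hA hx hK u v w
  set c : TangentSpace I x → Fin (Module.finrank ℝ E) → ℝ := fun v i ↦
    (Module.finBasis ℝ E).repr (trivializationAt E (TangentSpace I) x₀ ⟨x, v⟩).2 i
  have hsum (v : TangentSpace I x) : v = ∑ i, c v i • coordFrame I x₀ i x :=
    (sum_repr_smul_coordFrame hx v).symm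
  have hexpand : curvature u v w = ∑ k, ∑ j, ∑ i, c w k • c v j • c u i • K i j k x := by
    have hframe (i j k) : K i j k x =
        curvature (coordFrame I x₀ i x) (coordFrame I x₀ j x) (coordFrame I x₀ k x) :=
      (curvature_eq_curvatureOp (contMDiffAt_coordFrame hx i) (contMDiffAt_coordFrame hx j)
        (contMDiffAt_coordFrame hx k)).symm
    conv_lhs => rw [hsum u, hsum v, hsum w]
    simp only [curvature_sum_smul_right, curvature_sum_smul_middle, curvature_sum_smul_left,
      Finset.smul_sum, hframe]
  simp only [hexpand, Finset.sum_mul]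
  refine norm_sum_le_of_le _ fun k _ ↦ norm_sum_le_of_le _ fun j _ ↦
    norm_sum_le_of_le _ fun i _ ↦ ?_
  simp only [norm_smul, Real.norm_eq_abs]
  calc |c w k| * (|c v j| * (|c u i| * ‖K i j k x‖))
      ≤ (A * ‖w‖) * ((A * ‖v‖) * ((A * ‖u‖) * (1 + ‖K i j k x₀‖))) := by
        have hAw := (abs_nonneg _).trans (hA k w)
        have hAv := (abs_nonneg _).trans (hA j v)
        have hAu := (abs_nonneg _).trans (hA i u)
        gcongr
        exacts [hA k w, hA j v, hA i u, hK i j k]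
    _ = A * (A * (A * (1 + ‖K i j k x₀‖))) * ‖u‖ * ‖v‖ * ‖w‖ := by ring

end Curvature

/-! ### Spaces of Jacobi fields -/

theorem exists_forall_of_eventually_nhdsWithin {X : Type*} [TopologicalSpace X] {s : Set X}
    (hs : IsCompact s) {p : X → ℝ → Prop} (hp : ∀ x, Monotone (p x))
    (h : ∀ x ∈ s, ∃ C, ∀ᶠ y in 𝓝[s] x, p y C) : ∃ C, ∀ x ∈ s, p x C := by
  refine hs.induction_on (p := fun K ↦ ∃ C, ∀ x ∈ K, p x C) ⟨0, by simp⟩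
    (fun _ _ hK ⟨C, hC⟩ ↦ ⟨C, fun x hx ↦ hC x (hK hx)⟩) ?_ fun x hx ↦ ?_
  · rintro K L ⟨C, hC⟩ ⟨D, hD⟩
    refine ⟨max C D, fun x hx ↦ hx.elim (fun hxK ↦ ?_) fun hxL ↦ ?_⟩
    · exact hp x (le_max_left C D) (hC x hxK)
    · exact hp x (le_max_right C D) (hD x hxL)
  · obtain ⟨C, hC⟩ := h x hx
    exact ⟨_, hC, C, fun _ hy ↦ hy⟩

theorem eq_zero_of_norm_deriv_le_mul_norm {F : Type*} [NormedAddCommGroup F] [NormedSpace ℝ F]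
    {f f' : ℝ → F} {a b K t₀ t : ℝ}
    (hf : ∀ r ∈ Set.Icc a b, HasDerivWithinAt f (f' r) (Set.Icc a b) r)
    (hf' : ∀ r ∈ Set.Icc a b, ‖f' r‖ ≤ K * ‖f r‖) (ht₀ : t₀ ∈ Set.Icc a b) (hft₀ : f t₀ = 0)
    (ht : t ∈ Set.Icc a b) : f t = 0 := by
  wlog hle : t₀ ≤ t generalizing f f' a b t₀ t
  · have hneg {x : ℝ} (hx : x ∈ Set.Icc (-b) (-a)) : -x ∈ Set.Icc a b :=
      ⟨le_neg_of_le_neg hx.2, neg_le_of_neg_le hx.1⟩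
    have hmem {x : ℝ} (hx : x ∈ Set.Icc a b) : -x ∈ Set.Icc (-b) (-a) :=
      ⟨neg_le_neg hx.2, neg_le_neg hx.1⟩
    have := this (f := fun r ↦ f (-r)) (f' := fun r ↦ -f' (-r)) (t := -t)
      (fun r hr ↦ by
        simpa [Function.comp_def] using (hf (-r) (hneg hr)).scomp r
          (hasDerivAt_neg r).hasDerivWithinAt fun x hx ↦ hneg hx)
      (fun r hr ↦ by simpa using hf' (-r) (hneg hr)) (hmem ht₀) (by simpa using hft₀) (hmem ht)
      (neg_le_neg (le_of_not_ge hle))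
    simpa using this
  refine eq_zero_of_abs_deriv_le_mul_abs_self_of_eq_zero_right (f' := f') (K := K)
    (fun r hr ↦ ((hf r ⟨ht₀.1.trans hr.1, hr.2.trans ht.2⟩).continuousWithinAt).mono
      (Set.Icc_subset_Icc ht₀.1 ht.2)) (fun r hr ↦ ?_) hft₀
    (fun r hr ↦ hf' r ⟨ht₀.1.trans hr.1, hr.2.le.trans ht.2⟩) t (Set.right_mem_Icc.2 hle)
  have hr' : r ∈ Set.Ico a b := ⟨ht₀.1.trans hr.1, hr.2.trans_le ht.2⟩
  exact (hf r (Set.Ico_subset_Icc_self hr')).mono_of_mem_nhdsWithin (Icc_mem_nhdsGE_of_mem hr')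

section InnerProductSpace

variable {F : Type*} [NormedAddCommGroup F] [InnerProductSpace ℝ F]

theorem abs_deriv_sum_sq_norm_le {p q w : F} {C : ℝ} (hC : 0 ≤ C) (hw : ‖w‖ ≤ C * ‖p‖) :
    |⟪q, p⟫ + ⟪p, q⟫ + (⟪w, q⟫ + ⟪q, w⟫)| ≤ (1 + C) * (⟪p, p⟫ + ⟪q, q⟫) := by
  have hqw : ‖q‖ * ‖w‖ ≤ C * (‖p‖ * ‖q‖) := by
    calc ‖q‖ * ‖w‖ ≤ ‖q‖ * (C * ‖p‖) := by gcongr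
      _ = _ := by ring
  rw [real_inner_comm p q, real_inner_comm q w, real_inner_self_eq_norm_sq,
    real_inner_self_eq_norm_sq, ← two_mul, ← two_mul, ← mul_add, abs_mul, abs_two]
  calc 2 * |⟪p, q⟫ + ⟪q, w⟫| ≤ 2 * (‖p‖ * ‖q‖ + ‖q‖ * ‖w‖) := by
        gcongr
        exact (abs_add_le _ _).trans
          (add_le_add (abs_real_inner_le_norm p q) (abs_real_inner_le_norm q w))
    _ ≤ (1 + C) * (2 * ‖p‖ * ‖q‖) := by linarith
    _ ≤ (1 + C) * (‖p‖ ^ 2 + ‖q‖ ^ 2) := by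
        gcongr
        exact two_mul_le_add_sq _ _

theorem inner_apply_le_of_hasEigenvalue_le [FiniteDimensional ℝ F] {T : Module.End ℝ F}
    (hT : T.IsSymmetric) {c : ℝ} (hc : ∀ μ : ℝ, T.HasEigenvalue μ → μ ≤ c) (v : F) :
    ⟪T v, v⟫ ≤ c * ‖v‖ ^ 2 := by
  set e := hT.eigenvectorBasis rfl
  have hinner : ⟪T v, v⟫ = ∑ i, hT.eigenvalues rfl i * e.repr v i ^ 2 := by
    rw [← e.repr.inner_map_map, PiLp.inner_apply]
    refine Finset.sum_congr rfl fun i _ ↦ ?_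
    rw [hT.eigenvectorBasis_apply_self_apply rfl v i]
    simp only [RCLike.inner_apply, conj_trivial, RCLike.ofReal_real_eq_id, id]
    ring
  rw [hinner, ← e.repr.norm_map, EuclideanSpace.real_norm_sq_eq, Finset.mul_sum]
  gcongr with i
  exact hc _ (hT.hasEigenvalue_eigenvalues rfl i)

theorem linearIndependent_pair_of_inner_eq_zero {u v : F} (hu : u ≠ 0) (hv : v ≠ 0)
    (huv : ⟪u, v⟫ = 0) : LinearIndependent ℝ ![u, v] := by
  refine linearIndependent_of_ne_zero_of_inner_eq_zero (𝕜 := ℝ) ?_ ?_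
  · simp [Fin.forall_fin_two, hu, hv]
  · simp [Pairwise, Fin.forall_fin_two, huv, real_inner_comm u v]

end InnerProductSpace

section Jacobi

variable {E : Type*} [NormedAddCommGroup E] [NormedSpace ℝ E] [FiniteDimensional ℝ E]
  {H : Type*} [TopologicalSpace H] {I : ModelWithCorners ℝ E H}
  {M : Type*} [TopologicalSpace M] [ChartedSpace H M] [IsManifold I ∞ M]
  [RiemannianBundle (fun x : M ↦ TangentSpace I x)]
  [IsContMDiffRiemannianBundle I ∞ E (fun x : M ↦ TangentSpace I x)]
  [CompleteSpace E] {γ : ℝ → M} {s : Set ℝ} {a b : ℝ}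

namespace FieldAlong

theorem IsSmooth.continuousOn_inner (hs : UniqueDiffOn ℝ s) {V W : FieldAlong I γ s}
    (hV : V.IsSmooth) (hW : W.IsSmooth) : ContinuousOn (fun r ↦ ⟪V.ext r, W.ext r⟫) s :=
  fun r hr ↦ (hasDerivWithinAt_inner hs hV hW ⟨r, hr⟩).continuousWithinAt

theorem IsSmooth.eventually_norm_le (hs : UniqueDiffOn ℝ s) {V : FieldAlong I γ s}
    (hV : V.IsSmooth) (t : s) : ∀ᶠ r in 𝓝[s] (t : ℝ), ‖V.ext r‖ ≤ ‖V t‖ + 1 := by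
  have hcont := (hV.continuousOn_inner hs hV t t.2).sqrt
  simp only [real_inner_self_eq_norm_sq, Real.sqrt_sq (norm_nonneg _)] at hcont
  filter_upwards [hcont.eventually_lt_const (lt_add_one _)] with r hr
  exact V.ext_apply t ▸ hr.le

theorem IsSmooth.exists_norm_curvature_le (hs : UniqueDiffOn ℝ s) (hsc : IsCompact s)
    {V W : FieldAlong I γ s} (hV : V.IsSmooth) (hW : W.IsSmooth) :
    ∃ C, 0 ≤ C ∧ ∀ (t : s) (u : TangentSpace I (γ t)), ‖curvature u (V t) (W t)‖ ≤ C * ‖u‖ := by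
  have hlocal (t : ℝ) (ht : t ∈ s) : ∃ C, ∀ᶠ r in 𝓝[s] t,
      ∀ u : TangentSpace I (γ r), ‖curvature u (V.ext r) (W.ext r)‖ ≤ C * ‖u‖ := by
    obtain ⟨C, hC⟩ := JacobiSplitting.exists_norm_curvature_le (I := I) (γ t)
    refine ⟨|C| * (‖V ⟨t, ht⟩‖ + 1) * (‖W ⟨t, ht⟩‖ + 1), ?_⟩
    filter_upwards [(hV.contMDiffOn_curve t ht).continuousWithinAt.eventually hC,
      hV.eventually_norm_le hs ⟨t, ht⟩, hW.eventually_norm_le hs ⟨t, ht⟩] with r hCr hVr hWr u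
    calc ‖curvature u (V.ext r) (W.ext r)‖ ≤ C * ‖u‖ * ‖V.ext r‖ * ‖W.ext r‖ := hCr u _ _
      _ ≤ |C| * ‖u‖ * (‖V ⟨t, ht⟩‖ + 1) * (‖W ⟨t, ht⟩‖ + 1) := by
        gcongr
        exact le_abs_self C
      _ = _ := by ring
  obtain ⟨C, hC⟩ := exists_forall_of_eventually_nhdsWithin hsc (p := fun r C ↦
      ∀ u : TangentSpace I (γ r), ‖curvature u (V.ext r) (W.ext r)‖ ≤ C * ‖u‖)
    (fun r C D hCD h u ↦ (h u).trans (mul_le_mul_of_nonneg_right hCD (norm_nonneg u))) hlocal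
  refine ⟨max C 0, le_max_right C 0, fun t u ↦ ?_⟩
  have h := hC t t.2 u
  rw [ext_apply, ext_apply] at h
  exact h.trans (mul_le_mul_of_nonneg_right (le_max_left C 0) (norm_nonneg u))

theorem IsJacobi.eq_zero (hab : a < b) {J : FieldAlong I γ (Set.Icc a b)} (hJ : J.IsJacobi)
    {t₀ : Set.Icc a b} (h0 : J t₀ = 0) (h0' : J.covDeriv t₀ = 0) : J = 0 := by
  have hs := uniqueDiffOn_Icc hab
  have hJ' := hJ.1.covDeriv hs
  have hvel := isSmooth_velocity hJ.1.contMDiffOn_curve hs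
  obtain ⟨C, hC0, hC⟩ := hvel.exists_norm_curvature_le hs isCompact_Icc hvel
  have hJ''le (t : Set.Icc a b) : ‖J.covDeriv.covDeriv t‖ ≤ C * ‖J t‖ := by
    rw [eq_neg_of_add_eq_zero_left (hJ.2 t), norm_neg]
    exact hC t (J t)
  set f : ℝ → ℝ := fun r ↦ ⟪J.ext r, J.ext r⟫ + ⟪J.covDeriv.ext r, J.covDeriv.ext r⟫
  have hf (r : ℝ) (hr : r ∈ Set.Icc a b) :=
    (hasDerivWithinAt_inner hs hJ.1 hJ.1 ⟨r, hr⟩).add (hasDerivWithinAt_inner hs hJ' hJ' ⟨r, hr⟩)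
  funext t
  have hft : f t = 0 := by
    refine eq_zero_of_norm_deriv_le_mul_norm (f' := fun r ↦
      ⟪J.covDeriv.ext r, J.ext r⟫ + ⟪J.ext r, J.covDeriv.ext r⟫
        + (⟪J.covDeriv.covDeriv.ext r, J.covDeriv.ext r⟫
          + ⟪J.covDeriv.ext r, J.covDeriv.covDeriv.ext r⟫)) (K := 1 + C)
      (fun r hr ↦ ?_) (fun r hr ↦ ?_) t₀.2 (by simp [f, ext_apply, h0, h0']) t.2
    · simp only [ext_of_mem _ hr]
      exact hf r hr
    · rw [Real.norm_eq_abs, Real.norm_of_nonneg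
        (add_nonneg real_inner_self_nonneg real_inner_self_nonneg)]
      refine abs_deriv_sum_sq_norm_le hC0 ?_
      simpa only [ext_of_mem _ hr] using hJ''le ⟨r, hr⟩
  have hsum : ⟪J t, J t⟫ + ⟪J.covDeriv t, J.covDeriv t⟫ = 0 := by simpa [f, ext_apply] using hft
  exact inner_self_eq_zero.1 (add_eq_zero_iff_of_nonneg real_inner_self_nonneg
    real_inner_self_nonneg |>.1 hsum).1

theorem IsNormal.covDeriv (hγ : IsGeodesicOn I γ s) (hs : UniqueDiffOn ℝ s)
    {V : FieldAlong I γ s} (hV : V.IsSmooth) (hVn : V.IsNormal) : V.covDeriv.IsNormal := by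
  intro t
  have hderiv := hasDerivWithinAt_inner hs hV (isSmooth_velocity hγ.1 hs) t
  have hconst : HasDerivWithinAt (fun r ↦ ⟪V.ext r, (velocity I γ s).ext r⟫) 0 s t := by
    refine (hasDerivWithinAt_const (t : ℝ) s (0 : ℝ)).congr_of_mem (fun r hr ↦ ?_) t.2
    rw [ext_of_mem _ hr, ext_of_mem _ hr]
    exact hVn ⟨r, hr⟩
  simpa [hγ.2] using (hs t t.2).eq_deriv _ hderiv hconst

end FieldAlong

end Jacobi

section RiccatiOperator

theorem exists_eq_add_of_selfAdjoint {Λ V : Type*} [AddCommGroup Λ] [Module ℝ Λ]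
    [FiniteDimensional ℝ Λ] [NormedAddCommGroup V] [InnerProductSpace ℝ V] {A B : Λ →ₗ[ℝ] V}
    {N : Submodule ℝ V} [FiniteDimensional ℝ N] (hself : ∀ J K, ⟪B J, A K⟫ = ⟪A J, B K⟫)
    (hzero : ∀ J, A J = 0 → B J = 0 → J = 0) (hA : ∀ J, A J ∈ N) (hB : ∀ J, B J ∈ N)
    (hN : Module.finrank ℝ N = Module.finrank ℝ Λ) (J : Λ) :
    ∃ L K, A K = 0 ∧ B J = A L + B K := by
  have hrange : LinearMap.range A ≤ N := LinearMap.range_le_iff_comap.2 (by ext; simp [hA])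
  have hmap : (LinearMap.ker A).map B ≤ N := Submodule.map_le_iff_le_comap.2 fun K _ ↦ hB K
  have hinf : LinearMap.range A ⊓ (LinearMap.ker A).map B = ⊥ := by
    rw [Submodule.eq_bot_iff]
    rintro _ ⟨⟨L, rfl⟩, K, hK, hKL⟩
    have h := hself K L
    rw [LinearMap.mem_ker.1 hK, inner_zero_left, hKL] at h
    exact inner_self_eq_zero.1 h
  have hker : Module.finrank ℝ ((LinearMap.ker A).map B) = Module.finrank ℝ (LinearMap.ker A) := by
    rw [← LinearMap.range_domRestrict]
    exact LinearMap.finrank_range_of_inj ((injective_iff_map_eq_zero _).2 fun K hK ↦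
      Subtype.ext (hzero K K.2 hK))
  have hsup : LinearMap.range A ⊔ (LinearMap.ker A).map B = N := by
    refine Submodule.eq_of_le_of_finrank_eq (sup_le hrange hmap) ?_
    have hcount := Submodule.finrank_sup_add_finrank_inf_eq (LinearMap.range A)
      ((LinearMap.ker A).map B)
    rw [hinf, finrank_bot, add_zero, hker, LinearMap.finrank_range_add_finrank_ker] at hcount
    rw [hcount, hN]
  obtain ⟨_, ⟨L, rfl⟩, _, ⟨K, hK, rfl⟩, hLK⟩ := Submodule.mem_sup.1 (hsup.symm ▸ hB J)
  exact ⟨L, K, hK, hLK.symm⟩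

variable {E : Type*} [NormedAddCommGroup E] [NormedSpace ℝ E]
  {H : Type*} [TopologicalSpace H] {I : ModelWithCorners ℝ E H}
  {M : Type*} [TopologicalSpace M] [ChartedSpace H M] {γ : ℝ → M} {s : Set ℝ} {a b : ℝ}

/-- Evaluation at the parameter `t` of the fields in `Λ`; it is zero for `t ∉ s`. -/
def evalMap (Λ : Submodule ℝ (FieldAlong I γ s)) (t : ℝ) : Λ →ₗ[ℝ] TangentSpace I (γ t) where
  toFun J := (J : FieldAlong I γ s).ext t
  map_add' _ _ := FieldAlong.ext_add _ _ t
  map_smul' c _ := FieldAlong.ext_smul c _ t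

theorem evalMap_apply {Λ : Submodule ℝ (FieldAlong I γ s)} {t : ℝ} (ht : t ∈ s) (J : Λ) :
    evalMap Λ t J = (J : FieldAlong I γ s) ⟨t, ht⟩ :=
  FieldAlong.ext_of_mem _ ht

variable [RiemannianBundle (fun x : M ↦ TangentSpace I x)]

theorem mem_normalSpace_iff {t : s} {v : TangentSpace I (γ t)} :
    v ∈ normalSpace I γ s t ↔ ⟪v, velocity I γ s t⟫ = 0 := by
  rw [normalSpace, Submodule.mem_orthogonal_singleton_iff_inner_left]

theorem finrank_normalSpace [FiniteDimensional ℝ E] {t : s} (h : velocity I γ s t ≠ 0) :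
    Module.finrank ℝ (normalSpace I γ s t) + 1 = Module.finrank ℝ E := by
  have hsum := Submodule.finrank_add_finrank_orthogonal (Submodule.span ℝ {velocity I γ s t})
  rwa [finrank_span_singleton h, add_comm] at hsum

theorem range_evalMap [FiniteDimensional ℝ E] {Λ : Submodule ℝ (FieldAlong I γ s)} {t : s}
    (hΛ : ∀ J ∈ Λ, J.IsNormal) (hvel : velocity I γ s t ≠ 0)
    (hdim : Module.finrank ℝ Λ + 1 = Module.finrank ℝ E) (hinj : ∀ J, evalMap Λ t J = 0 → J = 0) :
    LinearMap.range (evalMap Λ t) = normalSpace I γ s t := by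
  refine Submodule.eq_of_le_of_finrank_eq ?_ ?_
  · rintro _ ⟨J, rfl⟩
    rw [evalMap_apply t.2]
    exact mem_normalSpace_iff.2 (hΛ J J.2 t)
  · rw [LinearMap.finrank_range_of_inj ((injective_iff_map_eq_zero _).2 hinj)]
    exact Nat.add_right_cancel (hdim.trans (finrank_normalSpace hvel).symm)

variable [FiniteDimensional ℝ E] [IsManifold I ∞ M]
  [IsContMDiffRiemannianBundle I ∞ E (fun x : M ↦ TangentSpace I x)] [CompleteSpace E]

/-- Evaluation at the parameter `t` of the covariant derivatives of the fields in `Λ`; it is zero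
for `t ∉ s`. -/
def evalDerivMap (hs : UniqueDiffOn ℝ s) {Λ : Submodule ℝ (FieldAlong I γ s)}
    (hΛ : ∀ J ∈ Λ, J.IsSmooth) (t : ℝ) : Λ →ₗ[ℝ] TangentSpace I (γ t) where
  toFun J := (J : FieldAlong I γ s).covDeriv.ext t
  map_add' J K := by
    rw [← FieldAlong.ext_add, ← FieldAlong.covDeriv_add hs (hΛ J J.2) (hΛ K K.2),
      Submodule.coe_add]
  map_smul' c J := by
    rw [RingHom.id_apply, ← FieldAlong.ext_smul, ← FieldAlong.covDeriv_smul hs c (hΛ J J.2),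
      Submodule.coe_smul]

theorem evalDerivMap_apply (hs : UniqueDiffOn ℝ s) {Λ : Submodule ℝ (FieldAlong I γ s)}
    (hΛ : ∀ J ∈ Λ, J.IsSmooth) {t : ℝ} (ht : t ∈ s) (J : Λ) :
    evalDerivMap hs hΛ t J = (J : FieldAlong I γ s).covDeriv ⟨t, ht⟩ :=
  FieldAlong.ext_of_mem _ ht

theorem RiccatiSelfAdjoint.inner_evalDerivMap (hs : UniqueDiffOn ℝ s)
    {Λ : Submodule ℝ (FieldAlong I γ s)} (hself : RiccatiSelfAdjoint Λ)
    (hΛ : ∀ J ∈ Λ, J.IsSmooth) {t : ℝ} (ht : t ∈ s) (J K : Λ) :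
    ⟪evalDerivMap hs hΛ t J, evalMap Λ t K⟫ = ⟪evalMap Λ t J, evalDerivMap hs hΛ t K⟫ := by
  simp only [evalMap_apply ht, evalDerivMap_apply _ _ ht]
  exact hself J J.2 K K.2 ⟨t, ht⟩

theorem eq_zero_of_evalMap_of_evalDerivMap (hab : a < b)
    {Λ : Submodule ℝ (FieldAlong I γ (Set.Icc a b))} (hΛ : ∀ J ∈ Λ, J.IsJacobi) {t : ℝ}
    (ht : t ∈ Set.Icc a b) {J : Λ} (hval : evalMap Λ t J = 0)
    (hderiv : evalDerivMap (uniqueDiffOn_Icc hab) (fun J hJ ↦ (hΛ J hJ).1) t J = 0) : J = 0 := by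
  rw [evalMap_apply ht] at hval
  rw [evalDerivMap_apply _ _ ht] at hderiv
  exact Subtype.ext ((hΛ J J.2).eq_zero hab hval hderiv)

theorem finiteDimensional_of_isJacobi (hab : a < b)
    {Λ : Submodule ℝ (FieldAlong I γ (Set.Icc a b))} (hΛ : ∀ J ∈ Λ, J.IsJacobi) :
    FiniteDimensional ℝ Λ := by
  refine Module.Finite.of_injective ((evalMap Λ a).prod
    (evalDerivMap (uniqueDiffOn_Icc hab) (fun J hJ ↦ (hΛ J hJ).1) a))
    ((injective_iff_map_eq_zero _).2 fun J hJ ↦ ?_)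
  obtain ⟨hval, hderiv⟩ := Prod.mk_eq_zero.1 hJ
  exact eq_zero_of_evalMap_of_evalDerivMap hab hΛ (Set.left_mem_Icc.2 hab.le) hval hderiv

theorem sq_norm_le_inner_curvature {x : M} {u v : TangentSpace I x} (hv : ‖v‖ = 1)
    (huv : ⟪u, v⟫ = 0) (hsec : LinearIndependent ℝ ![u, v] → 1 ≤ sectionalCurvature u v) :
    ‖u‖ ^ 2 ≤ ⟪curvature u v v, u⟫ := by
  rcases eq_or_ne u 0 with rfl | hu
  · simp
  have hv₀ : v ≠ 0 := norm_ne_zero_iff.1 (by simp [hv])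
  have hle := hsec (linearIndependent_pair_of_inner_eq_zero hu hv₀ huv)
  have hpos : 0 < ‖u‖ ^ 2 := by positivity
  rwa [sectionalCurvature, hv, huv, one_pow, mul_one, zero_pow two_ne_zero, sub_zero,
    le_div_iff₀ hpos, one_mul] at hle

namespace IsRiccatiOperator

variable {Λ : Submodule ℝ (FieldAlong I γ (Set.Icc a b))} {t : Set.Icc a b}
  {S : Module.End ℝ (normalSpace I γ (Set.Icc a b) t)}

theorem eq_zero (hS : IsRiccatiOperator Λ t S) (hab : a < b) (hΛ : ∀ J ∈ Λ, J.IsJacobi) {J : Λ}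
    (hJ : evalMap Λ t J = 0) : J = 0 := by
  rw [evalMap_apply t.2] at hJ
  have hderiv := hS J J.2 0 hJ.symm
  rw [map_zero] at hderiv
  exact Subtype.ext ((hΛ J J.2).eq_zero hab hJ hderiv.symm)

theorem isSymmetric (hS : IsRiccatiOperator Λ t S) (hself : RiccatiSelfAdjoint Λ)
    (hrange : LinearMap.range (evalMap Λ t) = normalSpace I γ (Set.Icc a b) t) :
    S.IsSymmetric := by
  have hsurj (v : normalSpace I γ (Set.Icc a b) t) :
      ∃ J : Λ, (v : TangentSpace I (γ t)) = (J : FieldAlong I γ (Set.Icc a b)) t := by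
    obtain ⟨J, hJ⟩ := hrange.ge v.2
    exact ⟨J, by rw [← hJ, evalMap_apply t.2]⟩
  intro v w
  obtain ⟨J, hJ⟩ := hsurj v
  obtain ⟨K, hK⟩ := hsurj w
  rw [Submodule.coe_inner, Submodule.coe_inner, hS J J.2 v hJ, hS K K.2 w hK, hJ, hK]
  exact hself J J.2 K K.2 t

theorem inner_covDeriv_le (hS : IsRiccatiOperator Λ t S) (hsymm : S.IsSymmetric) {c : ℝ}
    (hc : ∀ μ : ℝ, S.HasEigenvalue μ → μ ≤ c) {J : FieldAlong I γ (Set.Icc a b)} (hJ : J ∈ Λ)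
    (hJn : J.IsNormal) : ⟪J.covDeriv t, J t⟫ ≤ c * ‖J t‖ ^ 2 := by
  have hle := inner_apply_le_of_hasEigenvalue_le hsymm hc ⟨J t, mem_normalSpace_iff.2 (hJn t)⟩
  rwa [Submodule.coe_inner, hS J hJ _ rfl] at hle

end IsRiccatiOperator

theorem isRiccatiFamily_evalMap {α : ℝ} (hα : α < Real.pi)
    {Λ : Submodule ℝ (FieldAlong I γ (Set.Icc α Real.pi))}
    (hγ : IsGeodesicOn I γ (Set.Icc α Real.pi))
    (hunit : ∀ t, ‖velocity I γ (Set.Icc α Real.pi) t‖ = 1)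
    (hsec : ∀ (t : Set.Icc α Real.pi) (u : TangentSpace I (γ t)),
      LinearIndependent ℝ ![u, velocity I γ _ t] → 1 ≤ sectionalCurvature u (velocity I γ _ t))
    (hΛ : ∀ J ∈ Λ, J.IsJacobi ∧ J.IsNormal)
    (hdim : Module.finrank ℝ Λ + 1 = Module.finrank ℝ E) (hself : RiccatiSelfAdjoint Λ) :
    IsRiccatiFamily α (evalMap Λ)
      (evalDerivMap (uniqueDiffOn_Icc hα) fun J hJ ↦ (hΛ J hJ).1.1)
      (fun t J K ↦ ⟪curvature (evalMap Λ t J) ((velocity I γ (Set.Icc α Real.pi)).ext t)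
        ((velocity I γ (Set.Icc α Real.pi)).ext t), evalMap Λ t K⟫) := by
  have hs := uniqueDiffOn_Icc hα
  have hsm (J : Λ) : (J : FieldAlong I γ (Set.Icc α Real.pi)).IsSmooth := (hΛ J J.2).1.1
  have hself' {t : ℝ} (ht : t ∈ Set.Icc α Real.pi) :=
    hself.inner_evalDerivMap hs (fun J hJ ↦ (hΛ J hJ).1.1) ht
  have hzero {t : ℝ} (ht : t ∈ Set.Icc α Real.pi) {J : Λ} :=
    eq_zero_of_evalMap_of_evalDerivMap hα (fun J hJ ↦ (hΛ J hJ).1) ht (J := J)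
  refine
    { selfAdjoint := fun _ ↦ hself'
      hasDeriv_inner := fun t ht J K ↦ ?_
      hasDeriv_inner' := fun t ht J K ↦ ?_
      norm_sq_le_curv := fun t ht J ↦ ?_
      curv_eq_zero := fun t _ J K hK ↦ by simp only [hK, inner_zero_right]
      eq_zero := fun _ ht _ ↦ hzero ht
      exists_decomp := fun t ht ↦ ?_ }
  · refine (FieldAlong.hasDerivWithinAt_inner hs (hsm J) (hsm K) ⟨t, ht⟩).congr_deriv ?_
    rw [two_mul]
    nth_rw 2 [hself' ht J K]
    simp only [evalMap_apply ht, evalDerivMap_apply _ _ ht]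
  · refine (FieldAlong.hasDerivWithinAt_inner hs ((hsm J).covDeriv hs) (hsm K)
      ⟨t, ht⟩).congr_deriv ?_
    rw [eq_neg_of_add_eq_zero_left ((hΛ J J.2).1.2 ⟨t, ht⟩), inner_neg_left, neg_add_eq_sub]
    simp only [evalMap_apply ht, evalDerivMap_apply _ _ ht, FieldAlong.ext_of_mem _ ht]
  · simp only [evalMap_apply ht, FieldAlong.ext_of_mem _ ht]
    exact sq_norm_le_inner_curvature (hunit _) ((hΛ J J.2).2 ⟨t, ht⟩) (hsec _ _)
  · have := finiteDimensional_of_isJacobi hα fun J hJ ↦ (hΛ J hJ).1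
    have hvel : velocity I γ _ ⟨t, ht⟩ ≠ 0 := norm_ne_zero_iff.1 (by simp [hunit])
    refine exists_eq_add_of_selfAdjoint (N := normalSpace I γ _ ⟨t, ht⟩) (hself' ht)
      (fun _ ↦ hzero ht) (fun J ↦ ?_) (fun J ↦ ?_)
      (Nat.add_right_cancel ((finrank_normalSpace hvel).trans hdim.symm))
    · rw [evalMap_apply ht]
      exact mem_normalSpace_iff.2 ((hΛ J J.2).2 _)
    · rw [evalDerivMap_apply _ _ ht]
      exact mem_normalSpace_iff.2 ((hΛ J J.2).2.covDeriv hγ hs (hsm J) _)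

end RiccatiOperator

/-! ### The splitting -/

section Splitting

variable {E : Type*} [NormedAddCommGroup E] [NormedSpace ℝ E] [FiniteDimensional ℝ E]
  {H : Type*} [TopologicalSpace H] {I : ModelWithCorners ℝ E H}
  {M : Type*} [TopologicalSpace M] [ChartedSpace H M] [IsManifold I ∞ M]
  [RiemannianBundle (fun x : M ↦ TangentSpace I x)]
  [IsContMDiffRiemannianBundle I ∞ E (fun x : M ↦ TangentSpace I x)]
  [CompleteSpace E] {γ : ℝ → M} {s : Set ℝ} {a b α : ℝ}

/-- The span of the fields in `Λ` that vanish at some interior parameter. -/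
def vanishingSpan (Λ : Submodule ℝ (FieldAlong I γ (Set.Icc a b))) :
    Submodule ℝ (FieldAlong I γ (Set.Icc a b)) :=
  Submodule.span ℝ {J | J ∈ Λ ∧ ∃ t : Set.Icc a b, (t : ℝ) ∈ Set.Ioo a b ∧ J t = 0}

omit [RiemannianBundle (fun x : M ↦ TangentSpace I x)]
  [IsContMDiffRiemannianBundle I ∞ E (fun x : M ↦ TangentSpace I x)] [CompleteSpace E] in
theorem isSmooth_zero (hγ : ContMDiffOn 𝓘(ℝ, ℝ) I ∞ γ s) (hs : UniqueDiffOn ℝ s) :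
    (0 : FieldAlong I γ s).IsSmooth :=
  zero_smul ℝ (velocity I γ s) ▸ (isSmooth_velocity hγ hs).smul 0

theorem covDeriv_zero (hγ : ContMDiffOn 𝓘(ℝ, ℝ) I ∞ γ s) (hs : UniqueDiffOn ℝ s) :
    (0 : FieldAlong I γ s).covDeriv = 0 := by
  have h := FieldAlong.covDeriv_smul hs 0 (isSmooth_zero (I := I) hγ hs)
  rwa [zero_smul, zero_smul] at h

/-- The fields in `Λ` that are products of the sine and a parallel field. -/
def sineFields (hγ : ContMDiffOn 𝓘(ℝ, ℝ) I ∞ γ s) (hs : UniqueDiffOn ℝ s)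
    (Λ : Submodule ℝ (FieldAlong I γ s)) : Submodule ℝ (FieldAlong I γ s) where
  carrier := {J | J ∈ Λ ∧ ∃ F : FieldAlong I γ s, F.IsParallel ∧ ∀ t, J t = Real.sin t • F t}
  add_mem' := by
    rintro J K ⟨hJ, F, hF, hJF⟩ ⟨hK, G, hG, hKG⟩
    refine ⟨Λ.add_mem hJ hK, F + G, ⟨hF.1.add hG.1, ?_⟩, fun t ↦ ?_⟩
    · rw [FieldAlong.covDeriv_add hs hF.1 hG.1, hF.2, hG.2, add_zero]
    · rw [Pi.add_apply, Pi.add_apply, hJF, hKG, smul_add]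
  zero_mem' := ⟨Λ.zero_mem, 0, ⟨isSmooth_zero hγ hs, covDeriv_zero hγ hs⟩, fun t ↦ by simp⟩
  smul_mem' := by
    rintro c J ⟨hJ, F, hF, hJF⟩
    refine ⟨Λ.smul_mem c hJ, c • F, ⟨hF.1.smul c, ?_⟩, fun t ↦ ?_⟩
    · rw [FieldAlong.covDeriv_smul hs c hF.1, hF.2, smul_zero]
    · rw [Pi.smul_apply, Pi.smul_apply, hJF, smul_comm]

theorem FieldAlong.IsSmooth.eq_zero_of_Ioo (hab : a < b) {V : FieldAlong I γ (Set.Icc a b)}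
    (hV : V.IsSmooth) (h : ∀ t : Set.Icc a b, (t : ℝ) ∈ Set.Ioo a b → V t = 0) : V = 0 := by
  have hzero : Set.EqOn (fun r ↦ ⟪V.ext r, V.ext r⟫) (fun _ ↦ 0) (Set.Ioo a b) := fun r hr ↦ by
    simp only [FieldAlong.ext_of_mem V (Set.Ioo_subset_Icc_self hr), h ⟨r, _⟩ hr, inner_zero_left]
  funext t
  rw [Pi.zero_apply, ← inner_self_eq_zero (𝕜 := ℝ), ← V.ext_apply t]
  exact hzero.of_subset_closure (hV.continuousOn_inner (uniqueDiffOn_Icc hab) hV)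
    continuousOn_const Set.Ioo_subset_Icc_self (closure_Ioo hab.ne).ge t.2

theorem covDeriv_covDeriv_add_eq_zero (hα : α ∈ Set.Ico 0 Real.pi)
    {J : FieldAlong I γ (Set.Icc α Real.pi)} (hJ : J.IsSmooth)
    (hcot : ∀ t : Set.Icc α Real.pi, Real.sin t • J.covDeriv t = Real.cos t • J t) :
    J.covDeriv.covDeriv + J = 0 := by
  have hs := uniqueDiffOn_Icc hα.2
  have hJ' := hJ.covDeriv hs
  have hsin : ContDiffOn ℝ ∞ Real.sin (Set.Icc α Real.pi) := Real.contDiff_sin.contDiffOn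
  have hcos : ContDiffOn ℝ ∞ Real.cos (Set.Icc α Real.pi) := Real.contDiff_cos.contDiffOn
  have hmul : J.covDeriv.mulBy Real.sin = J.mulBy Real.cos := funext hcot
  refine ((hJ'.covDeriv hs).add hJ).eq_zero_of_Ioo hα.2 fun t ht ↦ ?_
  have hsint := Real.sin_pos_of_pos_of_lt_pi (hα.1.trans_lt ht.1) ht.2
  have hderiv := congrFun (congrArg FieldAlong.covDeriv hmul) t
  rw [FieldAlong.covDeriv_mulBy_apply hs hsin hJ' (Real.hasDerivAt_sin t).hasDerivWithinAt,
    FieldAlong.covDeriv_mulBy_apply hs hcos hJ (Real.hasDerivAt_cos t).hasDerivWithinAt,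
    add_comm, add_left_inj, ← sub_eq_zero, neg_smul, sub_neg_eq_add, ← smul_add] at hderiv
  exact (smul_eq_zero.1 hderiv).resolve_left hsint.ne'

/-- The parallel field is `F = sin t • J + cos t • J'`. -/
theorem exists_isParallel_of_covDeriv_eq_cot_smul (hα : α ∈ Set.Ico 0 Real.pi)
    {J : FieldAlong I γ (Set.Icc α Real.pi)} (hJ : J.IsSmooth)
    (hcot : ∀ t : Set.Icc α Real.pi, (t : ℝ) ∈ Set.Ioo α Real.pi →
      J.covDeriv t = Real.cot t • J t) :
    ∃ F : FieldAlong I γ (Set.Icc α Real.pi), F.IsParallel ∧ ∀ t, J t = Real.sin t • F t := by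
  have hs := uniqueDiffOn_Icc hα.2
  have hJ' := hJ.covDeriv hs
  have hsin : ContDiffOn ℝ ∞ Real.sin (Set.Icc α Real.pi) := Real.contDiff_sin.contDiffOn
  have hcos : ContDiffOn ℝ ∞ Real.cos (Set.Icc α Real.pi) := Real.contDiff_cos.contDiffOn
  have hcot' (t : Set.Icc α Real.pi) : Real.sin t • J.covDeriv t = Real.cos t • J t := by
    have hsub : J.covDeriv.mulBy Real.sin + (-1 : ℝ) • J.mulBy Real.cos = 0 := by
      refine ((hJ'.mulBy hsin).add ((hJ.mulBy hcos).smul (-1))).eq_zero_of_Ioo hα.2 fun t ht ↦ ?_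
      have hsint := Real.sin_pos_of_pos_of_lt_pi (hα.1.trans_lt ht.1) ht.2
      simp only [Pi.add_apply, Pi.smul_apply, FieldAlong.mulBy, hcot t ht, smul_smul,
        Real.cot_eq_cos_div_sin, mul_div_cancel₀ _ hsint.ne']
      module
    have h := congrFun hsub t
    rwa [Pi.add_apply, Pi.smul_apply, neg_one_smul, ← sub_eq_add_neg, Pi.zero_apply,
      sub_eq_zero] at h
  have hJac (t : Set.Icc α Real.pi) : J.covDeriv.covDeriv t = -J t :=
    eq_neg_of_add_eq_zero_left (congrFun (covDeriv_covDeriv_add_eq_zero hα hJ hcot') t)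
  refine ⟨J.mulBy Real.sin + J.covDeriv.mulBy Real.cos,
    ⟨(hJ.mulBy hsin).add (hJ'.mulBy hcos), ?_⟩, fun t ↦ ?_⟩
  · rw [FieldAlong.covDeriv_add hs (hJ.mulBy hsin) (hJ'.mulBy hcos)]
    funext t
    rw [Pi.add_apply, FieldAlong.covDeriv_mulBy_apply hs hsin hJ
        (Real.hasDerivAt_sin t).hasDerivWithinAt,
      FieldAlong.covDeriv_mulBy_apply hs hcos hJ' (Real.hasDerivAt_cos t).hasDerivWithinAt, hJac]
    simp only [Pi.zero_apply]
    module
  · calc J t = (Real.sin t ^ 2 + Real.cos t ^ 2) • J t := by rw [Real.sin_sq_add_cos_sq, one_smul]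
      _ = Real.sin t • Real.sin t • J t + Real.cos t • Real.cos t • J t := by module
      _ = Real.sin t • (Real.sin t • J t + Real.cos t • J.covDeriv t) := by
        rw [← hcot', smul_add, smul_comm (Real.cos t)]

/-- Self-adjointness makes `⟪J, F⟫ / sin` constant on the open interval. -/
theorem inner_eq_zero_of_isParallel (hα : α ∈ Set.Ico 0 Real.pi)
    {J F : FieldAlong I γ (Set.Icc α Real.pi)} (hJ : J.IsSmooth) (hF : F.IsParallel)
    (hself : ∀ t, ⟪J.covDeriv t, F.mulBy Real.sin t⟫ = ⟪J t, (F.mulBy Real.sin).covDeriv t⟫)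
    {t₀ : Set.Icc α Real.pi} (ht₀ : (t₀ : ℝ) ∈ Set.Ioo α Real.pi) (hJt₀ : J t₀ = 0)
    (t : Set.Icc α Real.pi) : ⟪J t, F t⟫ = 0 := by
  have hs := uniqueDiffOn_Icc hα.2
  have hsin : ContDiffOn ℝ ∞ Real.sin (Set.Icc α Real.pi) := Real.contDiff_sin.contDiffOn
  set φ : ℝ → ℝ := fun r ↦ ⟪J.ext r, F.ext r⟫
  have hφt (t : Set.Icc α Real.pi) : φ t = ⟪J t, F t⟫ := by simp only [φ, FieldAlong.ext_apply]
  have hφ (t : Set.Icc α Real.pi) :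
      HasDerivWithinAt φ ⟪J.covDeriv t, F t⟫ (Set.Icc α Real.pi) t :=
    (FieldAlong.hasDerivWithinAt_inner hs hJ hF.1 t).congr_deriv (by
      rw [hF.2, Pi.zero_apply, inner_zero_right, add_zero])
  have hode (t : Set.Icc α Real.pi) : ⟪J.covDeriv t, F t⟫ * Real.sin t = φ t * Real.cos t := by
    have h := hself t
    rw [FieldAlong.covDeriv_mulBy_apply hs hsin hF.1 (Real.hasDerivAt_sin t).hasDerivWithinAt,
      hF.2, Pi.zero_apply, smul_zero, add_zero, FieldAlong.mulBy, inner_smul_right,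
      inner_smul_right] at h
    rw [hφt, mul_comm, h, mul_comm]
  have hsin_pos {r : ℝ} (hr : r ∈ Set.Ioo α Real.pi) : Real.sin r ≠ 0 :=
    (Real.sin_pos_of_pos_of_lt_pi (hα.1.trans_lt hr.1) hr.2).ne'
  have hquot (r : ℝ) (hr : r ∈ Set.Ioo α Real.pi) :
      HasDerivAt (fun r ↦ φ r / Real.sin r) 0 r := by
    have hr' := Set.Ioo_subset_Icc_self hr
    refine (((hφ ⟨r, hr'⟩).hasDerivAt (Icc_mem_nhds hr.1 hr.2)).div (Real.hasDerivAt_sin r)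
      (hsin_pos hr)).congr_deriv ?_
    rw [hode ⟨r, hr'⟩, sub_self, zero_div]
  have hzero : Set.EqOn φ (fun _ ↦ 0) (Set.Ioo α Real.pi) := fun r hr ↦ by
    have hconst := isOpen_Ioo.is_const_of_deriv_eq_zero isPreconnected_Ioo
      (fun r hr ↦ (hquot r hr).differentiableAt.differentiableWithinAt)
      (fun r hr ↦ (hquot r hr).deriv) hr ht₀
    simp only [hφt, hJt₀, inner_zero_left, zero_div] at hconst
    exact (div_eq_zero_iff.1 hconst).resolve_right (hsin_pos hr)
  rw [← hφt]
  exact hzero.of_subset_closure (hJ.continuousOn_inner hs hF.1) continuousOn_const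
    Set.Ioo_subset_Icc_self (closure_Ioo hα.2.ne).ge t.2

theorem inner_eq_zero_of_mem_vanishingSpan (hα : α ∈ Set.Ico 0 Real.pi)
    (hγ : ContMDiffOn 𝓘(ℝ, ℝ) I ∞ γ (Set.Icc α Real.pi))
    {Λ : Submodule ℝ (FieldAlong I γ (Set.Icc α Real.pi))} (hΛ : ∀ J ∈ Λ, J.IsSmooth)
    (hself : RiccatiSelfAdjoint Λ) {J K : FieldAlong I γ (Set.Icc α Real.pi)}
    (hJ : J ∈ vanishingSpan Λ) (hK : K ∈ sineFields hγ (uniqueDiffOn_Icc hα.2) Λ)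
    (t : Set.Icc α Real.pi) : ⟪J t, K t⟫ = 0 := by
  obtain ⟨hKΛ, F, hF, hKF⟩ := hK
  obtain rfl : K = F.mulBy Real.sin := funext hKF
  induction hJ using Submodule.span_induction with
  | mem J hJ =>
    obtain ⟨hJΛ, t₀, ht₀, hJt₀⟩ := hJ
    rw [FieldAlong.mulBy, inner_smul_right, inner_eq_zero_of_isParallel hα (hΛ J hJΛ) hF
      (hself J hJΛ _ hKΛ) ht₀ hJt₀ t, mul_zero]
  | zero => rw [Pi.zero_apply, inner_zero_left]
  | add J L _ _ hJ hL => rw [Pi.add_apply, inner_add_left, hJ, hL, add_zero]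
  | smul c J _ hJ => rw [Pi.smul_apply, inner_smul_left, hJ, mul_zero]

theorem IsRiccatiOperator.inner_evalDerivMap_le {Λ : Submodule ℝ (FieldAlong I γ (Set.Icc a b))}
    (hab : a < b) {t : Set.Icc a b} {S : Module.End ℝ (normalSpace I γ (Set.Icc a b) t)}
    (hS : IsRiccatiOperator Λ t S) (hvel : velocity I γ (Set.Icc a b) t ≠ 0)
    (hΛ : ∀ J ∈ Λ, J.IsJacobi ∧ J.IsNormal) (hdim : Module.finrank ℝ Λ + 1 = Module.finrank ℝ E)
    (hself : RiccatiSelfAdjoint Λ) {c : ℝ} (hc : ∀ μ : ℝ, S.HasEigenvalue μ → μ ≤ c) (J : Λ) :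
    ⟪evalDerivMap (uniqueDiffOn_Icc hab) (fun J hJ ↦ (hΛ J hJ).1.1) t J, evalMap Λ t J⟫
      ≤ c * ‖evalMap Λ t J‖ ^ 2 := by
  have hsymm := hS.isSymmetric hself (range_evalMap (fun J hJ ↦ (hΛ J hJ).2) hvel hdim fun _ ↦
    hS.eq_zero hab fun J hJ ↦ (hΛ J hJ).1)
  rw [evalMap_apply t.2, evalDerivMap_apply _ _ t.2]
  exact hS.inner_covDeriv_le hsymm hc J.2 (hΛ J J.2).2

theorem exists_mem_sineFields (hα : α ∈ Set.Ico 0 Real.pi)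
    {Λ : Submodule ℝ (FieldAlong I γ (Set.Icc α Real.pi))} (hΛ : ∀ J ∈ Λ, J.IsJacobi)
    (hγ : ContMDiffOn 𝓘(ℝ, ℝ) I ∞ γ (Set.Icc α Real.pi)) {ρ : ℝ → Λ → Λ → ℝ}
    (h : IsRiccatiFamily α (evalMap Λ)
      (evalDerivMap (uniqueDiffOn_Icc hα.2) fun J hJ ↦ (hΛ J hJ).1) ρ)
    (hleft : 0 < α → (∀ J, evalMap Λ α J = 0 → J = 0) ∧
      ∀ J, ⟪evalDerivMap (uniqueDiffOn_Icc hα.2) (fun J hJ ↦ (hΛ J hJ).1) α J, evalMap Λ α J⟫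
        ≤ Real.cot α * ‖evalMap Λ α J‖ ^ 2)
    {lam : Λ →ₗ[ℝ] ℝ} (hlam : lam ≠ 0)
    (hker : ∀ J : Λ, (J : FieldAlong I γ (Set.Icc α Real.pi)) ∈ vanishingSpan Λ → lam J = 0) :
    ∃ J : Λ, lam J = 1 ∧
      (J : FieldAlong I γ (Set.Icc α Real.pi)) ∈ sineFields hγ (uniqueDiffOn_Icc hα.2) Λ := by
  have := finiteDimensional_of_isJacobi hα.2 hΛ
  obtain ⟨J, hlamJ, hJ⟩ := h.exists_cot_field hα hleft hlam fun t ht J hJ ↦ by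
    rw [evalMap_apply (Set.Ioo_subset_Icc_self ht)] at hJ
    exact hker J (Submodule.subset_span ⟨J.2, _, ht, hJ⟩)
  refine ⟨J, hlamJ, J.2, exists_isParallel_of_covDeriv_eq_cot_smul hα (hΛ J J.2).1 fun t ht ↦ ?_⟩
  have hcot := hJ t ht
  rwa [evalMap_apply t.2, evalDerivMap_apply _ _ t.2] at hcot

theorem vanishingSpan_sup_sineFields (hα : α ∈ Set.Ico 0 Real.pi)
    {Λ : Submodule ℝ (FieldAlong I γ (Set.Icc α Real.pi))} (hΛ : ∀ J ∈ Λ, J.IsJacobi)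
    (hγ : ContMDiffOn 𝓘(ℝ, ℝ) I ∞ γ (Set.Icc α Real.pi)) {ρ : ℝ → Λ → Λ → ℝ}
    (h : IsRiccatiFamily α (evalMap Λ)
      (evalDerivMap (uniqueDiffOn_Icc hα.2) fun J hJ ↦ (hΛ J hJ).1) ρ)
    (hleft : 0 < α → (∀ J, evalMap Λ α J = 0 → J = 0) ∧
      ∀ J, ⟪evalDerivMap (uniqueDiffOn_Icc hα.2) (fun J hJ ↦ (hΛ J hJ).1) α J, evalMap Λ α J⟫
        ≤ Real.cot α * ‖evalMap Λ α J‖ ^ 2) :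
    vanishingSpan Λ ⊔ sineFields hγ (uniqueDiffOn_Icc hα.2) Λ = Λ := by
  set W := vanishingSpan Λ ⊔ sineFields hγ (uniqueDiffOn_Icc hα.2) Λ
  refine le_antisymm (sup_le (Submodule.span_le.2 fun J hJ ↦ hJ.1) fun J hJ ↦ hJ.1) ?_
  by_contra hnot
  have hlt : W.comap Λ.subtype < ⊤ :=
    lt_top_iff_ne_top.2 fun htop ↦ hnot (Submodule.comap_subtype_eq_top.1 htop)
  obtain ⟨lam, hlam, hker⟩ := Submodule.exists_le_ker_of_lt_top _ hlt
  have hlamW {J : Λ} (hJ : (J : FieldAlong I γ (Set.Icc α Real.pi)) ∈ W) : lam J = 0 := hker hJ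
  obtain ⟨J, hlamJ, hJ⟩ := exists_mem_sineFields hα hΛ hγ h hleft hlam fun J hJ ↦
    hlamW (Submodule.mem_sup_left hJ)
  exact one_ne_zero (hlamJ.symm.trans (hlamW (Submodule.mem_sup_right hJ)))

end Splitting

end JacobiSplitting

end

open JacobiSplitting in
theorem theoremB_general {E : Type*} [NormedAddCommGroup E] [NormedSpace ℝ E]
    [FiniteDimensional ℝ E] {H : Type*} [TopologicalSpace H] {I : ModelWithCorners ℝ E H}
    {M : Type*} [TopologicalSpace M] [ChartedSpace H M] [IsManifold I ∞ M]
    [RiemannianBundle (fun x : M ↦ TangentSpace I x)]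
    [IsContMDiffRiemannianBundle I ∞ E (fun x : M ↦ TangentSpace I x)]
    {α : ℝ} (hα : α ∈ Set.Ico 0 Real.pi)
    (γ : ℝ → M) (hγ : IsGeodesicOn I γ (Set.Icc α Real.pi))
    (hγ_unit : ∀ t, ‖velocity I γ (Set.Icc α Real.pi) t‖ = 1)
    (hsec : ∀ (t : Set.Icc α Real.pi) (u : TangentSpace I (γ t)),
      LinearIndependent ℝ ![u, velocity I γ _ t] → 1 ≤ sectionalCurvature u (velocity I γ _ t))
    (Λ : Submodule ℝ (FieldAlong I γ (Set.Icc α Real.pi)))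
    (hΛ : ∀ J ∈ Λ, J.IsJacobi ∧ J.IsNormal)
    (hdim : Module.finrank ℝ Λ + 1 = Module.finrank ℝ E)
    (hself : RiccatiSelfAdjoint Λ)
    (hbound : 0 < α →
      ∃ S : Module.End ℝ (normalSpace I γ (Set.Icc α Real.pi) ⟨α, Set.left_mem_Icc.2 hα.2.le⟩),
        IsRiccatiOperator Λ ⟨α, Set.left_mem_Icc.2 hα.2.le⟩ S ∧
          ∀ μ : ℝ, S.HasEigenvalue μ → μ ≤ Real.cot α) :
    ∃ Z P : Submodule ℝ (FieldAlong I γ (Set.Icc α Real.pi)),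
      Z = Submodule.span ℝ
        {J | J ∈ Λ ∧ ∃ t : Set.Icc α Real.pi, (t : ℝ) ∈ Set.Ioo α Real.pi ∧ J t = 0} ∧
      (P : Set (FieldAlong I γ (Set.Icc α Real.pi))) =
        {J | J ∈ Λ ∧ ∃ F : FieldAlong I γ (Set.Icc α Real.pi),
          F.IsParallel ∧ ∀ t, J t = Real.sin t • F t} ∧
      Z ⊔ P = Λ ∧ Disjoint Z P ∧
      ∀ J ∈ Z, ∀ K ∈ P, ∀ t, inner ℝ (J t) (K t) = 0 := by
  have := FiniteDimensional.complete ℝ E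
  have hJac (J) (hJ : J ∈ Λ) : J.IsJacobi := (hΛ J hJ).1
  have hfam := isRiccatiFamily_evalMap hα.2 hγ hγ_unit hsec hΛ hdim hself
  have horth : ∀ J ∈ vanishingSpan Λ, ∀ K ∈ sineFields hγ.1 (uniqueDiffOn_Icc hα.2) Λ, ∀ t,
      inner ℝ (J t) (K t) = 0 := fun J hJ K hK ↦
    inner_eq_zero_of_mem_vanishingSpan hα hγ.1 (fun J hJ ↦ (hJac J hJ).1) hself hJ hK
  refine ⟨_, _, rfl, rfl, vanishingSpan_sup_sineFields hα hJac hγ.1 hfam fun hα₀ ↦ ?_,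
    Submodule.disjoint_def.2 fun J hJZ hJP ↦
      funext fun t ↦ inner_self_eq_zero.1 (horth J hJZ J hJP t), horth⟩
  obtain ⟨S, hS, hc⟩ := hbound hα₀
  have hvel : velocity I γ (Set.Icc α Real.pi) ⟨α, Set.left_mem_Icc.2 hα.2.le⟩ ≠ 0 :=
    norm_ne_zero_iff.1 (by simp [hγ_unit])
  exact ⟨fun _ ↦ hS.eq_zero hα.2 hJac, hS.inner_evalDerivMap_le hα.2 hvel hΛ hdim hself hc⟩

open JacobiSplitting in
theorem theoremB {n : ℕ} {M : Type*} [EMetricSpace M]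
    [ChartedSpace (EuclideanSpace ℝ (Fin n)) M] [IsManifold (𝓡 n) ∞ M]
    [RiemannianBundle (fun x : M ↦ TangentSpace (𝓡 n) x)]
    [IsContMDiffRiemannianBundle (𝓡 n) ∞ (EuclideanSpace ℝ (Fin n))
      (fun x : M ↦ TangentSpace (𝓡 n) x)]
    [IsRiemannianManifold (𝓡 n) M] [CompleteSpace M]
    (hsec : ∀ (x : M) (u v : TangentSpace (𝓡 n) x),
      LinearIndependent ℝ ![u, v] → 1 ≤ sectionalCurvature u v)
    {α : ℝ} (hα : α ∈ Set.Ico 0 Real.pi)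
    (γ : ℝ → M) (hγ : IsGeodesicOn (𝓡 n) γ (Set.Icc α Real.pi))
    (hγ_unit : ∀ t, ‖velocity (𝓡 n) γ (Set.Icc α Real.pi) t‖ = 1)
    (Λ : Submodule ℝ (FieldAlong (𝓡 n) γ (Set.Icc α Real.pi)))
    (hΛ : ∀ J ∈ Λ, J.IsJacobi ∧ J.IsNormal)
    (hdim : Module.finrank ℝ Λ + 1 = n)
    (hself : RiccatiSelfAdjoint Λ)
    -- for `α = 0` the bound is `cot 0 = ∞` and there is no condition
    (hbound : 0 < α →
      ∃ S : Module.End ℝ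
          (normalSpace (𝓡 n) γ (Set.Icc α Real.pi) ⟨α, Set.left_mem_Icc.2 hα.2.le⟩),
        IsRiccatiOperator Λ ⟨α, Set.left_mem_Icc.2 hα.2.le⟩ S ∧
          ∀ μ : ℝ, S.HasEigenvalue μ → μ ≤ Real.cot α) :
    ∃ Z P : Submodule ℝ (FieldAlong (𝓡 n) γ (Set.Icc α Real.pi)),
      Z = Submodule.span ℝ
        {J | J ∈ Λ ∧ ∃ t : Set.Icc α Real.pi, (t : ℝ) ∈ Set.Ioo α Real.pi ∧ J t = 0} ∧
      (P : Set (FieldAlong (𝓡 n) γ (Set.Icc α Real.pi))) =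
        {J | J ∈ Λ ∧ ∃ F : FieldAlong (𝓡 n) γ (Set.Icc α Real.pi),
          F.IsParallel ∧ ∀ t, J t = Real.sin t • F t} ∧
      Z ⊔ P = Λ ∧ Disjoint Z P ∧
      ∀ J ∈ Z, ∀ K ∈ P, ∀ t, inner ℝ (J t) (K t) = 0 := by
  exact theoremB_general hα γ hγ hγ_unit (fun t u ↦ hsec (γ t) u _) Λ hΛ
    (hdim.trans finrank_euclideanSpace_fin.symm) hself hbound
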